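/- Let $k$ be an algebraically closed field of characteristic $p>2$ and let $n\ge 1$. Let $\mathrm{O}_n(k)$ be the orthogonal group of the standard symmetric bilinear form on $k^n$, let $\mathrm{SO}_n(k)$ be its subgroup of elements of determinant $1$, let $\mathfrak{so}_n(k)$ be the Lie algebra of skew-symmetric $n\times n$ matrices, on which both groups act by conjugation, and let $\mathcal N\subseteq\mathfrak{so}_n(k)$ be the set of nilpotent elements. For $x\in\mathcal N$ and a partition $\lambda=(\lambda_1\ge\lambda_2\ge\cdots)$ of $n$ (with $\lambda_i=0$ beyond the last part) write $x\sim\lambda$ if the Jordan blocks of $x$ have sizes $\lambda_1,\lambda_2,\dots$. Put $${}^1\mathcal N^p=\{x\in\mathcal N \mid x\sim\lambda \text{ with } \lambda_1\le p,\ \lambda_2<p\}.$$ An $\mathfrak{sl}_2$-triple in $\mathfrak{so}_n(k)$ is a triple $(e,h,f)$ of elements with $[h,e]=2e$, $[h,f]=-2f$, $[e,f]=h$ (the zero triple is allowed); groups act on triples by simultaneous conjugation. A partition is very even if all its parts are even and each occurs with even multiplicity. (a) ${}^1\mathcal N^p$ has the $\mathfrak{sl}_2$-property for $G=\mathrm{SO}_n(k)$.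 That is, ${}^1\mathcal N^p$ is a $G$-stable Zariski closed subset of $\mathfrak{so}_n(k)$ contained in $\mathcal N$, and the map $$\{G\text{-orbits of } \mathfrak{sl}_2\text{-triples } (e,h,f) \text{ with } e,f\in{}^1\mathcal N^p\}\longrightarrow\{G\text{-orbits in } {}^1\mathcal N^p\}$$ that sends the $G$-orbit of $(e,h,f)$ to the $G$-orbit of $e$ is a bijection. (b) Let $x\in\mathcal N$ with $x\sim\lambda$. If $\lambda$ is very even, then the $\mathrm{O}_n(k)$-orbit of $x$ is the union of exactly two $\mathrm{SO}_n(k)$-orbits; otherwise it is a single $\mathrm{SO}_n(k)$-orbit. (c) Let $(e,h,f)$ be an $\mathfrak{sl}_2$-triple in $\mathfrak{so}_n(k)$ with $e,f\in{}^1\mathcal N^p$. Then $(e',h',f')\mapsto e'$ induces a bijection from the set of $\mathrm{SO}_n(k)$-orbits contained in the $\mathrm{O}_n(k)$-orbit of $(e,h,f)$ to the set of $\mathrm{SO}_n(k)$-orbits contained in the $\mathrm{O}_n(k)$-orbit of $e$. In particular, by (b), the $\mathrm{O}_n(k)$-orbit of $(e,h,f)$ splits into two $\mathrm{SO}_n(k)$-orbits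 if the Jordan type of $e$ is very even, and is a single $\mathrm{SO}_n(k)$-orbit otherwise. -/

import Mathlib

attribute [local instance] LieRing.ofAssociativeRing

noncomputable section

namespace SlTwoOrbits

/-- An `sl₂`-triple `(e, h, f)` in a Lie ring `L`; in contrast to Mathlib's `IsSl2Triple`,
`h = 0` is allowed. -/
@[ext]
structure Triple (L : Type*) [LieRing L] where
  e : L
  h : L
  f : L
  lie_h_e : ⁅h, e⁆ = 2 • e
  lie_h_f : ⁅h, f⁆ = -(2 • f)
  lie_e_f : ⁅e, f⁆ = h

/-- The orthogonal group `O_n(k)` of the standard symmetric bilinear form on `k^n`. -/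
abbrev OGroup (n : ℕ) (k : Type*) [Field k] := Matrix.orthogonalGroup (Fin n) k

/-- The Lie algebra `so_n(k)` of skew-symmetric `n × n` matrices. -/
abbrev so (n : ℕ) (k : Type*) [Field k] : LieSubalgebra k (Matrix (Fin n) (Fin n) k) :=
  LieAlgebra.Orthogonal.so (Fin n) k

variable {n : ℕ} {k : Type*} [Field k]

/-- The special orthogonal group, as a subgroup of `O_n(k)`. -/
def SO (n : ℕ) (k : Type*) [Field k] : Subgroup (OGroup n k) where
  carrier := {g | (g : Matrix (Fin n) (Fin n) k).det = 1}
  one_mem' := by simp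
  mul_mem' := by
    intro a b ha hb
    simp only [Set.mem_ofPred_eq] at ha hb
    simp [Matrix.det_mul, ha, hb]
  inv_mem' := by
    intro a ha
    simp only [Set.mem_ofPred_eq] at ha ⊢
    have h : ((a * a⁻¹ : OGroup n k) : Matrix (Fin n) (Fin n) k).det = 1 := by simp
    rw [Submonoid.coe_mul, Matrix.det_mul, ha, one_mul] at h
    exact h

theorem coe_inv_eq_transpose (g : OGroup n k) :
    ((g⁻¹ : OGroup n k) : Matrix (Fin n) (Fin n) k) =
      (g : Matrix (Fin n) (Fin n) k).transpose := by
  have h1 : (g : Matrix (Fin n) (Fin n) k) * (g : Matrix (Fin n) (Fin n) k).transpose = 1 :=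
    Matrix.mem_orthogonalGroup_iff (Fin n) k |>.1 g.2
  have h2 : ((g⁻¹ : OGroup n k) : Matrix (Fin n) (Fin n) k) * g = 1 := by
    rw [← Submonoid.coe_mul, inv_mul_cancel, Submonoid.coe_one]
  exact left_inv_eq_right_inv h2 h1

theorem coe_inv_mul (g : OGroup n k) :
    ((g⁻¹ : OGroup n k) : Matrix (Fin n) (Fin n) k) * (g : Matrix (Fin n) (Fin n) k) = 1 := by
  rw [← Submonoid.coe_mul, inv_mul_cancel, Submonoid.coe_one]

/-- The adjoint action `(g, x) ↦ g x g⁻¹` of `O_n(k)` on `so_n(k)`. -/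
instance adjointAction : MulAction (OGroup n k) (so n k) where
  smul g x := ⟨(g : Matrix (Fin n) (Fin n) k) * (x : Matrix (Fin n) (Fin n) k) *
      ((g⁻¹ : OGroup n k) : Matrix (Fin n) (Fin n) k), by
    have hx := (LieAlgebra.Orthogonal.mem_so (Fin n) k _).1 x.2
    rw [LieAlgebra.Orthogonal.mem_so, coe_inv_eq_transpose]
    simp [Matrix.transpose_mul, hx, Matrix.mul_assoc]⟩
  one_smul x := Subtype.ext (by
    change ((1 : OGroup n k) : Matrix (Fin n) (Fin n) k) * (x : Matrix (Fin n) (Fin n) k) *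
      (((1 : OGroup n k)⁻¹ : OGroup n k) : Matrix (Fin n) (Fin n) k) = x
    simp)
  mul_smul g g' x := Subtype.ext (by
    change ((g * g' : OGroup n k) : Matrix (Fin n) (Fin n) k) *
        (x : Matrix (Fin n) (Fin n) k) *
        (((g * g')⁻¹ : OGroup n k) : Matrix (Fin n) (Fin n) k) =
      (g : Matrix (Fin n) (Fin n) k) *
        ((g' : Matrix (Fin n) (Fin n) k) * (x : Matrix (Fin n) (Fin n) k) *
          ((g'⁻¹ : OGroup n k) : Matrix (Fin n) (Fin n) k)) *
        ((g⁻¹ : OGroup n k) : Matrix (Fin n) (Fin n) k)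
    rw [mul_inv_rev, Submonoid.coe_mul, Submonoid.coe_mul]
    simp only [Matrix.mul_assoc])

theorem coe_smul (g : OGroup n k) (x : so n k) :
    ((g • x : so n k) : Matrix (Fin n) (Fin n) k) =
      (g : Matrix (Fin n) (Fin n) k) * (x : Matrix (Fin n) (Fin n) k) *
        ((g⁻¹ : OGroup n k) : Matrix (Fin n) (Fin n) k) := rfl

theorem smul_lie (g : OGroup n k) (x y : so n k) : g • ⁅x, y⁆ = ⁅g • x, g • y⁆ := by
  apply Subtype.ext
  have key : ∀ a b : Matrix (Fin n) (Fin n) k,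
      (g : Matrix (Fin n) (Fin n) k) * (a * b) *
        ((g⁻¹ : OGroup n k) : Matrix (Fin n) (Fin n) k) =
      (g : Matrix (Fin n) (Fin n) k) * a *
        ((g⁻¹ : OGroup n k) : Matrix (Fin n) (Fin n) k) *
        ((g : Matrix (Fin n) (Fin n) k) * b *
        ((g⁻¹ : OGroup n k) : Matrix (Fin n) (Fin n) k)) := by
    intro a b
    have h := coe_inv_mul g
    calc _ = (g : Matrix (Fin n) (Fin n) k) * a * 1 * b *
          ((g⁻¹ : OGroup n k) : Matrix (Fin n) (Fin n) k) := by
            simp only [Matrix.mul_assoc, Matrix.one_mul]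
      _ = _ := by rw [← h]; simp only [Matrix.mul_assoc]
  rw [coe_smul, LieSubalgebra.coe_bracket, LieSubalgebra.coe_bracket, coe_smul, coe_smul,
    Ring.lie_def, Ring.lie_def, mul_sub, sub_mul, key, key]

theorem smul_two_nsmul (g : OGroup n k) (x : so n k) : g • (2 • x) = 2 • (g • x) := by
  apply Subtype.ext
  simp [coe_smul, two_nsmul, mul_add, add_mul]

theorem smul_neg' (g : OGroup n k) (x : so n k) : g • (-x) = -(g • x) := by
  apply Subtype.ext
  simp [coe_smul]

/-- The diagonal adjoint action of `O_n(k)` on the `sl₂`-triples in `so_n(k)`. -/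
instance tripleAction : MulAction (OGroup n k) (Triple (so n k)) where
  smul g t :=
    { e := g • t.e
      h := g • t.h
      f := g • t.f
      lie_h_e := by rw [← smul_lie, t.lie_h_e, smul_two_nsmul]
      lie_h_f := by rw [← smul_lie, t.lie_h_f, smul_neg', smul_two_nsmul]
      lie_e_f := by rw [← smul_lie, t.lie_e_f] }
  one_smul t := Triple.ext (one_smul _ t.e) (one_smul _ t.h) (one_smul _ t.f)
  mul_smul g g' t :=
    Triple.ext (mul_smul g g' t.e) (mul_smul g g' t.h) (mul_smul g g' t.f)

/-- The set of `G`-orbits of elements of `S`. -/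
def orbitsOf {Γ X : Type*} [Group Γ] [MulAction Γ X] (G : Subgroup Γ) (S : Set X) :
    Set (Set X) :=
  {C | ∃ x ∈ S, C = MulAction.orbit G x}

/-- The map on sets of triples induced by `(e, h, f) ↦ e`. -/
def eImage {L : Type*} [LieRing L] (C : Set (Triple L)) : Set L := Triple.e '' C

/-- `eImage` sends the `G`-orbit of `(e, h, f)` to the `G`-orbit of `e`. -/
theorem eImage_orbit (G : Subgroup (OGroup n k)) (t : Triple (so n k)) :
    eImage (MulAction.orbit G t) = MulAction.orbit G t.e := by
  ext x
  constructor
  · rintro ⟨_, ⟨g, rfl⟩, rfl⟩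
    exact ⟨g, rfl⟩
  · rintro ⟨g, rfl⟩
    exact ⟨g • t, ⟨g, rfl⟩, rfl⟩

/-- The nilpotent cone of `so_n(k)`. -/
def nilCone (n : ℕ) (k : Type*) [Field k] : Set (so n k) :=
  {x | IsNilpotent (x : Matrix (Fin n) (Fin n) k)}

/-- `part μ i` is the `i`-th part of the partition `μ` in weakly decreasing order,
counted from `i = 0`, and it is `0` beyond the last part. -/
def part (μ : n.Partition) (i : ℕ) : ℕ := (μ.parts.sort (· ≥ ·)).getD i 0

/-- `x ∼ μ`: the nilpotent matrix `x` has Jordan normal form with one block of size `part μ i`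
for each `i < μ.parts.card`. That is, there is a basis of `k^n` that consists of chains
`b_{i,0}, …, b_{i, part μ i - 1}` with `x b_{i,0} = 0` and `x b_{i,j} = b_{i,j-1}` for `j > 0`. -/
def HasJordanType (x : Matrix (Fin n) (Fin n) k) (μ : n.Partition) : Prop :=
  ∃ b : Module.Basis (Σ i : Fin μ.parts.card, Fin (part μ i)) k (Fin n → k),
    ∀ (i : Fin μ.parts.card) (j : Fin (part μ i)),
      ((j : ℕ) = 0 → x.mulVec (b ⟨i, j⟩) = 0) ∧
      ∀ j' : Fin (part μ i), (j : ℕ) = j' + 1 → x.mulVec (b ⟨i, j⟩) = b ⟨i, j'⟩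

/-- All parts are even, and each has even multiplicity. -/
def VeryEven (μ : n.Partition) : Prop :=
  ∀ i ∈ μ.parts, Even i ∧ Even (μ.parts.count i)

/-- The set `¹𝒩^p` of the nilpotent `x ∼ (μ₁, μ₂, …)` in `so_n(k)` with `μ₁ ≤ p`, `μ₂ < p`. -/
def oneNp (n : ℕ) (k : Type*) [Field k] (p : ℕ) : Set (so n k) :=
  {x | x ∈ nilCone n k ∧ ∃ μ : n.Partition,
    HasJordanType (x : Matrix (Fin n) (Fin n) k) μ ∧ part μ 0 ≤ p ∧ part μ 1 < p}

/-- Zariski closed subsets of `so_n(k)`: common zero sets of polynomials in matrix entries. -/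
def IsZariskiClosed (V : Set (so n k)) : Prop :=
  ∃ P : Set (MvPolynomial (Fin n × Fin n) k),
    V = {x : so n k | ∀ q ∈ P,
      MvPolynomial.eval (fun ij => (x : Matrix (Fin n) (Fin n) k) ij.1 ij.2) q = 0}

/-- `V` satisfies the `sl₂`-property for `G ≤ O_n(k)`: it is a `G`-stable closed subvariety of the
nilpotent cone, and the map from the `G`-orbits of `sl₂`-triples `(e, h, f)` with `e, f ∈ V` to
the `G`-orbits in `V` that sends the orbit of `(e, h, f)` to the orbit of `e` is a bijection. -/
structure SlTwoProperty (G : Subgroup (OGroup n k)) (V : Set (so n k)) : Prop where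
  subset_nilCone : V ⊆ nilCone n k
  closed : IsZariskiClosed V
  stable : ∀ g ∈ G, ∀ x ∈ V, g • x ∈ V
  bijOn : Set.BijOn eImage (orbitsOf G {t : Triple (so n k) | t.e ∈ V ∧ t.f ∈ V}) (orbitsOf G V)

/-- The set of `SO_n(k)`-orbits into which the `O_n(k)`-orbit of `x` splits. -/
def splitting (n : ℕ) (k : Type*) [Field k] {X : Type*} [MulAction (OGroup n k) X] (x : X) : Set (Set X) :=
  orbitsOf (SO n k) (MulAction.orbit (OGroup n k) x)

end SlTwoOrbits

end

/-! Membership of `x` in `oneNp` means `x ^ p = 0` and `x ^ (p - 1)` of rank at most one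
(`mem_oneNp_iff`). This is a polynomial condition stable under conjugation, and it is the form in
which the set is used below.

Existence of a triple over `e`: if `e ^ (N + 1) = 0`, choose a complement `U` of `ker e ^ N` and
correct it so that `⟨u, e ^ j u'⟩` vanishes on `U` for `j < N`. Then `U + e U + ⋯ + e ^ N U` is an
orthogonal direct summand stable under `e`, with an explicit skew-symmetric lowering operator whose
coefficients are integers. Split it off and repeat with smaller `N` (`exists_orthTriple`). The
result satisfies `f ^ N = z * e ^ N * w`, so the rank bound passes from `e` to `f`.

Uniqueness: two triples with the same `e` are compared isotypic part by isotypic part, from the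
longest strings down (`exists_isometry_intertwiner`). An explicit sum `topIntertwiner` turns a map
commuting with `e` alone into one commuting with `e` and `f`. It needs `1, …, N` invertible and `h =
N` on the image of `e ^ N`. The weight condition is automatic if `N + 1` is invertible; for `N = p -
1` it is not, and it is here that the rank bound enters: `e ^ (p - 1)` is symmetric of rank at most
one, which forces `h` to act on its image by `-1 = p - 1` (`RankLeOne.mul_eq_neg`).

Determinant: the conjugating isometry acts trivially on the multiplicity spaces of `e`, so `-1` is
not an eigenvalue and its determinant is `1` (`det_eq_one_of_agreeOnKernels`). Thus triples over the
same `e` are already conjugate under `SO`, and this gives injectivity in (a) and in (c).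

For (b), the orbit splits exactly when the centraliser of `x` in `O_n` lies in `SO_n`. An odd block
size yields a centralising `-1` on an odd-dimensional nondegenerate summand. An even block size has
even multiplicity, because its multiplicity space carries a nondegenerate alternating form. If all
blocks are even, the centraliser stabilises a Lagrangian subspace, which forces determinant `1`. -/

namespace SlTwoOrbits

open Matrix

/-! ### Strings of a skew-symmetric matrix, with their orthogonal projections and lowering
operators. -/

section Strings

variable {ι k : Type*} [Fintype ι] [DecidableEq ι] [Field k]

theorem transpose_pow_of_skew {e : Matrix ι ι k} (he : eᵀ = -e) (m : ℕ) :
    (e ^ m)ᵀ = (-1 : k) ^ m • e ^ m := by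
  rcases Nat.even_or_odd m with h | h
  · rw [transpose_pow, he, h.neg_pow, h.neg_one_pow, one_smul]
  · rw [transpose_pow, he, h.neg_pow, h.neg_one_pow, neg_one_smul]

/-- Every square matrix over a field has a generalised inverse. -/
theorem exists_mul_mul_eq_self (s : Matrix ι ι k) : ∃ y : Matrix ι ι k, s * y * s = s := by
  obtain ⟨g, hg⟩ := (Matrix.toLin' s).rangeRestrict.exists_rightInverse_of_surjective
    (LinearMap.range_rangeRestrict _)
  obtain ⟨g', hg'⟩ := g.exists_extend
  refine ⟨LinearMap.toMatrix' g', Matrix.toLin'.injective ?_⟩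
  ext1
  rename_i i
  ext1
  simp only [Matrix.toLin'_mul, Matrix.toLin'_toMatrix', LinearMap.comp_apply]
  have h1 := fun v => LinearMap.congr_fun hg' ((Matrix.toLin' s).rangeRestrict v)
  have h2 := fun v => congrArg Subtype.val
    (LinearMap.congr_fun hg ((Matrix.toLin' s).rangeRestrict v))
  simp only [LinearMap.comp_apply, Submodule.subtype_apply, LinearMap.codRestrict_apply,
    LinearMap.rangeRestrict, LinearMap.id_apply] at h1 h2
  rw [h1, h2]

/-- The columns of `y` span a space `U` such that `U, e U, …, e ^ N U` are independent
and such that the form `⟨e ^ j u, u'⟩` vanishes on `U` for `j < N`. -/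
structure IsString (e : Matrix ι ι k) (N : ℕ) (y : Matrix ι ι k) : Prop where
  skew : eᵀ = -e
  transpose_eq : yᵀ = (-1 : k) ^ N • y
  pow_succ_mul : e ^ (N + 1) * y = 0
  mul_pow_mul : y * e ^ N * y = y
  mul_pow_mul_of_lt : ∀ j < N, y * e ^ j * y = 0

namespace IsString

variable {e y : Matrix ι ι k} {N : ℕ}

theorem mul_pow_succ (hy : IsString e N y) : y * e ^ (N + 1) = 0 := by
  have h := congrArg transpose hy.pow_succ_mul
  rw [transpose_mul, transpose_pow_of_skew hy.skew, hy.transpose_eq, transpose_zero] at h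
  simpa using h

theorem pow_mul_of_lt (hy : IsString e N y) {j : ℕ} (hj : N < j) : e ^ j * y = 0 := by
  obtain ⟨m, rfl⟩ := Nat.exists_eq_add_of_lt hj
  rw [show N + m + 1 = m + (N + 1) by ring, pow_add, Matrix.mul_assoc, hy.pow_succ_mul, mul_zero]

theorem mul_pow_of_lt (hy : IsString e N y) {j : ℕ} (hj : N < j) : y * e ^ j = 0 := by
  obtain ⟨m, rfl⟩ := Nat.exists_eq_add_of_lt hj
  rw [show N + m + 1 = (N + 1) + m by ring, pow_add, ← Matrix.mul_assoc, hy.mul_pow_succ, zero_mul]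

theorem mul_pow_mul_eq_ite (hy : IsString e N y) (j : ℕ) :
    y * e ^ j * y = if j = N then y else 0 := by
  split_ifs with h
  · rw [h, hy.mul_pow_mul]
  · rcases lt_or_gt_of_ne h with h | h
    · exact hy.mul_pow_mul_of_lt j h
    · rw [hy.mul_pow_of_lt h, zero_mul]

end IsString

/-- The projection onto the span of `U, e U, …, e ^ N U`. -/
def stringProj (e : Matrix ι ι k) (N : ℕ) (y : Matrix ι ι k) : Matrix ι ι k :=
  ∑ i ∈ Finset.range (N + 1), e ^ i * y * e ^ (N - i)

/-- The lowering operator on the span of `U, e U, …, e ^ N U`. -/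
def stringLower (e : Matrix ι ι k) (N : ℕ) (y : Matrix ι ι k) : Matrix ι ι k :=
  ∑ i ∈ Finset.range N, (((i + 1) * (N - i) : ℕ) : k) • (e ^ i * y * e ^ (N - 1 - i))

namespace IsString

variable {e y : Matrix ι ι k} {N : ℕ}

theorem transpose_stringProj (hy : IsString e N y) : (stringProj e N y)ᵀ = stringProj e N y := by
  rw [stringProj, transpose_sum, ← Finset.sum_range_reflect]
  refine Finset.sum_congr rfl fun i hi => ?_
  have hi' : i ≤ N := Nat.lt_succ_iff.1 (Finset.mem_range.1 hi)
  rw [show N + 1 - 1 - i = N - i by omega, show N - (N - i) = i by omega,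
    transpose_mul, transpose_mul, transpose_pow_of_skew hy.skew, transpose_pow_of_skew hy.skew,
    hy.transpose_eq]
  simp only [smul_mul_assoc, mul_smul_comm, smul_smul, Matrix.mul_assoc]
  rw [← pow_add, ← pow_add, show N - i + N + i = 2 * N by omega, pow_mul]
  simp

/-- The coefficient `(i + 1) * (N - i)` is invariant under `i ↦ N - 1 - i`, and the signs from the
transposes add up to the odd exponent `2 * (N - 1) + 1`. -/
theorem transpose_stringLower (hy : IsString e N y) :
    (stringLower e N y)ᵀ = -stringLower e N y := by
  rw [stringLower, transpose_sum, ← Finset.sum_range_reflect, ← Finset.sum_neg_distrib]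
  refine Finset.sum_congr rfl fun i hi => ?_
  have hi' : i < N := Finset.mem_range.1 hi
  rw [show N - 1 - (N - 1 - i) = i by omega,
    transpose_smul, transpose_mul, transpose_mul, transpose_pow_of_skew hy.skew,
    transpose_pow_of_skew hy.skew, hy.transpose_eq]
  simp only [smul_mul_assoc, mul_smul_comm, smul_smul, Matrix.mul_assoc, ← smul_neg]
  rw [show N - 1 - i + 1 = N - i by omega, show N - (N - 1 - i) = i + 1 by omega,
    mul_comm (N - i), mul_smul, ← pow_add, ← pow_add,
    show N - 1 - i + N + i = 2 * (N - 1) + 1 by omega, pow_succ, pow_mul]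
  simp

theorem stringProj_mul (hy : IsString e N y) : stringProj e N y * e = e * stringProj e N y := by
  rw [stringProj, Finset.sum_mul, Finset.mul_sum, Finset.sum_range_succ', Finset.sum_range_succ]
  congr 1
  · refine Finset.sum_congr rfl fun i hi => ?_
    have hi' : i < N := Finset.mem_range.1 hi
    rw [Matrix.mul_assoc _ _ e, ← pow_succ, show N - (i + 1) + 1 = N - i by omega, pow_succ']
    simp only [Matrix.mul_assoc]
  · rw [Matrix.mul_assoc _ _ e, ← pow_succ, ← Matrix.mul_assoc, ← Matrix.mul_assoc, ← pow_succ',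
      hy.pow_succ_mul, pow_zero, one_mul, Nat.sub_zero, hy.mul_pow_succ, zero_mul]

/-- By `y * e ^ m * y = δ_{m,N} y`, only the summand with index `j` survives. -/
theorem stringProj_mul_pow_mul (hy : IsString e N y) (j : ℕ) :
    stringProj e N y * (e ^ j * y) = e ^ j * y := by
  rcases lt_or_ge N j with hj | hj
  · rw [hy.pow_mul_of_lt hj, mul_zero]
  rw [stringProj, Finset.sum_mul, Finset.sum_eq_single j]
  · rw [show e ^ j * y * e ^ (N - j) * (e ^ j * y) = e ^ j * (y * (e ^ (N - j) * e ^ j) * y) by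
      simp only [Matrix.mul_assoc], ← pow_add, Nat.sub_add_cancel hj, hy.mul_pow_mul]
  · intro i hi hij
    have hi' : i < N + 1 := Finset.mem_range.1 hi
    rw [show e ^ i * y * e ^ (N - i) * (e ^ j * y) = e ^ i * (y * (e ^ (N - i) * e ^ j) * y) by
      simp only [Matrix.mul_assoc], ← pow_add, hy.mul_pow_mul_eq_ite, if_neg (by omega), mul_zero]
  · intro h
    exact absurd (Finset.mem_range.2 (by omega)) h

/-- Every summand of `stringProj` begins with some `e ^ j * y`, so identities of operators supported
on the string may be checked there. -/
theorem eq_of_mul_pow_mul (_hy : IsString e N y) {a b : Matrix ι ι k}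
    (ha : a * stringProj e N y = a) (hb : b * stringProj e N y = b)
    (h : ∀ j, a * (e ^ j * y) = b * (e ^ j * y)) : a = b := by
  rw [← ha, ← hb, stringProj, Finset.mul_sum, Finset.mul_sum]
  refine Finset.sum_congr rfl fun i _ => ?_
  simp only [← Matrix.mul_assoc] at h ⊢
  rw [h]

theorem stringProj_idem (hy : IsString e N y) :
    stringProj e N y * stringProj e N y = stringProj e N y := by
  conv_lhs => rw [stringProj.eq_1 e N y, Finset.mul_sum]
  rw [stringProj.eq_1 e N y]
  refine Finset.sum_congr rfl fun i _ => ?_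
  rw [← stringProj.eq_1 e N y, ← Matrix.mul_assoc, hy.stringProj_mul_pow_mul]

theorem stringLower_mul (hy : IsString e N y) : stringLower e N y * y = 0 := by
  rw [stringLower, Finset.sum_mul]
  refine Finset.sum_eq_zero fun i hi => ?_
  have hi' : i < N := Finset.mem_range.1 hi
  rw [smul_mul_assoc, Matrix.mul_assoc, Matrix.mul_assoc, ← Matrix.mul_assoc y,
    hy.mul_pow_mul_of_lt _ (by omega), mul_zero, smul_zero]

theorem stringLower_mul_pow_mul (hy : IsString e N y) (j : ℕ) :
    stringLower e N y * (e ^ (j + 1) * y) = (((j + 1 : ℕ) : k) * ((N : k) - j)) • (e ^ j * y) := by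
  rcases lt_or_ge N (j + 1) with hj | hj
  · rw [hy.pow_mul_of_lt hj, mul_zero]
    -- At the end `j = N` of the string the right side vanishes through the factor `N - j`, not
    -- through `e ^ j * y`.
    rcases Nat.lt_succ_iff_lt_or_eq.1 hj with hj | rfl
    · rw [hy.pow_mul_of_lt hj, smul_zero]
    · simp
  rw [stringLower, Finset.sum_mul, Finset.sum_eq_single j]
  · rw [smul_mul_assoc, show e ^ j * y * e ^ (N - 1 - j) * (e ^ (j + 1) * y) =
      e ^ j * (y * (e ^ (N - 1 - j) * e ^ (j + 1)) * y) by simp only [Matrix.mul_assoc], ← pow_add,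
      show N - 1 - j + (j + 1) = N by omega, hy.mul_pow_mul]
    push_cast [Nat.cast_sub (show j ≤ N by omega)]
    rfl
  · intro i hi hij
    have hi' : i < N := Finset.mem_range.1 hi
    rw [smul_mul_assoc, show e ^ i * y * e ^ (N - 1 - i) * (e ^ (j + 1) * y) =
      e ^ i * (y * (e ^ (N - 1 - i) * e ^ (j + 1)) * y) by simp only [Matrix.mul_assoc], ← pow_add,
      hy.mul_pow_mul_eq_ite, if_neg (by omega), mul_zero, smul_zero]
  · intro h
    exact absurd (Finset.mem_range.2 (by omega)) h

theorem stringProj_mul_stringLower (hy : IsString e N y) :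
    stringProj e N y * stringLower e N y = stringLower e N y := by
  conv_lhs => rw [stringLower.eq_1 e N y, Finset.mul_sum]
  rw [stringLower.eq_1 e N y]
  refine Finset.sum_congr rfl fun i _ => ?_
  rw [mul_smul_comm, ← Matrix.mul_assoc, hy.stringProj_mul_pow_mul]

theorem stringLower_mul_stringProj (hy : IsString e N y) :
    stringLower e N y * stringProj e N y = stringLower e N y := by
  have h := congrArg transpose hy.stringProj_mul_stringLower
  rw [transpose_mul, hy.transpose_stringLower, hy.transpose_stringProj, neg_mul, neg_inj] at h
  exact h

/-- The weight operator on a string. -/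
theorem lie_stringLower_mul (hy : IsString e N y) (j : ℕ) :
    (e * stringLower e N y - stringLower e N y * e) * (e ^ j * y) =
      (2 * (j : k) - N) • (e ^ j * y) := by
  have h1 : stringLower e N y * e * (e ^ j * y) =
      (((j + 1 : ℕ) : k) * ((N : k) - j)) • (e ^ j * y) := by
    rw [← hy.stringLower_mul_pow_mul, pow_succ']
    simp only [Matrix.mul_assoc]
  rw [sub_mul, h1]
  cases j with
  | zero =>
    simp [Matrix.mul_assoc, hy.stringLower_mul]
  | succ j =>
    rw [Matrix.mul_assoc, hy.stringLower_mul_pow_mul, mul_smul_comm, ← Matrix.mul_assoc,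
      ← pow_succ', ← sub_smul]
    congr 1
    push_cast
    ring

/-- Lowering `m` times kills `e ^ j * y` for `j < m` and sends `e ^ (j + m) * y` to a multiple of `e
^ j * y`. Since `y = y * e ^ N * y`, the form `c • y` later exhibits the top power of `f` as a
multiple of `e ^ N` on both sides. -/
theorem exists_stringLower_pow (hy : IsString e N y) :
    stringLower e N y ^ (N + 1) = 0 ∧ ∃ c : k, stringLower e N y ^ N * stringProj e N y = c • y := by
  have key : ∀ m, (∀ j < m, stringLower e N y ^ m * (e ^ j * y) = 0) ∧
      ∀ j, ∃ c : k, stringLower e N y ^ m * (e ^ (j + m) * y) = c • (e ^ j * y) := by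
    intro m
    induction m with
    | zero => exact ⟨fun j hj => absurd hj (Nat.not_lt_zero j), fun j => ⟨1, by simp⟩⟩
    | succ m ih =>
      refine ⟨fun j hj => ?_, fun j => ?_⟩
      · cases j with
        | zero => rw [pow_succ, pow_zero, one_mul, Matrix.mul_assoc, hy.stringLower_mul, mul_zero]
        | succ j =>
          rw [pow_succ, Matrix.mul_assoc, hy.stringLower_mul_pow_mul, mul_smul_comm,
            ih.1 j (by omega), smul_zero]
      · obtain ⟨c, hc⟩ := ih.2 j
        refine ⟨(((j + m + 1 : ℕ) : k) * ((N : k) - (j + m : ℕ))) * c, ?_⟩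
        rw [pow_succ, Matrix.mul_assoc, ← add_assoc, hy.stringLower_mul_pow_mul, mul_smul_comm, hc,
          smul_smul]
  constructor
  · refine hy.eq_of_mul_pow_mul ?_ (zero_mul _) fun j => ?_
    · rw [pow_succ, Matrix.mul_assoc, hy.stringLower_mul_stringProj]
    · rw [zero_mul]
      rcases lt_or_ge j (N + 1) with hj | hj
      · exact (key (N + 1)).1 j hj
      · rw [hy.pow_mul_of_lt hj, mul_zero]
  · obtain ⟨c, hc⟩ := (key N).2 0
    refine ⟨c, ?_⟩
    rw [stringProj, Finset.mul_sum, Finset.sum_eq_single N]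
    · rw [zero_add, pow_zero, one_mul] at hc
      rw [← Matrix.mul_assoc, hc, Nat.sub_self, pow_zero, mul_one]
    · intro i hi hiN
      have : i < N + 1 := Finset.mem_range.1 hi
      rw [← Matrix.mul_assoc, (key N).1 i (by omega), zero_mul]
    · intro h
      exact absurd (Finset.mem_range.2 (by omega)) h

end IsString

/-- A matrix whose columns generate strings of length `N + 1` can be corrected so that the
pairings of degree less than `N` vanish. -/
theorem exists_isString (h2 : (2 : k) ≠ 0) {e y : Matrix ι ι k} {N : ℕ} (he : eᵀ = -e)
    (hyt : yᵀ = (-1 : k) ^ N • y) (hey : e ^ (N + 1) * y = 0) (hyy : y * e ^ N * y = y) :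
    ∃ x : Matrix ι ι k, e ^ (N + 1) * x = 0 ∧
      IsString e N ((1 + e * x) * y * (1 + e * x)ᵀ) := by
  -- The pairings are removed in decreasing degree: after `m` steps those of degree at least `N - m`
  -- and less than `N` are zero.
  suffices H : ∀ m ≤ N, ∃ x y' : Matrix ι ι k, e ^ (N + 1) * x = 0 ∧ y' = (1 + e * x) * y * (1 + e * x)ᵀ ∧
      y'ᵀ = (-1 : k) ^ N • y' ∧ e ^ (N + 1) * y' = 0 ∧ y' * e ^ N * y' = y' ∧
      ∀ j < N, N - m ≤ j → y' * e ^ j * y' = 0 by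
    obtain ⟨x, y', hx, rfl, h1, h2, h3, h4⟩ := H N le_rfl
    exact ⟨x, hx, he, h1, h2, h3, fun j hj => h4 j hj (by omega)⟩
  intro m
  induction m with
  | zero =>
    exact fun _ => ⟨0, y, by simp, by simp, hyt, hey, hyy, fun j hj hj' => by omega⟩
  | succ m ih =>
    intro hm
    obtain ⟨x, y', hx, hy', ht, hp, hN, hj⟩ := ih (by omega)
    have hp' : y' * e ^ (N + 1) = 0 := by
      have h := congrArg transpose hp
      rw [transpose_mul, transpose_pow_of_skew he, ht, transpose_zero] at h
      simpa using h
    have hpl : ∀ j, N < j → e ^ j * y' = 0 := by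
      intro j hj
      obtain ⟨m, rfl⟩ := Nat.exists_eq_add_of_lt hj
      rw [show N + m + 1 = m + (N + 1) by ring, pow_add, Matrix.mul_assoc, hp, mul_zero]
    have hpr : ∀ j, N < j → y' * e ^ j = 0 := by
      intro j hj
      obtain ⟨m, rfl⟩ := Nat.exists_eq_add_of_lt hj
      rw [show N + m + 1 = (N + 1) + m by ring, pow_add, ← Matrix.mul_assoc, hp', zero_mul]
    set j₀ := N - (m + 1) with hj₀
    -- Replacing `u` by `u + e ^ (m + 1) z u` changes the pairing of degree `j₀` through its degree
    -- `N` pairings, once from each argument; each contributes minus one half of the unwanted term.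
    set z : Matrix ι ι k := (-(2 : k)⁻¹) • (y' * e ^ j₀) with hz
    set g : Matrix ι ι k := 1 + e ^ (m + 1) * z with hg
    have hzt : zᵀ = (-1 : k) ^ (m + 1) • ((-(2 : k)⁻¹) • (e ^ j₀ * y')) := by
      rw [hz, transpose_smul, transpose_mul, transpose_pow_of_skew he, ht]
      simp only [smul_mul_assoc, mul_smul_comm, smul_smul]
      congr 1
      rw [← pow_add, mul_comm]
      congr 1
      rw [show N + j₀ = 2 * j₀ + (m + 1) by omega, pow_add, pow_mul]
      simp
    have hgt : gᵀ = 1 + (-(2 : k)⁻¹) • (e ^ j₀ * y' * e ^ (m + 1)) := by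
      rw [hg, transpose_add, transpose_one, transpose_mul, transpose_pow_of_skew he, hzt]
      simp only [smul_mul_assoc, mul_smul_comm, smul_smul]
      congr 2
      rw [← mul_assoc, ← pow_add, ← two_mul, pow_mul]
      simp
    have hgy : g * y' = y' + (-(2 : k)⁻¹) • (e ^ (m + 1) * (y' * e ^ j₀ * y')) := by
      rw [hg, add_mul, one_mul, hz]
      simp only [smul_mul_assoc, mul_smul_comm, Matrix.mul_assoc]
    have hyg : y' * gᵀ = y' + (-(2 : k)⁻¹) • (y' * e ^ j₀ * y' * e ^ (m + 1)) := by
      rw [hgt, mul_add, mul_one]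
      simp only [mul_smul_comm, Matrix.mul_assoc]
    have hmid : ∀ j, j₀ ≤ j → y' * gᵀ * e ^ j * (g * y') =
        y' * e ^ j * y' - (2 : k)⁻¹ • (y' * e ^ (j + (m + 1)) * (y' * e ^ j₀ * y')) -
          (2 : k)⁻¹ • ((y' * e ^ j₀ * y') * e ^ (j + (m + 1)) * y') := by
      intro j hj
      -- The quadratic term has exponent `j + 2 * (m + 1) ≥ N + m + 1`, which exceeds `N`.
      have h0 : (y' * e ^ j₀ * y' * e ^ (m + 1)) * e ^ j * (e ^ (m + 1) * (y' * e ^ j₀ * y')) = 0 := by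
        rw [show (y' * e ^ j₀ * y' * e ^ (m + 1)) * e ^ j * (e ^ (m + 1) * (y' * e ^ j₀ * y')) =
          (y' * e ^ j₀) * (y' * (e ^ (m + 1) * e ^ j * e ^ (m + 1))) * (y' * e ^ j₀ * y') by
          simp only [Matrix.mul_assoc], ← pow_add, ← pow_add, hpr (m + 1 + j + (m + 1)) (by omega), mul_zero, zero_mul]
      rw [hyg, hgy]
      simp only [add_mul, mul_add, smul_mul_assoc, mul_smul_comm]
      have h1 : y' * e ^ j * (e ^ (m + 1) * (y' * e ^ j₀ * y')) =
          y' * e ^ (j + (m + 1)) * (y' * e ^ j₀ * y') := by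
        rw [pow_add e j]
        simp only [Matrix.mul_assoc]
      have h2 : y' * e ^ j₀ * y' * e ^ (m + 1) * e ^ j * y' =
          y' * e ^ j₀ * y' * e ^ (j + (m + 1)) * y' := by
        rw [add_comm j, pow_add e (m + 1)]
        simp only [Matrix.mul_assoc]
      rw [h0, h1, h2]
      module
    refine ⟨x + e ^ m * z + e ^ m * z * e * x, g * y' * gᵀ, ?_, ?_, ?_, ?_, ?_, ?_⟩
    · have hz0 : e ^ (N + 1) * (e ^ m * z) = 0 := by
        rw [← Matrix.mul_assoc, ← pow_add, hz, mul_smul_comm, ← Matrix.mul_assoc,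
          hpl (N + 1 + m) (by omega), zero_mul, smul_zero]
      rw [mul_add, mul_add, hx, hz0, ← Matrix.mul_assoc, ← Matrix.mul_assoc, hz0]
      simp
    · have : g * (1 + e * x) = 1 + e * (x + e ^ m * z + e ^ m * z * e * x) := by
        rw [hg, pow_succ']
        noncomm_ring
      rw [hy', ← this, transpose_mul]
      simp only [Matrix.mul_assoc]
    · rw [transpose_mul, transpose_mul, transpose_transpose, ht]
      simp only [smul_mul_assoc, mul_smul_comm, Matrix.mul_assoc]
    · rw [← Matrix.mul_assoc, hgy, mul_add, hp, mul_smul_comm, ← Matrix.mul_assoc, ← pow_add,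
        ← Matrix.mul_assoc, ← Matrix.mul_assoc, hpl (N + 1 + (m + 1)) (by omega)]
      simp
    · have : g * y' * gᵀ * e ^ N * (g * y' * gᵀ) = g * (y' * gᵀ * e ^ N * (g * y')) * gᵀ := by
        simp only [Matrix.mul_assoc]
      rw [this, hmid N (by omega), hpr (N + (m + 1)) (by omega),
        Matrix.mul_assoc (y' * e ^ j₀ * y'), hpl (N + (m + 1)) (by omega), hN]
      simp
    · intro j hjN hjm
      have : g * y' * gᵀ * e ^ j * (g * y' * gᵀ) = g * (y' * gᵀ * e ^ j * (g * y')) * gᵀ := by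
        simp only [Matrix.mul_assoc]
      rw [this, hmid j (by omega)]
      -- In degree `j₀` the two halves cancel the old pairing; in higher degrees the corrections
      -- contain a power of `e` above `N`, so what was zero stays zero.
      rcases eq_or_lt_of_le hjm with h | h
      · have h' : j = j₀ := h.symm
        rw [h', show j₀ + (m + 1) = N by omega,
          show y' * e ^ N * (y' * e ^ j₀ * y') = (y' * e ^ N * y') * e ^ j₀ * y' by
            simp only [Matrix.mul_assoc],
          show y' * e ^ j₀ * y' * e ^ N * y' = y' * e ^ j₀ * (y' * e ^ N * y') by
            simp only [Matrix.mul_assoc], hN, sub_sub, ← add_smul]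
        have : (2 : k)⁻¹ + 2⁻¹ = 1 := by
          field_simp
          norm_num
        rw [this, one_smul, sub_self, mul_zero, zero_mul]
      · rw [hj j hjN (by omega), hpr (j + (m + 1)) (by omega),
          Matrix.mul_assoc (y' * e ^ j₀ * y'), hpl (j + (m + 1)) (by omega)]
        simp

end Strings

end SlTwoOrbits

namespace SlTwoOrbits

open Matrix

/-! ### Existence of orthogonal `sl₂`-triples. -/

section Existence

variable {ι k : Type*} [Fintype ι] [Field k]

/-- An `sl₂`-triple of skew-symmetric matrices that is supported on the image of the orthogonal
projection `π`. -/
structure OrthTriple (π e h f : Matrix ι ι k) : Prop where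
  transpose_proj : πᵀ = π
  proj_idem : π * π = π
  transpose_e : eᵀ = -e
  transpose_f : fᵀ = -f
  lie_h_e : h * e - e * h = (2 : k) • e
  lie_h_f : h * f - f * h = -((2 : k) • f)
  lie_e_f : e * f - f * e = h
  proj_mul_e : π * e = e
  proj_mul_f : π * f = f

namespace OrthTriple

variable {π e h f π' e' h' f' : Matrix ι ι k}

theorem e_mul_proj (t : OrthTriple π e h f) : e * π = e := by
  have := congrArg transpose t.proj_mul_e
  rwa [transpose_mul, t.transpose_e, t.transpose_proj, neg_mul, neg_inj] at this

theorem f_mul_proj (t : OrthTriple π e h f) : f * π = f := by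
  have := congrArg transpose t.proj_mul_f
  rwa [transpose_mul, t.transpose_f, t.transpose_proj, neg_mul, neg_inj] at this

theorem proj_mul_h (t : OrthTriple π e h f) : π * h = h := by
  rw [← t.lie_e_f, mul_sub, ← Matrix.mul_assoc, ← Matrix.mul_assoc, t.proj_mul_e, t.proj_mul_f]

theorem h_mul_proj (t : OrthTriple π e h f) : h * π = h := by
  rw [← t.lie_e_f, sub_mul, Matrix.mul_assoc, Matrix.mul_assoc, t.e_mul_proj, t.f_mul_proj]

theorem transpose_h (t : OrthTriple π e h f) : hᵀ = -h := by
  rw [← t.lie_e_f, transpose_sub, transpose_mul, transpose_mul, t.transpose_e, t.transpose_f]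
  noncomm_ring

/-- Exchange of the roles of `e` and `f`. -/
theorem swap (t : OrthTriple π e h f) : OrthTriple π f (-h) e where
  transpose_proj := t.transpose_proj
  proj_idem := t.proj_idem
  transpose_e := t.transpose_f
  transpose_f := t.transpose_e
  lie_h_e := by
    rw [neg_mul, mul_neg, ← neg_sub', t.lie_h_f, neg_neg]
  lie_h_f := by
    rw [neg_mul, mul_neg, ← neg_sub', t.lie_h_e]
  lie_e_f := by rw [← t.lie_e_f, neg_sub]
  proj_mul_e := t.proj_mul_f
  proj_mul_f := t.proj_mul_e

/-- Orthogonality of the supports kills every mixed product, so the relations add up. -/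
theorem add (t : OrthTriple π e h f) (t' : OrthTriple π' e' h' f') (hπ : π * π' = 0) :
    OrthTriple (π + π') (e + e') (h + h') (f + f') := by
  have hπ' : π' * π = 0 := by
    have := congrArg transpose hπ
    rwa [transpose_mul, t.transpose_proj, t'.transpose_proj, transpose_zero] at this
  have mul_eq_zero' : ∀ {p q a b : Matrix ι ι k}, p * q = 0 → a * p = a → q * b = b → a * b = 0 := by
    intro p q a b hpq ha hb
    rw [← ha, ← hb, Matrix.mul_assoc, ← Matrix.mul_assoc p, hpq, zero_mul, mul_zero]
  have t1 := t.e_mul_proj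
  have t2 := t.f_mul_proj
  have t3 := t.h_mul_proj
  have t4 := t'.e_mul_proj
  have t5 := t'.f_mul_proj
  have t6 := t'.h_mul_proj
  have s1 := t.proj_mul_e
  have s2 := t.proj_mul_f
  have s3 := t.proj_mul_h
  have s4 := t'.proj_mul_e
  have s5 := t'.proj_mul_f
  have s6 := t'.proj_mul_h
  constructor
  · rw [transpose_add, t.transpose_proj, t'.transpose_proj]
  · rw [mul_add, add_mul, add_mul, t.proj_idem, t'.proj_idem, hπ, hπ']
    simp
  · rw [transpose_add, t.transpose_e, t'.transpose_e, neg_add]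
  · rw [transpose_add, t.transpose_f, t'.transpose_f, neg_add]
  · rw [mul_add, add_mul, add_mul, mul_add, add_mul, add_mul, smul_add, ← t.lie_h_e, ← t'.lie_h_e,
      mul_eq_zero' hπ t3 s4, mul_eq_zero' hπ' t6 s1, mul_eq_zero' hπ t1 s6, mul_eq_zero' hπ' t4 s3]
    abel
  · rw [mul_add, add_mul, add_mul, mul_add, add_mul, add_mul, smul_add, neg_add, ← t.lie_h_f,
      ← t'.lie_h_f,
      mul_eq_zero' hπ t3 s5, mul_eq_zero' hπ' t6 s2, mul_eq_zero' hπ t2 s6, mul_eq_zero' hπ' t5 s3]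
    abel
  · rw [mul_add, add_mul, add_mul, mul_add, add_mul, add_mul, ← t.lie_e_f, ← t'.lie_e_f,
      mul_eq_zero' hπ t1 s5, mul_eq_zero' hπ' t4 s2, mul_eq_zero' hπ t2 s4, mul_eq_zero' hπ' t5 s1]
    abel
  · rw [add_mul, mul_add, mul_add, s1, s4, mul_eq_zero' hπ t.proj_idem s4,
      mul_eq_zero' hπ' t'.proj_idem s1]
    abel
  · rw [add_mul, mul_add, mul_add, s2, s5, mul_eq_zero' hπ t.proj_idem s5,
      mul_eq_zero' hπ' t'.proj_idem s2]
    abel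

end OrthTriple

variable [DecidableEq ι]

/-- The relations are checked on `e ^ j * y`, where `h` has weight `2 * j - N`. All coefficients are
integers and none is inverted, so small characteristic does no harm. -/
theorem IsString.orthTriple {e y : Matrix ι ι k} {N : ℕ} (hy : IsString e N y) :
    OrthTriple (stringProj e N y) (e * stringProj e N y)
      (e * stringLower e N y - stringLower e N y * e) (stringLower e N y) := by
  have hFq := hy.stringLower_mul_stringProj
  have hqF := hy.stringProj_mul_stringLower
  have hqe := hy.stringProj_mul
  have hF := hy.lie_stringLower_mul
  have hlow := hy.stringLower_mul_pow_mul
  have hq := hy.stringProj_mul_pow_mul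
  have hqq := hy.stringProj_idem
  have hqt := hy.transpose_stringProj
  have hFt := hy.transpose_stringLower
  have hred := @hy.eq_of_mul_pow_mul
  have hFy := hy.stringLower_mul
  set q := stringProj e N y
  set F := stringLower e N y
  have hHq : (e * F - F * e) * q = e * F - F * e := by
    rw [sub_mul, Matrix.mul_assoc, hFq, Matrix.mul_assoc, ← hqe, ← Matrix.mul_assoc, hFq]
  have heF : e * q * F = e * F := by rw [Matrix.mul_assoc, hqF]
  have hFe : F * (e * q) = F * e := by rw [← hqe, ← Matrix.mul_assoc, hFq]
  have heq (j : ℕ) : e * q * (e ^ j * y) = e ^ (j + 1) * y := by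
    rw [Matrix.mul_assoc, hq, ← Matrix.mul_assoc, ← pow_succ']
  refine ⟨hqt, hqq, ?_, hFt, ?_, ?_, ?_, ?_, hqF⟩
  · rw [transpose_mul, hqt, hy.skew, mul_neg, hqe]
  · apply hred
    · rw [sub_mul, Matrix.mul_assoc, Matrix.mul_assoc e q q, hqq, Matrix.mul_assoc (e * q), hHq]
    · rw [smul_mul_assoc, Matrix.mul_assoc, hqq]
    · intro j
      rw [sub_mul, Matrix.mul_assoc, heq, hF, Matrix.mul_assoc (e * q), hF, mul_smul_comm, heq,
        smul_mul_assoc, heq, ← sub_smul]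
      congr 1
      push_cast
      ring
  · apply hred
    · rw [sub_mul, Matrix.mul_assoc, hFq, Matrix.mul_assoc F, hHq]
    · rw [neg_mul, smul_mul_assoc, hFq]
    · intro j
      rw [sub_mul, Matrix.mul_assoc, Matrix.mul_assoc F, hF, mul_smul_comm, neg_mul, smul_mul_assoc]
      cases j with
      | zero => simp [hFy]
      | succ j =>
        rw [hlow, mul_smul_comm, hF]
        push_cast
        module
  · rw [heF, hFe]
  · rw [← hqe, ← Matrix.mul_assoc, hqq]

theorem add_pow_of_mul_eq_zero {R : Type*} [Ring R] {a b : R} (hab : a * b = 0) (hba : b * a = 0)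
    (m : ℕ) : (a + b) ^ (m + 1) = a ^ (m + 1) + b ^ (m + 1) := by
  induction m with
  | zero => simp
  | succ m ih =>
    rw [pow_succ, ih, add_mul, mul_add, mul_add, pow_succ a m, mul_assoc (a ^ m) a b, hab,
      pow_succ b m, mul_assoc (b ^ m) b a, hba, ← pow_succ a m, ← pow_succ b m, ← pow_succ,
      ← pow_succ]
    simp

theorem pow_mul_one_sub {R : Type*} [Ring R] {a q : R} (hq : q * q = q) (haq : q * a = a * q)
    (m : ℕ) : (a * (1 - q)) ^ (m + 1) = a ^ (m + 1) * (1 - q) := by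
  have hc : Commute a (1 - q) := (Commute.one_right a).sub_right haq.symm
  have hi : IsIdempotentElem (1 - q) := IsIdempotentElem.one_sub hq
  rw [hc.mul_pow, hi.pow_succ_eq]

/-- Every nilpotent skew-symmetric matrix is part of an `sl₂`-triple of skew-symmetric matrices. -/
theorem exists_orthTriple (h2 : (2 : k) ≠ 0) (N : ℕ) : ∀ π e : Matrix ι ι k, πᵀ = π → π * π = π →
    eᵀ = -e → π * e = e → e ^ (N + 1) = 0 →
      ∃ h f, OrthTriple π e h f ∧ f ^ (N + 1) = 0 ∧ ∃ z w, f ^ N = z * e ^ N * w := by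
  induction N with
  | zero =>
    intro π e hπ hπ2 he hπe heN
    have he0 : e = 0 := by simpa using heN
    subst he0
    exact ⟨0, 0, ⟨hπ, hπ2, by simp, by simp, by simp, by simp, by simp, by simp, by simp⟩, by simp,
      1, 1, by simp⟩
  | succ N ih =>
    intro π e hπ hπ2 he hπe heN
    have heπ : e * π = e := by
      have := congrArg transpose hπe
      rwa [transpose_mul, he, hπ, neg_mul, neg_inj] at this
    set s := e ^ (N + 1) with hs
    have hst : sᵀ = (-1 : k) ^ (N + 1) • s := transpose_pow_of_skew he _
    have hπs : π * s = s := by rw [hs, pow_succ', ← Matrix.mul_assoc, hπe]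
    have hsπ : s * π = s := by rw [hs, pow_succ, Matrix.mul_assoc, heπ]
    have hes : e * s = 0 := by rw [hs, ← pow_succ', heN]
    have hse : s * e = 0 := by rw [hs, ← pow_succ, heN]
    have hsign : (-1 : k) ^ (N + 1) * (-1) ^ (N + 1) = 1 := by rw [← mul_pow]; simp
    obtain ⟨y₀, hy₀⟩ := exists_mul_mul_eq_self s
    -- Averaging gives a generalised inverse of `s` with the same symmetry under transposition as
    -- `s`.
    set y₁ : Matrix ι ι k := (2 : k)⁻¹ • (y₀ + (-1 : k) ^ (N + 1) • y₀ᵀ) with hy₁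
    have hy₁t : y₁ᵀ = (-1 : k) ^ (N + 1) • y₁ := by
      rw [hy₁, transpose_smul, transpose_add, transpose_smul, transpose_transpose, smul_comm,
        smul_add ((-1 : k) ^ (N + 1)), smul_smul ((-1 : k) ^ (N + 1)), hsign, one_smul, add_comm]
    have hy₀t : s * y₀ᵀ * s = (-1 : k) ^ (N + 1) • s := by
      have := congrArg transpose hy₀
      rw [transpose_mul, transpose_mul, hst, smul_mul_assoc, mul_smul_comm, mul_smul_comm, smul_smul,
        hsign, one_smul, ← Matrix.mul_assoc] at this
      exact this
    have hsys : s * y₁ * s = s := by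
      rw [hy₁, mul_smul_comm, smul_mul_assoc, mul_add, add_mul, hy₀, mul_smul_comm, smul_mul_assoc,
        hy₀t, smul_smul, hsign, one_smul, ← two_smul k s, smul_smul, inv_mul_cancel₀ h2, one_smul]
    -- The sandwich makes the inverse reflexive, `y₂ * s * y₂ = y₂`, and `π` confines it to the
    -- support of `e`.
    set y₂ := π * (y₁ * s * y₁) * π with hy₂
    have hπy₂ : π * y₂ = y₂ := by
      rw [hy₂, ← Matrix.mul_assoc, ← Matrix.mul_assoc, hπ2]
    have hsys₂ : s * y₂ * s = s := by
      rw [hy₂, show s * (π * (y₁ * s * y₁) * π) * s = (s * π) * y₁ * s * y₁ * (π * s) by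
        simp only [Matrix.mul_assoc], hsπ, hπs, hsys, hsys]
    have hy₂t : y₂ᵀ = (-1 : k) ^ (N + 1) • y₂ := by
      rw [hy₂]
      simp only [transpose_mul, hπ, hy₁t, hst, smul_mul_assoc, mul_smul_comm, smul_smul,
        Matrix.mul_assoc, hsign, one_smul]
    have hysy₂ : y₂ * s * y₂ = y₂ := by
      rw [hy₂, show π * (y₁ * s * y₁) * π * s * (π * (y₁ * s * y₁) * π) =
        π * (y₁ * ((s * y₁ * ((π * s) * π)) * y₁ * s) * y₁) * π by
        simp only [Matrix.mul_assoc], hπs, hsπ, hsys, hsys]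
    clear_value y₂
    obtain ⟨x, -, hY⟩ := exists_isString h2 he hy₂t (by rw [heN, zero_mul]) hysy₂
    set Y := (1 + e * x) * y₂ * (1 + e * x)ᵀ with hYdef
    -- The correction `1 + e * x` is invisible next to `s`, because `s * e = e * s = 0`.
    have hsY : s * Y * s = s := by
      have h1 : s * (1 + e * x) = s := by
        rw [mul_add, mul_one, ← Matrix.mul_assoc, hse, zero_mul, add_zero]
      have h2 : (1 + e * x)ᵀ * s = s := by
        rw [transpose_add, transpose_mul, he, transpose_one, add_mul, one_mul, Matrix.mul_assoc,
          neg_mul, hes, neg_zero, mul_zero, add_zero]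
      rw [hYdef, show s * ((1 + e * x) * y₂ * (1 + e * x)ᵀ) * s =
        (s * (1 + e * x)) * y₂ * ((1 + e * x)ᵀ * s) by simp only [Matrix.mul_assoc], h1, h2, hsys₂]
    have hπY : π * Y = Y := by
      rw [hYdef, ← Matrix.mul_assoc, ← Matrix.mul_assoc, mul_add, mul_one, ← Matrix.mul_assoc, hπe,
        add_mul, hπy₂, add_mul 1, one_mul]
    have hπeY (i : ℕ) : π * (e ^ i * Y) = e ^ i * Y := by
      cases i with
      | zero => rw [pow_zero, one_mul, hπY]
      | succ i => rw [pow_succ', Matrix.mul_assoc e, ← Matrix.mul_assoc, hπe]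
    have hlow := hY.exists_stringLower_pow
    have ht := hY.orthTriple
    have hqe := hY.stringProj_mul
    have hqY := hY.stringProj_mul_pow_mul 0
    rw [pow_zero, one_mul] at hqY
    have hπq : π * stringProj e (N + 1) Y = stringProj e (N + 1) Y := by
      rw [stringProj, Finset.mul_sum]
      exact Finset.sum_congr rfl fun i _ => by rw [← Matrix.mul_assoc, hπeY]
    set q := stringProj e (N + 1) Y
    set F := stringLower e (N + 1) Y
    have hqπ : q * π = q := by
      have := congrArg transpose hπq
      rwa [transpose_mul, ht.transpose_proj, hπ] at this
    have hYq : Y * q = Y := by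
      have := congrArg transpose hqY
      rw [transpose_mul, ht.transpose_proj, hY.transpose_eq, smul_mul_assoc] at this
      have h := congrArg (fun z => (-1 : k) ^ (N + 1) • z) this
      simpa only [smul_smul, hsign, one_smul] using h
    -- The longest strings carry all of `e ^ (N + 1)`; on the complement this power vanishes and the
    -- induction hypothesis applies.
    have hsq : s * q = s := by
      have hcomm : q * s = s * q := (Commute.pow_right (show Commute q e from hqe) (N + 1)).eq
      rw [← hsY, Matrix.mul_assoc (s * Y), ← hcomm, ← Matrix.mul_assoc, Matrix.mul_assoc s Y q, hYq]
    obtain ⟨h₁, f₁, ht₁, hf₁, -⟩ := ih (π - q) (e * (1 - q))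
      (by rw [transpose_sub, hπ, ht.transpose_proj])
      (by rw [mul_sub, sub_mul, sub_mul, hπ2, hqπ, hπq, ht.proj_idem]; abel)
      (by rw [transpose_mul, transpose_sub, transpose_one, ht.transpose_proj, he, mul_neg, sub_mul,
            one_mul, hqe, mul_sub, mul_one])
      (by rw [← Matrix.mul_assoc, sub_mul, hπe, hqe, mul_sub, mul_one, sub_mul, Matrix.mul_assoc e q q,
            ht.proj_idem]; noncomm_ring)
      (by rw [pow_mul_one_sub ht.proj_idem hqe, mul_sub, mul_one, hsq, sub_self])
    have hqπ₁ : q * (π - q) = 0 := by rw [mul_sub, hqπ, ht.proj_idem, sub_self]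
    have hπ₁q : (π - q) * q = 0 := by rw [sub_mul, hπq, ht.proj_idem, sub_self]
    have htt := ht.add ht₁ hqπ₁
    rw [add_sub_cancel, show e * q + e * (1 - q) = e by noncomm_ring] at htt
    have hFf : F * f₁ = 0 := by
      rw [← ht.f_mul_proj, ← ht₁.proj_mul_f, Matrix.mul_assoc, ← Matrix.mul_assoc q, hqπ₁, zero_mul,
        mul_zero]
    have hfF : f₁ * F = 0 := by
      rw [← ht.proj_mul_f, ← ht₁.f_mul_proj, Matrix.mul_assoc, ← Matrix.mul_assoc _ q, hπ₁q,
        zero_mul, mul_zero]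
    refine ⟨_, _, htt, ?_, ?_⟩
    · rw [add_pow_of_mul_eq_zero hFf hfF, hlow.1, pow_succ, hf₁, zero_mul, add_zero]
    · obtain ⟨c, hc⟩ := hlow.2
      -- The summand `f₁` has no `(N + 1)`-st power, and on the string that power is `c • Y = c • (Y
      -- * e ^ (N + 1) * Y)`.
      refine ⟨c • Y, Y, ?_⟩
      rw [add_pow_of_mul_eq_zero hFf hfF, hf₁, add_zero, smul_mul_assoc, smul_mul_assoc, hY.mul_pow_mul,
        ← hc, pow_succ, Matrix.mul_assoc, ht.f_mul_proj]

end Existence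

end SlTwoOrbits

namespace SlTwoOrbits

open Matrix

/-! ### Intertwiners between the isotypic parts of greatest height. -/

section Intertwiners

variable {ι k : Type*} [Fintype ι] [DecidableEq ι] [Field k]

/-- The triple `(e, h, f)` has strings of length at most `N + 1`, and the strings of length `N + 1`
have weights `-N, …, N`. -/
structure HasHeight (N : ℕ) (e h f : Matrix ι ι k) : Prop where
  e_pow : e ^ (N + 1) = 0
  f_pow : f ^ (N + 1) = 0
  h_mul_e_pow : h * e ^ N = (N : k) • e ^ N
  h_mul_f_pow : h * f ^ N = -((N : k) • f ^ N)

namespace OrthTriple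

variable {π e h f : Matrix ι ι k}

theorem h_mul_e_pow (t : OrthTriple π e h f) (m : ℕ) :
    h * e ^ m = e ^ m * h + (2 * (m : k)) • e ^ m := by
  have hhe : h * e = e * h + (2 : k) • e := by rw [← t.lie_h_e]; abel
  induction m with
  | zero => simp
  | succ m ih =>
    rw [pow_succ, ← Matrix.mul_assoc, ih, add_mul, Matrix.mul_assoc, hhe, mul_add, smul_mul_assoc,
      mul_smul_comm, ← Matrix.mul_assoc]
    push_cast
    module

theorem e_pow_lie_f (t : OrthTriple π e h f) (m : ℕ) :
    e ^ (m + 1) * f - f * e ^ (m + 1) = ((m + 1 : ℕ) : k) • (h * e ^ m - (m : k) • e ^ m) := by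
  have heh : e * h = h * e - (2 : k) • e := by rw [← t.lie_h_e]; abel
  induction m with
  | zero => simp [t.lie_e_f]
  | succ m ih =>
    have h1 : e ^ (m + 1 + 1) * f - f * e ^ (m + 1 + 1) =
        e * (e ^ (m + 1) * f - f * e ^ (m + 1)) + h * e ^ (m + 1) := by
      rw [← t.lie_e_f, pow_succ' e (m + 1)]
      noncomm_ring
    rw [h1, ih, mul_smul_comm, mul_sub, ← Matrix.mul_assoc, heh, sub_mul, smul_mul_assoc,
      mul_smul_comm, Matrix.mul_assoc, ← pow_succ']
    push_cast
    module

/-- Commuting `f` past `e ^ (N + 1) = 0` gives `(N + 1) • (h * e ^ N - N • e ^ N) = 0`. For `N = p -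
1` this is void, and `hasHeight_of_rankLeOne` takes over. -/
theorem hasHeight (t : OrthTriple π e h f) {N : ℕ} (he : e ^ (N + 1) = 0) (hf : f ^ (N + 1) = 0)
    (hN : ((N + 1 : ℕ) : k) ≠ 0) : HasHeight N e h f := by
  refine ⟨he, hf, ?_, ?_⟩
  · have := t.e_pow_lie_f N
    rw [he, zero_mul, mul_zero, sub_self] at this
    exact sub_eq_zero.1 ((smul_eq_zero.1 this.symm).resolve_left hN)
  · have := t.swap.e_pow_lie_f N
    rw [hf, zero_mul, mul_zero, sub_self] at this
    have h' := sub_eq_zero.1 ((smul_eq_zero.1 this.symm).resolve_left hN)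
    rw [neg_mul] at h'
    rw [← h', neg_neg]

theorem e_pow_mul_h (t : OrthTriple π e h f) {N : ℕ} (H : HasHeight N e h f) :
    e ^ N * h = -((N : k) • e ^ N) := by
  have h1 := t.h_mul_e_pow N
  rw [H.h_mul_e_pow] at h1
  rw [eq_sub_of_add_eq h1.symm]
  module

theorem h_mul_e_pow_mul (t : OrthTriple π e h f) {N : ℕ} {Y : Matrix ι ι k}
    (hh : h * Y = -((N : k) • Y)) (j : ℕ) : h * (e ^ j * Y) = (2 * (j : k) - N) • (e ^ j * Y) := by
  rw [← Matrix.mul_assoc, t.h_mul_e_pow, add_mul, Matrix.mul_assoc, hh, mul_neg, mul_smul_comm,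
    smul_mul_assoc]
  module

theorem f_mul_e_pow_mul (t : OrthTriple π e h f) {N : ℕ} {Y : Matrix ι ι k} (hf : f * Y = 0)
    (hh : h * Y = -((N : k) • Y)) (j : ℕ) :
    f * (e ^ (j + 1) * Y) = (((j + 1 : ℕ) : k) * ((N : k) - j)) • (e ^ j * Y) := by
  have hfe : f * e = e * f - h := by rw [← t.lie_e_f]; abel
  have key : f * (e ^ (j + 1) * Y) = e * (f * (e ^ j * Y)) - h * (e ^ j * Y) := by
    rw [pow_succ', Matrix.mul_assoc, ← Matrix.mul_assoc, hfe, sub_mul, Matrix.mul_assoc e]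
  induction j with
  | zero => rw [key]; simp [hf, hh]
  | succ j ih =>
    have key' : f * (e ^ (j + 1) * Y) = e * (f * (e ^ j * Y)) - h * (e ^ j * Y) := by
      rw [pow_succ', Matrix.mul_assoc, ← Matrix.mul_assoc, hfe, sub_mul, Matrix.mul_assoc e]
    rw [key, ih key', t.h_mul_e_pow_mul hh, mul_smul_comm, ← Matrix.mul_assoc, ← pow_succ']
    push_cast
    module

theorem mul_f_pow_mul_e (t : OrthTriple π e h f) {N : ℕ} {Y : Matrix ι ι k} (hf : Y * e = 0)
    (hh : Y * h = -((N : k) • Y)) (j : ℕ) :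
    Y * f ^ (j + 1) * e = (((j + 1 : ℕ) : k) * ((N : k) - j)) • (Y * f ^ j) := by
  have hef : f * e = e * f - h := by rw [← t.lie_e_f]; abel
  have hw (m : ℕ) : Y * f ^ m * h = (2 * (m : k) - N) • (Y * f ^ m) := by
    have h1 := t.swap.h_mul_e_pow m
    have h2 : f ^ m * h = h * f ^ m + (2 * (m : k)) • f ^ m := by
      rw [neg_mul, mul_neg] at h1
      rw [← neg_neg (h * f ^ m), h1]
      abel
    rw [Matrix.mul_assoc, h2, mul_add, ← Matrix.mul_assoc, hh, neg_mul, smul_mul_assoc, mul_smul_comm]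
    module
  have key (m : ℕ) : Y * f ^ (m + 1) * e = Y * f ^ m * e * f - Y * f ^ m * h := by
    rw [pow_succ, ← Matrix.mul_assoc, Matrix.mul_assoc _ f e, hef, mul_sub, ← Matrix.mul_assoc]
  induction j with
  | zero => rw [key, hw]; simp [hf]
  | succ j ih =>
    rw [key, ih, hw, smul_mul_assoc, Matrix.mul_assoc, ← pow_succ]
    push_cast
    module

end OrthTriple

/-- The product of the ladder coefficients `(j + 1) (N - j)` for `j < i`. -/
def ladder (k : Type*) [Field k] (N i : ℕ) : k :=
  ∏ j ∈ Finset.range i, (((j + 1 : ℕ) : k) * ((N : k) - j))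

/-- All factors `j + 1` and `N - j` lie between `1` and `N`. -/
theorem ladder_ne_zero {N : ℕ} (hN : ∀ m : ℕ, 0 < m → m ≤ N → (m : k) ≠ 0) {i : ℕ} (hi : i ≤ N) :
    ladder k N i ≠ 0 := by
  refine Finset.prod_ne_zero_iff.2 fun j hj => ?_
  have hj' : j < i := Finset.mem_range.1 hj
  rw [← Nat.cast_sub (by omega)]
  exact mul_ne_zero (hN _ (by omega) (by omega)) (hN _ (by omega) (by omega))

theorem OrthTriple.f_pow_mul_e_pow_mul {π e h f : Matrix ι ι k} (t : OrthTriple π e h f) {N : ℕ}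
    {Y : Matrix ι ι k} (hf : f * Y = 0) (hh : h * Y = -((N : k) • Y)) (j : ℕ) :
    f ^ j * (e ^ j * Y) = ladder k N j • Y := by
  induction j with
  | zero => simp [ladder]
  | succ j ih =>
    rw [pow_succ f, Matrix.mul_assoc, t.f_mul_e_pow_mul hf hh, mul_smul_comm, ih,
      smul_smul, mul_comm, ladder, ladder, Finset.prod_range_succ]

namespace HasHeight

variable {π e h f : Matrix ι ι k} {N : ℕ}

theorem swap (H : HasHeight N e h f) : HasHeight N f (-h) e where
  e_pow := H.f_pow
  f_pow := H.e_pow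
  h_mul_e_pow := by rw [neg_mul, H.h_mul_f_pow, neg_neg]
  h_mul_f_pow := by rw [neg_mul, H.h_mul_e_pow]

theorem f_pow_mul_e_pow_mul_f_pow (H : HasHeight N e h f) (t : OrthTriple π e h f) :
    f ^ N * (e ^ N * f ^ N) = ladder k N N • f ^ N :=
  t.f_pow_mul_e_pow_mul (by rw [← pow_succ', H.f_pow]) H.h_mul_f_pow N

theorem e_pow_mul_f_pow_mul_e_pow (H : HasHeight N e h f) (t : OrthTriple π e h f) :
    e ^ N * (f ^ N * e ^ N) = ladder k N N • e ^ N :=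
  H.swap.f_pow_mul_e_pow_mul_f_pow t.swap

end HasHeight

/-- The intertwiner between the isotypic parts of height `N` that is induced by `φ`. -/
def topIntertwiner (N : ℕ) (e f e' f' φ : Matrix ι ι k) : Matrix ι ι k :=
  ∑ i ∈ Finset.range (N + 1), ((ladder k N N)⁻¹ * (ladder k N i)⁻¹) •
    (e' ^ i * (f' ^ N * φ * e ^ N) * f ^ i)

section

variable {π e h f π' e' h' f' φ : Matrix ι ι k} {N : ℕ}
  (hN : ∀ m : ℕ, 0 < m → m ≤ N → (m : k) ≠ 0)
  (t : OrthTriple π e h f) (H : HasHeight N e h f)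
  (t' : OrthTriple π' e' h' f') (H' : HasHeight N e' h' f')

include hN in
theorem inv_ladder_succ_mul {i : ℕ} (hi : i < N) :
    (ladder k N (i + 1))⁻¹ * (((i + 1 : ℕ) : k) * ((N : k) - i)) = (ladder k N i)⁻¹ := by
  have h1 := ladder_ne_zero hN (show i + 1 ≤ N by omega)
  have h2 := ladder_ne_zero hN (show i ≤ N by omega)
  have h3 : ladder k N (i + 1) = ladder k N i * (((i + 1 : ℕ) : k) * ((N : k) - i)) :=
    Finset.prod_range_succ _ _
  rw [inv_mul_eq_iff_eq_mul₀ h1, h3, mul_right_comm, mul_inv_cancel₀ h2, one_mul]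

include hN t H H' in
-- The sum telescopes: summand `i + 1` times `e` is `e'` times summand `i`, because the inverse
-- ladder coefficients absorb the factor `(i + 1) * (N - i)`. The end terms vanish by `e ^ (N + 1) =
-- 0` and `e' ^ (N + 1) = 0`.
theorem topIntertwiner_mul_e : topIntertwiner N e f e' f' φ * e =
    e' * topIntertwiner N e f e' f' φ := by
  have hYe : (f' ^ N * φ * e ^ N) * e = 0 := by
    rw [Matrix.mul_assoc, ← pow_succ, H.e_pow, mul_zero]
  have hYh : (f' ^ N * φ * e ^ N) * h = -((N : k) • (f' ^ N * φ * e ^ N)) := by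
    rw [Matrix.mul_assoc, t.e_pow_mul_h H, mul_neg, mul_smul_comm]
  rw [topIntertwiner, Finset.sum_mul, Finset.mul_sum, Finset.sum_range_succ', Finset.sum_range_succ]
  congr 1
  · refine Finset.sum_congr rfl fun i hi => ?_
    rw [smul_mul_assoc, Matrix.mul_assoc (e' ^ (i + 1)), Matrix.mul_assoc, t.mul_f_pow_mul_e hYe hYh,
      mul_smul_comm, smul_smul, mul_assoc, inv_ladder_succ_mul hN (Finset.mem_range.1 hi),
      mul_smul_comm, pow_succ']
    simp only [Matrix.mul_assoc]
  · rw [smul_mul_assoc, pow_zero, pow_zero, mul_one, one_mul, hYe, smul_zero, mul_smul_comm,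
      ← Matrix.mul_assoc, ← Matrix.mul_assoc, ← pow_succ', H'.e_pow, zero_mul, zero_mul, smul_zero]

include hN t' H H' in
theorem topIntertwiner_mul_f : topIntertwiner N e f e' f' φ * f =
    f' * topIntertwiner N e f e' f' φ := by
  have hYe : f' * (f' ^ N * φ * e ^ N) = 0 := by
    rw [← Matrix.mul_assoc, ← Matrix.mul_assoc, ← pow_succ', H'.f_pow, zero_mul, zero_mul]
  have hYh : h' * (f' ^ N * φ * e ^ N) = -((N : k) • (f' ^ N * φ * e ^ N)) := by
    rw [← Matrix.mul_assoc, ← Matrix.mul_assoc, H'.h_mul_f_pow, neg_mul, neg_mul, smul_mul_assoc,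
      smul_mul_assoc]
  symm
  rw [topIntertwiner, Finset.sum_mul, Finset.mul_sum, Finset.sum_range_succ', Finset.sum_range_succ]
  congr 1
  · refine Finset.sum_congr rfl fun i hi => ?_
    rw [mul_smul_comm, ← Matrix.mul_assoc, t'.f_mul_e_pow_mul hYe hYh, smul_mul_assoc,
      smul_smul, mul_assoc, inv_ladder_succ_mul hN (Finset.mem_range.1 hi), smul_mul_assoc, pow_succ]
    simp only [Matrix.mul_assoc]
  · rw [smul_mul_assoc, pow_zero, pow_zero, mul_one, one_mul, mul_smul_comm, hYe, smul_zero,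
      Matrix.mul_assoc, ← pow_succ, H.f_pow, mul_zero, smul_zero]

/-- The summand `i = 0` ends in `e ^ N` and all others begin with `e'`. Hence the intertwiner does
not affect the forms on the multiplicity spaces of shorter strings. -/
theorem exists_topIntertwiner_mul {x : Matrix ι ι k} (hx : e ^ N * x = 0) :
    ∃ z, topIntertwiner N e f e' f' φ * x = e' * z := by
  rw [topIntertwiner, Finset.sum_mul, Finset.sum_range_succ']
  refine ⟨∑ i ∈ Finset.range N, ((ladder k N N)⁻¹ * (ladder k N (i + 1))⁻¹) •
    (e' ^ i * (f' ^ N * φ * e ^ N) * f ^ (i + 1)) * x, ?_⟩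
  rw [Finset.mul_sum, smul_mul_assoc, pow_zero, pow_zero, one_mul, mul_one, Matrix.mul_assoc _ _ x,
    hx, mul_zero, smul_zero, add_zero]
  refine Finset.sum_congr rfl fun i _ => ?_
  rw [smul_mul_assoc, smul_mul_assoc, mul_smul_comm, pow_succ']
  simp only [Matrix.mul_assoc]

include hN t' H' in
-- Only the summand `i = 0` survives; the factor `(ladder k N N)⁻¹` in the definition is chosen for
-- this normalisation.
theorem e_pow_mul_topIntertwiner (hφ : φ * e = e' * φ) :
    e' ^ N * topIntertwiner N e f e' f' φ = φ * e ^ N := by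
  have hφN : φ * e ^ N = e' ^ N * φ := (SemiconjBy.pow_right (show SemiconjBy φ e e' from hφ) N).eq
  rw [topIntertwiner, Finset.mul_sum, Finset.sum_range_succ', Finset.sum_eq_zero, zero_add]
  · rw [pow_zero, pow_zero, one_mul, mul_one, mul_smul_comm, Matrix.mul_assoc, hφN,
      ← Matrix.mul_assoc, ← Matrix.mul_assoc, Matrix.mul_assoc (e' ^ N), H'.e_pow_mul_f_pow_mul_e_pow t',
      smul_mul_assoc, smul_smul]
    have : ladder k N N ≠ 0 := ladder_ne_zero hN le_rfl
    simp [ladder] at this ⊢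
    rw [inv_mul_cancel₀ this, one_smul]
  · intro i _
    rw [mul_smul_comm, ← Matrix.mul_assoc, ← Matrix.mul_assoc, ← pow_add,
      show N + (i + 1) = N + 1 + i by ring, pow_add, H'.e_pow]
    simp

theorem topIntertwiner_mul_f_pow (H : HasHeight N e h f) : topIntertwiner N e f e' f' φ * f ^ N =
    (ladder k N N)⁻¹ • (f' ^ N * φ * e ^ N * f ^ N) := by
  rw [topIntertwiner, Finset.sum_mul, Finset.sum_range_succ', Finset.sum_eq_zero, zero_add]
  · simp [ladder]
  · intro i _
    rw [smul_mul_assoc, Matrix.mul_assoc, ← pow_add, show i + 1 + N = N + 1 + i by ring, pow_add f,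
      H.f_pow]
    simp

theorem topIntertwiner_mul_proj (t : OrthTriple π e h f) (hφ : φ * π = φ) :
    topIntertwiner N e f e' f' φ * π = topIntertwiner N e f e' f' φ := by
  rw [topIntertwiner, Finset.sum_mul]
  refine Finset.sum_congr rfl fun i _ => ?_
  rw [smul_mul_assoc]
  congr 1
  have hc1 : π * e ^ N = e ^ N * π :=
    (Commute.pow_right (show Commute π e by rw [Commute, SemiconjBy, t.proj_mul_e, t.e_mul_proj]) N).eq
  have hc2 : π * f ^ i = f ^ i * π :=
    (Commute.pow_right (show Commute π f by rw [Commute, SemiconjBy, t.proj_mul_f, t.f_mul_proj]) i).eq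
  rw [Matrix.mul_assoc, ← hc2, ← Matrix.mul_assoc, show e' ^ i * (f' ^ N * φ * e ^ N) * π =
    e' ^ i * (f' ^ N * φ * (e ^ N * π)) by simp only [Matrix.mul_assoc], ← hc1,
    show f' ^ N * φ * (π * e ^ N) = f' ^ N * (φ * π) * e ^ N by simp only [Matrix.mul_assoc], hφ]

theorem proj_mul_topIntertwiner (t' : OrthTriple π' e' h' f') (hφ : π' * φ = φ) :
    π' * topIntertwiner N e f e' f' φ = topIntertwiner N e f e' f' φ := by
  rw [topIntertwiner, Finset.mul_sum]
  refine Finset.sum_congr rfl fun i _ => ?_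
  rw [mul_smul_comm]
  congr 1
  have hc1 : π' * e' ^ i = e' ^ i * π' :=
    (Commute.pow_right (show Commute π' e' by
      rw [Commute, SemiconjBy, t'.proj_mul_e, t'.e_mul_proj]) i).eq
  have hc2 : π' * f' ^ N = f' ^ N * π' :=
    (Commute.pow_right (show Commute π' f' by
      rw [Commute, SemiconjBy, t'.proj_mul_f, t'.f_mul_proj]) N).eq
  simp only [← Matrix.mul_assoc]
  rw [hc1, Matrix.mul_assoc _ π', hc2, ← Matrix.mul_assoc, Matrix.mul_assoc _ π', hφ]

include hN t H t' H' in
-- Both `e` and `e'` are skew, so the transpose `Tᵀ` of the intertwiner satisfies `Tᵀ * e' = e *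
-- Tᵀ`. By `hR`, the isometry condition in degree `N`, it carries `f' ^ N * φ * e ^ N` to `f ^ N * π
-- * e ^ N`, and the two sums agree term by term.
theorem transpose_topIntertwiner_mul (hφ : φ * e = e' * φ) (hR : φᵀ * e' ^ N * φ = π * e ^ N) :
    (topIntertwiner N e f e' f' φ)ᵀ * topIntertwiner N e f e' f' φ =
      topIntertwiner N e f e f π := by
  have hL : ladder k N N ≠ 0 := ladder_ne_zero hN le_rfl
  have sgn : ((-1 : k) ^ N) * (-1) ^ N = 1 := by rw [← mul_pow]; simp
  have hφN : φ * e ^ N = e' ^ N * φ := (SemiconjBy.pow_right (show SemiconjBy φ e e' from hφ) N).eq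
  have hφt : φᵀ * e' = e * φᵀ := by
    have := congrArg transpose hφ
    rw [transpose_mul, transpose_mul, t.transpose_e, t'.transpose_e, neg_mul, mul_neg, neg_inj] at this
    exact this.symm
  have hφtN : φᵀ * e' ^ N = e ^ N * φᵀ :=
    (SemiconjBy.pow_right (show SemiconjBy φᵀ e' e from hφt) N).eq
  set T := topIntertwiner N e f e' f' φ with hT
  have hTe : T * e = e' * T := topIntertwiner_mul_e hN t H H'
  have hTf : T * f = f' * T := topIntertwiner_mul_f hN H t' H'
  have hTte : Tᵀ * e' = e * Tᵀ := by
    have := congrArg transpose hTe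
    rw [transpose_mul, transpose_mul, t.transpose_e, t'.transpose_e, neg_mul, mul_neg, neg_inj] at this
    exact this.symm
  have hTfN : T * f ^ N = f' ^ N * T := (SemiconjBy.pow_right (show SemiconjBy T f f' from hTf) N).eq
  have hTtf : Tᵀ * f' ^ N = (ladder k N N)⁻¹ • (f ^ N * e ^ N * φᵀ * f' ^ N) := by
    have h1 : f' ^ N * T = (ladder k N N)⁻¹ • (f' ^ N * φ * e ^ N * f ^ N) := by
      rw [← hTfN, hT, topIntertwiner_mul_f_pow H]
    have h2 := congrArg transpose h1
    simp only [transpose_mul, transpose_smul, transpose_pow_of_skew t.transpose_e,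
      transpose_pow_of_skew t.transpose_f, transpose_pow_of_skew t'.transpose_f, mul_smul_comm,
      smul_mul_assoc, smul_smul, mul_assoc, sgn, mul_one] at h2
    have h3 := congrArg (fun z => (-1 : k) ^ N • z) h2
    simp only [smul_smul, sgn, one_smul] at h3
    rw [h3, mul_left_comm, sgn, mul_one]
    simp only [Matrix.mul_assoc]
  have hmid : Tᵀ * (f' ^ N * φ * e ^ N) = f ^ N * π * e ^ N := by
    rw [Matrix.mul_assoc (f' ^ N) φ, hφN, ← Matrix.mul_assoc, hTtf, smul_mul_assoc,
      Matrix.mul_assoc (f ^ N), ← hφtN,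
      show f ^ N * (φᵀ * e' ^ N) * f' ^ N * (e' ^ N * φ) =
        f ^ N * (φᵀ * (e' ^ N * (f' ^ N * e' ^ N)) * φ) by simp only [Matrix.mul_assoc],
      H'.e_pow_mul_f_pow_mul_e_pow t', mul_smul_comm, smul_mul_assoc, mul_smul_comm, smul_smul,
      inv_mul_cancel₀ hL, one_smul, hR, Matrix.mul_assoc]
  have hexp (S : Matrix ι ι k) : S * T = ∑ i ∈ Finset.range (N + 1),
      S * (((ladder k N N)⁻¹ * (ladder k N i)⁻¹) • (e' ^ i * (f' ^ N * φ * e ^ N) * f ^ i)) := by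
    rw [hT, topIntertwiner, Finset.mul_sum]
  rw [hexp, topIntertwiner]
  refine Finset.sum_congr rfl fun i _ => ?_
  have hTi : Tᵀ * e' ^ i = e ^ i * Tᵀ := (SemiconjBy.pow_right (show SemiconjBy Tᵀ e' e from hTte) i).eq
  rw [mul_smul_comm, ← Matrix.mul_assoc, ← Matrix.mul_assoc, hTi, Matrix.mul_assoc (e ^ i), hmid]

end

end Intertwiners

end SlTwoOrbits

namespace SlTwoOrbits

open Matrix

/-! ### Isometries that intertwine two triples, by descending string length. -/

section Conjugacy

variable {ι k : Type*} [Fintype ι] [DecidableEq ι] [Field k]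

/-- For skew `e`, the kernel of `e ^ m` is orthogonal to its image. -/
theorem transpose_mul_pow_mul_eq_zero {e a : Matrix ι ι k} (he : eᵀ = -e) {m : ℕ}
    (h : e ^ m * a = 0) (z : Matrix ι ι k) : aᵀ * (e ^ m * z) = 0 := by
  have sgn : ((-1 : k) ^ m) * (-1) ^ m = 1 := by rw [← mul_pow]; simp
  have h1 := congrArg (fun z => (-1 : k) ^ m • zᵀ) h
  simp only [transpose_mul, transpose_pow_of_skew he, transpose_zero, smul_zero, mul_smul_comm,
    smul_smul, sgn, one_smul] at h1
  rw [← Matrix.mul_assoc, h1, zero_mul]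

/-- The projection onto the isotypic part of height `N` of an `sl₂`-triple. -/
def topProj (N : ℕ) (π e f : Matrix ι ι k) : Matrix ι ι k :=
  topIntertwiner N e f e f π

namespace OrthTriple

variable {π e h f : Matrix ι ι k} {N : ℕ}

omit [DecidableEq ι] in
theorem proj_comm_e (t : OrthTriple π e h f) : π * e = e * π := by
  rw [t.proj_mul_e, t.e_mul_proj]

theorem proj_comm_e_pow (t : OrthTriple π e h f) (m : ℕ) : π * e ^ m = e ^ m * π :=
  (Commute.pow_right (show Commute π e from t.proj_comm_e) m).eq

theorem proj_mul_e_pow (t : OrthTriple π e h f) (m : ℕ) : π * e ^ (m + 1) = e ^ (m + 1) := by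
  rw [pow_succ', ← Matrix.mul_assoc, t.proj_mul_e]

theorem e_pow_mul_proj (t : OrthTriple π e h f) (m : ℕ) : e ^ (m + 1) * π = e ^ (m + 1) := by
  rw [pow_succ, Matrix.mul_assoc, t.e_mul_proj]

/-- This is the isometry identity for `φ = π`. A matrix with `qᵀ * q = q` is symmetric and
idempotent, so `topProj` is an orthogonal projection. -/
theorem transpose_topProj_mul (t : OrthTriple π e h f) (H : HasHeight N e h f)
    (hN : ∀ m : ℕ, 0 < m → m ≤ N → (m : k) ≠ 0) :
    (topProj N π e f)ᵀ * topProj N π e f = topProj N π e f :=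
  transpose_topIntertwiner_mul hN t H t H t.proj_comm_e
    (by rw [t.transpose_proj, t.proj_comm_e_pow, Matrix.mul_assoc, t.proj_idem])

theorem transpose_topProj (t : OrthTriple π e h f) (H : HasHeight N e h f)
    (hN : ∀ m : ℕ, 0 < m → m ≤ N → (m : k) ≠ 0) : (topProj N π e f)ᵀ = topProj N π e f := by
  rw [← t.transpose_topProj_mul H hN, transpose_mul, transpose_transpose]

theorem topProj_idem (t : OrthTriple π e h f) (H : HasHeight N e h f)
    (hN : ∀ m : ℕ, 0 < m → m ≤ N → (m : k) ≠ 0) :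
    topProj N π e f * topProj N π e f = topProj N π e f := by
  have := t.transpose_topProj_mul H hN
  rwa [t.transpose_topProj H hN] at this

theorem topProj_mul_f_pow (t : OrthTriple π e h f) (H : HasHeight N e h f)
    (hN : ∀ m : ℕ, 0 < m → m ≤ N → (m : k) ≠ 0) : topProj N π e f * f ^ N = f ^ N * π := by
  have hL : ladder k N N ≠ 0 := ladder_ne_zero hN le_rfl
  have h1 := t.swap.proj_comm_e_pow N
  rw [topProj, topIntertwiner_mul_f_pow H, Matrix.mul_assoc (f ^ N) π, t.proj_comm_e_pow,
    Matrix.mul_assoc (f ^ N), Matrix.mul_assoc (e ^ N), h1, ← Matrix.mul_assoc, ← Matrix.mul_assoc,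
    Matrix.mul_assoc (f ^ N), H.f_pow_mul_e_pow_mul_f_pow t, smul_mul_assoc, smul_smul,
    inv_mul_cancel₀ hL, one_smul]

theorem topProj_comm_e (t : OrthTriple π e h f) (H : HasHeight N e h f)
    (hN : ∀ m : ℕ, 0 < m → m ≤ N → (m : k) ≠ 0) :
    topProj N π e f * e = e * topProj N π e f :=
  topIntertwiner_mul_e hN t H H

theorem topProj_comm_f (t : OrthTriple π e h f) (H : HasHeight N e h f)
    (hN : ∀ m : ℕ, 0 < m → m ≤ N → (m : k) ≠ 0) :
    topProj N π e f * f = f * topProj N π e f :=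
  topIntertwiner_mul_f hN H t H

theorem topProj_mul_proj (t : OrthTriple π e h f) : topProj N π e f * π = topProj N π e f :=
  topIntertwiner_mul_proj t t.proj_idem

theorem proj_mul_topProj (t : OrthTriple π e h f) : π * topProj N π e f = topProj N π e f :=
  proj_mul_topIntertwiner t t.proj_idem

theorem e_pow_mul_topProj (t : OrthTriple π e h f) (H : HasHeight N e h f)
    (hN : ∀ m : ℕ, 0 < m → m ≤ N → (m : k) ≠ 0) : e ^ N * topProj N π e f = π * e ^ N :=
  e_pow_mul_topIntertwiner hN t H t.proj_comm_e

/-- The part of the triple that is orthogonal to a symmetric idempotent `q ≤ π` commuting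
with it. -/
theorem complement (t : OrthTriple π e h f) {q : Matrix ι ι k} (hqt : qᵀ = q) (hqq : q * q = q)
    (hqe : q * e = e * q) (hqf : q * f = f * q) (hπq : π * q = q) :
    OrthTriple (π - q) (e * (1 - q)) (h * (1 - q)) (f * (1 - q)) := by
  have hqπ : q * π = q := by
    have := congrArg transpose hπq
    rwa [transpose_mul, hqt, t.transpose_proj] at this
  have hqh : q * h = h * q := by
    rw [← t.lie_e_f, mul_sub, sub_mul, ← Matrix.mul_assoc, ← Matrix.mul_assoc, hqe, hqf,
      Matrix.mul_assoc, Matrix.mul_assoc, hqe, hqf, ← Matrix.mul_assoc, ← Matrix.mul_assoc]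
  have mulr {a b : Matrix ι ι k} (hb : q * b = b * q) :
      a * (1 - q) * (b * (1 - q)) = a * b * (1 - q) := by
    have : (1 - q) * (b * (1 - q)) = b * (1 - q) := by
      rw [sub_mul, one_mul, ← Matrix.mul_assoc, hb, Matrix.mul_assoc, mul_sub q, mul_one, hqq,
        sub_self, mul_zero, sub_zero]
    rw [Matrix.mul_assoc, this, Matrix.mul_assoc]
  have hsk {a : Matrix ι ι k} (ha : aᵀ = -a) (hb : q * a = a * q) :
      (a * (1 - q))ᵀ = -(a * (1 - q)) := by
    rw [transpose_mul, transpose_sub, transpose_one, hqt, ha, sub_mul, one_mul, mul_neg, hb]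
    noncomm_ring
  have hpr {a : Matrix ι ι k} (ha : π * a = a) (hb : q * a = a * q) :
      (π - q) * (a * (1 - q)) = a * (1 - q) := by
    rw [sub_mul, ← Matrix.mul_assoc, ← Matrix.mul_assoc, ha, hb, Matrix.mul_assoc, mul_sub q,
      mul_one, hqq, sub_self, mul_zero, sub_zero]
  refine ⟨by rw [transpose_sub, t.transpose_proj, hqt], ?_, hsk t.transpose_e hqe,
    hsk t.transpose_f hqf, ?_, ?_, ?_, hpr t.proj_mul_e hqe, hpr t.proj_mul_f hqf⟩
  · rw [mul_sub, sub_mul, sub_mul, t.proj_idem, hqπ, hπq, hqq]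
    abel
  · rw [mulr hqe, mulr hqh, ← sub_mul, t.lie_h_e, smul_mul_assoc]
  · rw [mulr hqf, mulr hqh, ← sub_mul, t.lie_h_f, neg_mul, smul_mul_assoc]
  · rw [mulr hqf, mulr hqe, ← sub_mul, t.lie_e_f]

end OrthTriple

/-- `φ` and `ψ` induce compatible isometries of the multiplicity spaces
`ker e ^ (d + 1) / (ker e ^ d + e ker e ^ (d + 2))`. -/
def AgreeOnKernels (π e e' φ ψ : Matrix ι ι k) : Prop :=
  ∀ (d : ℕ) (x y : Matrix ι ι k), e ^ (d + 1) * x = 0 → e ^ (d + 1) * y = 0 → π * x = x → π * y = y →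
    (φ * y)ᵀ * (e' ^ d * (ψ * x)) = yᵀ * (e ^ d * x)

/-- A map intertwining `e` and `e'` that preserves the forms on the multiplicity spaces can be
replaced by an isometry that intertwines the `sl₂`-triples. -/
theorem exists_isometry_intertwiner (N : ℕ) : ∀ {π e h f π' e' h' f' φ : Matrix ι ι k},
    (∀ m : ℕ, 0 < m → m ≤ N → (m : k) ≠ 0) →
    OrthTriple π e h f → HasHeight N e h f → OrthTriple π' e' h' f' → HasHeight N e' h' f' →
    φ * e = e' * φ → φ * π = φ → π' * φ = φ → AgreeOnKernels π e e' φ φ →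
    ∃ ψ, ψ * e = e' * ψ ∧ ψ * f = f' * ψ ∧ ψ * π = ψ ∧ π' * ψ = ψ ∧ ψᵀ * ψ = π ∧
      AgreeOnKernels π e e' φ ψ := by
  induction N with
  | zero =>
    intro π e h f π' e' h' f' φ _ t H t' H' hφ hφπ hπφ hR
    have he := H.e_pow
    have hf := H.f_pow
    have hf' := H'.f_pow
    rw [zero_add, pow_one] at he hf hf'
    refine ⟨φ, hφ, by rw [hf, hf', mul_zero, zero_mul], hφπ, hπφ, ?_, hR⟩
    -- Here `e = 0`, and agreement in degree `0` already says that `φ` is an isometry.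
    have := hR 0 π π (by rw [he]; simp) (by rw [he]; simp) t.proj_idem t.proj_idem
    rwa [pow_zero, one_mul, pow_zero, one_mul, hφπ, t.transpose_proj, t.proj_idem] at this
  | succ N ih =>
    intro π e h f π' e' h' f' φ hN t H t' H' hφ hφπ hπφ hR
    have hTe := topIntertwiner_mul_e (φ := φ) hN t H H'
    have hTf := topIntertwiner_mul_f (φ := φ) hN H t' H'
    have hTπ := topIntertwiner_mul_proj (N := N + 1) (e' := e') (f' := f') t hφπ
    have hπT := proj_mul_topIntertwiner (N := N + 1) (e := e) (f := f) t' hπφ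
    have hTK := fun x => @exists_topIntertwiner_mul _ _ _ _ _ e f e' f' φ (N + 1) x
    have heT := e_pow_mul_topIntertwiner (f := f) hN t' H' hφ
    have hφp (m : ℕ) : φ * e ^ m = e' ^ m * φ :=
      (SemiconjBy.pow_right (show SemiconjBy φ e e' from hφ) m).eq
    -- In top degree the kernel is everything, so `π` itself may be inserted for both arguments.
    have hRN := hR (N + 1) π π (by rw [H.e_pow, zero_mul]) (by rw [H.e_pow, zero_mul])
      t.proj_idem t.proj_idem
    rw [hφπ, t.transpose_proj, ← t.proj_comm_e_pow, ← Matrix.mul_assoc, ← Matrix.mul_assoc,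
      t.proj_idem] at hRN
    have hTT := transpose_topIntertwiner_mul hN t H t' H' hφ hRN
    have hqt := t.transpose_topProj H hN
    have hqq := t.topProj_idem H hN
    have hqe := t.topProj_comm_e H hN
    have hqf := t.topProj_comm_f H hN
    have hqπ := t.topProj_mul_proj (N := N + 1)
    have hπq := t.proj_mul_topProj (N := N + 1)
    have heq := t.e_pow_mul_topProj H hN
    have hqfN := t.topProj_mul_f_pow H hN
    rw [t.proj_mul_e_pow] at heq
    rw [t.swap.e_pow_mul_proj] at hqfN
    have hqK : ∀ x, e ^ (N + 1) * x = 0 → ∃ z, topProj (N + 1) π e f * x = e * z :=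
      fun x => exists_topIntertwiner_mul
    have hqt' := t'.transpose_topProj H' hN
    have hqq' := t'.topProj_idem H' hN
    have hqe' := t'.topProj_comm_e H' hN
    have hqf' := t'.topProj_comm_f H' hN
    have hqπ' := t'.topProj_mul_proj (N := N + 1)
    have hπq' := t'.proj_mul_topProj (N := N + 1)
    have heq' := t'.e_pow_mul_topProj H' hN
    have hqfN' := t'.topProj_mul_f_pow H' hN
    rw [t'.proj_mul_e_pow] at heq'
    rw [t'.swap.e_pow_mul_proj] at hqfN'
    have hqK' : ∀ x, e' ^ (N + 1) * x = 0 → ∃ z, topProj (N + 1) π' e' f' * x = e' * z :=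
      fun x => exists_topIntertwiner_mul
    have hqT : topProj (N + 1) π' e' f' * topIntertwiner (N + 1) e f e' f' φ =
        topIntertwiner (N + 1) e f e' f' φ := by
      have hc (i : ℕ) : topProj (N + 1) π' e' f' * e' ^ i = e' ^ i * topProj (N + 1) π' e' f' :=
        (Commute.pow_right (show Commute _ e' from hqe') i).eq
      conv_lhs => rw [topIntertwiner.eq_1 (N + 1) e f e' f' φ, Finset.mul_sum]
      rw [topIntertwiner.eq_1 (N + 1) e f e' f' φ]
      refine Finset.sum_congr rfl fun i _ => ?_
      rw [mul_smul_comm, ← Matrix.mul_assoc, ← Matrix.mul_assoc, hc, Matrix.mul_assoc (e' ^ i),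
        ← Matrix.mul_assoc _ (f' ^ (N + 1) * φ), ← Matrix.mul_assoc _ (f' ^ (N + 1)), hqfN']
    have hTq : topIntertwiner (N + 1) e f e' f' φ * topProj (N + 1) π e f =
        topIntertwiner (N + 1) e f e' f' φ := by
      have hc (i : ℕ) : topProj (N + 1) π e f * f ^ i = f ^ i * topProj (N + 1) π e f :=
        (Commute.pow_right (show Commute _ f from hqf) i).eq
      conv_lhs => rw [topIntertwiner.eq_1 (N + 1) e f e' f' φ, Finset.sum_mul]
      rw [topIntertwiner.eq_1 (N + 1) e f e' f' φ]
      refine Finset.sum_congr rfl fun i _ => ?_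
      rw [smul_mul_assoc, Matrix.mul_assoc, ← hc, Matrix.mul_assoc (e' ^ i), ← Matrix.mul_assoc _ _ (f ^ i),
        Matrix.mul_assoc _ (e ^ (N + 1)), heq, Matrix.mul_assoc (e' ^ i)]
    change _ = topProj (N + 1) π e f at hTT
    generalize topProj (N + 1) π e f = q at *
    generalize topProj (N + 1) π' e' f' = q' at *
    generalize topIntertwiner (N + 1) e f e' f' φ = T at *
    have t₁ := t.complement hqt hqq hqe hqf hπq
    have t₁' := t'.complement hqt' hqq' hqe' hqf' hπq'
    -- On the complements of the top parts the `(N + 1)`-st powers vanish, and invertibility of `N +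
    -- 1` yields the height condition there.
    have hN0 : ((N + 1 : ℕ) : k) ≠ 0 := hN (N + 1) (by omega) le_rfl
    have he₁ : (e * (1 - q)) ^ (N + 1) = 0 := by
      rw [pow_mul_one_sub hqq hqe, mul_sub, mul_one, heq, sub_self]
    have he₁' : (e' * (1 - q')) ^ (N + 1) = 0 := by
      rw [pow_mul_one_sub hqq' hqe', mul_sub, mul_one, heq', sub_self]
    have hf₁ : (f * (1 - q)) ^ (N + 1) = 0 := by
      rw [pow_mul_one_sub hqq hqf, mul_sub, mul_one,
        ← (Commute.pow_right (show Commute q f from hqf) (N + 1)).eq, hqfN, sub_self]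
    have hf₁' : (f' * (1 - q')) ^ (N + 1) = 0 := by
      rw [pow_mul_one_sub hqq' hqf', mul_sub, mul_one,
        ← (Commute.pow_right (show Commute q' f' from hqf') (N + 1)).eq, hqfN', sub_self]
    have hqc : q * (1 - q) = 0 := by rw [mul_sub, mul_one, hqq, sub_self]
    have hqc' : q' * (1 - q') = 0 := by rw [mul_sub, mul_one, hqq', sub_self]
    have hcc : (1 - q) * (1 - q) = 1 - q := by rw [sub_mul, hqc, one_mul, sub_zero]
    have hcc' : (1 - q') * (1 - q') = 1 - q' := by rw [sub_mul, hqc', one_mul, sub_zero]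
    have hce : (1 - q) * e = e * (1 - q) := by rw [sub_mul, hqe, mul_sub, one_mul, mul_one]
    have hce' : (1 - q') * e' = e' * (1 - q') := by rw [sub_mul, hqe', mul_sub, one_mul, mul_one]
    have hcep' (m : ℕ) : (1 - q') * e' ^ m = e' ^ m * (1 - q') :=
      (Commute.pow_right (show Commute (1 - q') e' from hce') m).eq
    have hct' : (1 - q')ᵀ = 1 - q' := by rw [transpose_sub, transpose_one, hqt']
    have hct : (1 - q)ᵀ = 1 - q := by rw [transpose_sub, transpose_one, hqt]
    set φ₁ := (1 - q') * φ * (1 - q) with hφ₁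
    have hφ₁e : φ₁ * (e * (1 - q)) = e' * (1 - q') * φ₁ := by
      rw [hφ₁, show (1 - q') * φ * (1 - q) * (e * (1 - q)) =
        (1 - q') * (φ * ((1 - q) * e)) * (1 - q) by simp only [Matrix.mul_assoc], hce,
        show (1 - q') * (φ * (e * (1 - q))) * (1 - q) = (1 - q') * (φ * e) * ((1 - q) * (1 - q)) by
          simp only [Matrix.mul_assoc], hφ, hcc,
        show (1 - q') * (e' * φ) * (1 - q) = ((1 - q') * e') * φ * (1 - q) by
          simp only [Matrix.mul_assoc], hce',
        show e' * (1 - q') * ((1 - q') * φ * (1 - q)) = e' * ((1 - q') * (1 - q')) * φ * (1 - q) by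
          simp only [Matrix.mul_assoc], hcc']
    have hφ₁π : φ₁ * (π - q) = φ₁ := by
      have h1 : (1 - q) * (π - q) = π - q := by
        rw [sub_mul, one_mul, mul_sub, hqπ, hqq, sub_self, sub_zero]
      rw [hφ₁, Matrix.mul_assoc, h1]
      simp only [Matrix.mul_assoc, mul_sub, hφπ, mul_one]
    have hπφ₁ : (π' - q') * φ₁ = φ₁ := by
      have h1 : (π' - q') * (1 - q') = π' - q' := by
        rw [mul_sub, mul_one, sub_mul, hπq', hqq', sub_self, sub_zero]
      rw [hφ₁, ← Matrix.mul_assoc, ← Matrix.mul_assoc, h1, sub_mul, hπφ, sub_mul 1, one_mul]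
    have hx₁ {x : Matrix ι ι k} (hx : (π - q) * x = x) : q * x = 0 ∧ π * x = x := by
      have h0 : q * x = 0 := by rw [← hx, ← Matrix.mul_assoc, mul_sub, hqπ, hqq, sub_self, zero_mul]
      refine ⟨h0, ?_⟩
      rwa [sub_mul, h0, sub_zero] at hx
    have hpow {x : Matrix ι ι k} (hx : q * x = 0) (d : ℕ) : (e * (1 - q)) ^ d * x = e ^ d * x := by
      cases d with
      | zero => rw [pow_zero, pow_zero]
      | succ d => rw [pow_mul_one_sub hqq hqe, Matrix.mul_assoc, sub_mul, hx, one_mul, sub_zero]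
    have hpow' {x : Matrix ι ι k} (hx : q' * x = 0) (d : ℕ) :
        (e' * (1 - q')) ^ d * x = e' ^ d * x := by
      cases d with
      | zero => rw [pow_zero, pow_zero]
      | succ d => rw [pow_mul_one_sub hqq' hqe', Matrix.mul_assoc, sub_mul, hx, one_mul, sub_zero]
    have hlt {d : ℕ} (hd : d < N + 1) {x : Matrix ι ι k} (hx : e ^ (d + 1) * x = 0) :
        e ^ (N + 1) * x = 0 := by
      rw [show N + 1 = (N - d) + (d + 1) by omega, pow_add, Matrix.mul_assoc, hx, mul_zero]
    have hφK {d : ℕ} {x : Matrix ι ι k} (hx : e ^ d * x = 0) : e' ^ d * (φ * x) = 0 := by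
      rw [← Matrix.mul_assoc, ← hφp, Matrix.mul_assoc, hx, mul_zero]
    have hR₁ : AgreeOnKernels (π - q) (e * (1 - q)) (e' * (1 - q')) φ₁ φ₁ := by
      intro d x y hx hy hπx hπy
      rcases le_or_gt (N + 1) d with hd | hd
      · rw [show d = (N + 1) + (d - (N + 1)) by omega, pow_add _ (N + 1), pow_add (e * (1 - q)) (N + 1),
          he₁, he₁']
        simp
      obtain ⟨hqx, hπx'⟩ := hx₁ hπx
      obtain ⟨hqy, hπy'⟩ := hx₁ hπy
      rw [hpow hqx] at hx ⊢
      rw [hpow hqy] at hy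
      have hφ₁x {x : Matrix ι ι k} (hqx : q * x = 0) : φ₁ * x = (1 - q') * (φ * x) := by
        rw [hφ₁, Matrix.mul_assoc, sub_mul 1 q, one_mul, hqx, sub_zero, Matrix.mul_assoc]
      have hz : q' * (φ₁ * x) = 0 := by
        rw [hφ₁x hqx, ← Matrix.mul_assoc, hqc', zero_mul]
      rw [hpow' hz, hφ₁x hqx, hφ₁x hqy, transpose_mul, hct', Matrix.mul_assoc,
        ← Matrix.mul_assoc (1 - q'), hcep', Matrix.mul_assoc, ← Matrix.mul_assoc (1 - q') (1 - q'),
        hcc', sub_mul, one_mul, mul_sub, mul_sub]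
      -- The part of `φ * x` cut off by `q'` lies in the image of `e'`; after `e' ^ d` it lies in
      -- the image of `e' ^ (d + 1)`, orthogonal to `φ * y`.
      obtain ⟨z, hz⟩ := hqK' (φ * x) (hφK (hlt hd hx))
      rw [hz, hR d x y hx hy hπx' hπy', ← Matrix.mul_assoc _ e' z, ← pow_succ,
        transpose_mul_pow_mul_eq_zero t'.transpose_e (hφK hy), sub_zero]
    obtain ⟨ψ₁, hψe, hψf, hψπ, hπψ, hψψ, hRψ⟩ := ih (fun m h0 hm => hN m h0 (by omega)) t₁
      (t₁.hasHeight he₁ hf₁ hN0) t₁' (t₁'.hasHeight he₁' hf₁' hN0) hφ₁e hφ₁π hπφ₁ hR₁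
    have hψq : ψ₁ * q = 0 := by
      rw [← hψπ, Matrix.mul_assoc, sub_mul, hπq, hqq, sub_self, mul_zero]
    have hqψ : q' * ψ₁ = 0 := by
      rw [← hπψ, ← Matrix.mul_assoc, mul_sub, hqπ', hqq', sub_self, zero_mul]
    have hψe' : ψ₁ * e = e' * ψ₁ := by
      rwa [mul_sub, mul_one, mul_sub, ← hqe, ← Matrix.mul_assoc, hψq, zero_mul, sub_zero,
        Matrix.mul_assoc, sub_mul, hqψ, one_mul, sub_zero] at hψe
    have hψf' : ψ₁ * f = f' * ψ₁ := by
      rwa [mul_sub, mul_one, mul_sub, ← hqf, ← Matrix.mul_assoc, hψq, zero_mul, sub_zero,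
        Matrix.mul_assoc, sub_mul, hqψ, one_mul, sub_zero] at hψf
    have hψep (m : ℕ) : ψ₁ * e ^ m = e' ^ m * ψ₁ :=
      (SemiconjBy.pow_right (show SemiconjBy ψ₁ e e' from hψe') m).eq
    have hTψ : Tᵀ * ψ₁ = 0 := by
      rw [← hqT, transpose_mul, hqt', Matrix.mul_assoc, hqψ, mul_zero]
    have hψT : ψ₁ᵀ * T = 0 := by
      have := congrArg transpose hTψ
      rwa [transpose_mul, transpose_transpose, transpose_zero] at this
    refine ⟨T + ψ₁, by rw [add_mul, mul_add, hTe, hψe'], by rw [add_mul, mul_add, hTf, hψf'], ?_, ?_, ?_,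
      ?_⟩
    · rw [← sub_add_cancel π q, mul_add, add_mul, add_mul, hψπ, hψq, hTq, mul_sub, hTπ, hTq]
      abel
    · rw [mul_add, hπT, ← sub_add_cancel π' q', add_mul, hπψ, hqψ, add_zero]
    · rw [transpose_add, add_mul, mul_add, mul_add, hTT, hψψ, hTψ, hψT]
      abel
    · intro d x y hx hy hπx hπy
      -- Below the top degree `T * x` lies in the image of `e'` and pairs to zero, so only `ψ₁`
      -- counts. In top degree `ψ₁` is killed and `T` agrees with `φ` by its normalisation. Above it
      -- all powers vanish.
      rcases lt_trichotomy d (N + 1) with hd | rfl | hd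
      · obtain ⟨z, hz⟩ := hTK x (hlt hd hx)
        obtain ⟨zx, hzx⟩ := hqK x (hlt hd hx)
        obtain ⟨zy, hzy⟩ := hqK y (hlt hd hy)
        have hcx (x : Matrix ι ι k) : q * ((1 - q) * x) = 0 := by
          rw [← Matrix.mul_assoc, hqc, zero_mul]
        have hkx {d : ℕ} {x : Matrix ι ι k} (hx : e ^ d * x = 0) : e ^ d * ((1 - q) * x) = 0 := by
          rw [← Matrix.mul_assoc, ← (Commute.pow_right (show Commute (1 - q) e from hce) d).eq,
            Matrix.mul_assoc, hx, mul_zero]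
        have hπcx {x : Matrix ι ι k} (hx : π * x = x) : (π - q) * ((1 - q) * x) = (1 - q) * x := by
          rw [← Matrix.mul_assoc, sub_mul, hqc, sub_zero, mul_sub π, mul_one, hπq, sub_mul, hx,
            sub_mul, one_mul]
        have key := hRψ d ((1 - q) * x) ((1 - q) * y) (by rw [hpow (hcx x), hkx hx])
          (by rw [hpow (hcx y), hkx hy]) (hπcx hπx) (hπcx hπy)
        have hψx : ψ₁ * ((1 - q) * x) = ψ₁ * x := by
          rw [← Matrix.mul_assoc, mul_sub, hψq, mul_one, sub_zero]
        have hq'ψ : q' * (ψ₁ * x) = 0 := by rw [← Matrix.mul_assoc, hqψ, zero_mul]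
        have hcψ (m : ℕ) : (1 - q') * (e' ^ m * (ψ₁ * x)) = e' ^ m * (ψ₁ * x) := by
          rw [← Matrix.mul_assoc, hcep', Matrix.mul_assoc, sub_mul, hq'ψ, one_mul, sub_zero]
        have hφy : φ₁ * ((1 - q) * y) = (1 - q') * (φ * y - φ * (e * zy)) := by
          rw [hφ₁, Matrix.mul_assoc _ (1 - q), ← Matrix.mul_assoc (1 - q), hcc, sub_mul 1 q, one_mul,
            hzy, Matrix.mul_assoc, mul_sub φ]
        have hψK : e' ^ (d + 1) * (ψ₁ * x) = 0 := by
          rw [← Matrix.mul_assoc, ← hψep, Matrix.mul_assoc, hx, mul_zero]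
        rw [hψx, hφy, hpow (hcx x), hpow' hq'ψ, transpose_mul, hct', Matrix.mul_assoc, hcψ,
          transpose_sub, sub_mul, ← Matrix.mul_assoc φ, hφ, Matrix.mul_assoc e', transpose_mul e',
          t'.transpose_e, mul_neg, neg_mul, Matrix.mul_assoc _ e', ← Matrix.mul_assoc e', ← pow_succ',
          hψK, mul_zero, neg_zero, sub_zero, transpose_mul (1 - q) y, hct, Matrix.mul_assoc,
          ← Matrix.mul_assoc (1 - q) (e ^ d), (Commute.pow_right (show Commute (1 - q) e from hce) d).eq,
          Matrix.mul_assoc, ← Matrix.mul_assoc (1 - q) (1 - q), hcc, sub_mul, one_mul, hzx, mul_sub,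
          ← Matrix.mul_assoc (e ^ d), ← pow_succ, mul_sub,
          transpose_mul_pow_mul_eq_zero t.transpose_e hy, sub_zero] at key
        rw [add_mul, hz, mul_add, ← Matrix.mul_assoc (e' ^ d), ← pow_succ, mul_add,
          transpose_mul_pow_mul_eq_zero t'.transpose_e (hφK hy), zero_add, key]
      · have hψN : e' ^ (N + 1) * ψ₁ = 0 := by
          rw [← heq', Matrix.mul_assoc, hqψ, mul_zero]
        rw [add_mul, mul_add, ← Matrix.mul_assoc _ ψ₁, hψN, zero_mul, add_zero, ← Matrix.mul_assoc _ T,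
          heT, hφp, Matrix.mul_assoc, hR _ x y hx hy hπx hπy]
      · rw [show d = (N + 1 + 1) + (d - (N + 1 + 1)) by omega, pow_add e' (N + 1 + 1),
          pow_add e (N + 1 + 1), H.e_pow, H'.e_pow]
        simp

end Conjugacy

end SlTwoOrbits

namespace SlTwoOrbits

open Matrix

/-! ### The rank condition, the determinant, and conjugacy of triples with the same `e`. -/

section Uniqueness

variable {ι k : Type*} [Field k]

/-- All `2 × 2` minors of `s` vanish, that is, `s` has rank at most one. -/
def RankLeOne (s : Matrix ι ι k) : Prop :=
  ∀ i j i' j', s i j * s i' j' = s i j' * s i' j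

theorem rankLeOne_iff {s : Matrix ι ι k} : RankLeOne s ↔ ∃ u v, s = vecMulVec u v := by
  constructor
  · intro hs
    by_cases h0 : s = 0
    · exact ⟨0, 0, by rw [h0, vecMulVec_zero]⟩
    · obtain ⟨a, b, hab⟩ : ∃ a b, s a b ≠ 0 := by
        by_contra! h
        exact h0 (Matrix.ext h)
      refine ⟨fun i => s i b, fun j => (s a b)⁻¹ * s a j, Matrix.ext fun i j => ?_⟩
      rw [vecMulVec_apply, mul_left_comm, ← hs i j a b]
      field_simp
  · rintro ⟨u, v, rfl⟩ i j i' j'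
    simp only [vecMulVec_apply]
    ring

variable [Fintype ι]

theorem RankLeOne.mul_mul {s : Matrix ι ι k} (hs : RankLeOne s) (z w : Matrix ι ι k) :
    RankLeOne (z * s * w) := by
  obtain ⟨u, v, rfl⟩ := rankLeOne_iff.1 hs
  exact rankLeOne_iff.2 ⟨_, _, by rw [mul_vecMulVec, vecMulVec_mul]⟩

/-- The relation shows that `h` preserves the line spanned by the image of `s`, so `h * s = α • s`.
Transposing gives `s * h = -(α • s)`, and the relation becomes `α = -α - 2`. -/
theorem RankLeOne.mul_eq_neg {s h : Matrix ι ι k} (hs : RankLeOne s) (h2 : (2 : k) ≠ 0)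
    (hst : sᵀ = s) (hh : hᵀ = -h) (hhs : h * s = s * h - (2 : k) • s) : h * s = -s := by
  by_cases h0 : s = 0
  · rw [h0]; simp
  obtain ⟨u, v, huv⟩ := rankLeOne_iff.1 hs
  obtain ⟨b, hb⟩ : ∃ b, v b ≠ 0 := by
    by_contra! h
    rw [show v = 0 from funext h, vecMulVec_zero] at huv
    exact h0 huv
  have h1 : vecMulVec (h *ᵥ u) v = vecMulVec u (v ᵥ* h - (2 : k) • v) := by
    rw [← mul_vecMulVec, ← huv, hhs, vecMulVec_sub, ← vecMulVec_mul, ← huv, vecMulVec_smul, ← huv]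
  obtain ⟨α, hα⟩ : ∃ α : k, h *ᵥ u = α • u := by
    refine ⟨(v ᵥ* h - (2 : k) • v) b * (v b)⁻¹, funext fun i => ?_⟩
    have := congrFun (congrFun h1 i) b
    rw [vecMulVec_apply, vecMulVec_apply] at this
    rw [Pi.smul_apply, smul_eq_mul, mul_right_comm, mul_comm _ (u i), ← this]
    field_simp
  have h3 : h * s = α • s := by rw [huv, mul_vecMulVec, hα, smul_vecMulVec]
  have h4 : s * h = -(α • s) := by
    have := congrArg transpose h3
    rw [transpose_mul, transpose_smul, hst, hh, mul_neg] at this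
    rw [← this, neg_neg]
  have h5 : (2 * (α + 1)) • s = 0 := by
    rw [h3, h4] at hhs
    calc (2 * (α + 1)) • s = α • s - (-(α • s) - (2 : k) • s) := by module
      _ = 0 := by rw [← hhs, sub_self]
  have h6 : α = -1 := by
    have := (smul_eq_zero.1 h5).resolve_right h0
    exact eq_neg_of_add_eq_zero_left ((mul_eq_zero.1 this).resolve_left h2)
  rw [h3, h6, neg_one_smul]

variable [DecidableEq ι]

/-- As `p` is odd, `e ^ (p - 1)` is symmetric, and `p - 1 = -1` in `k` is the eigenvalue found in
`RankLeOne.mul_eq_neg`. -/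
theorem OrthTriple.hasHeight_of_rankLeOne {π e h f : Matrix ι ι k} (t : OrthTriple π e h f)
    {p : ℕ} [CharP k p] (h2 : (2 : k) ≠ 0) (hp : 0 < p) (hodd : Odd p)
    (he : e ^ p = 0) (hf : f ^ p = 0) (hre : RankLeOne (e ^ (p - 1))) (hrf : RankLeOne (f ^ (p - 1))) :
    HasHeight (p - 1) e h f := by
  have hp1 : ((p - 1 : ℕ) : k) = -1 := by
    rw [Nat.cast_sub hp, CharP.cast_eq_zero, Nat.cast_one, zero_sub]
  have hev : Even (p - 1) := by
    obtain ⟨m, rfl⟩ := hodd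
    exact ⟨m, by omega⟩
  have key {e h f : Matrix ι ι k} (t : OrthTriple π e h f) (hre : RankLeOne (e ^ (p - 1))) :
      h * e ^ (p - 1) = -e ^ (p - 1) := by
    refine hre.mul_eq_neg h2 ?_ t.transpose_h ?_
    · rw [transpose_pow_of_skew t.transpose_e, hev.neg_one_pow, one_smul]
    · rw [t.h_mul_e_pow, hp1]
      module
  refine ⟨by rwa [Nat.sub_add_cancel hp], by rwa [Nat.sub_add_cancel hp], ?_, ?_⟩
  · rw [key t hre, hp1, neg_one_smul]
  · have := key t.swap hrf
    rw [neg_mul, neg_inj] at this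
    rw [this, hp1, neg_one_smul, neg_neg]

/-- Since `ψ` is trivial on the multiplicity spaces of `e`, it has no eigenvalue `-1`. Then `1 + ψ =
(1 + ψ)ᵀ * ψ` has nonzero determinant, and cancelling gives the claim. -/
theorem det_eq_one_of_agreeOnKernels (h2 : (2 : k) ≠ 0) {e ψ : Matrix ι ι k} {N : ℕ} (he : eᵀ = -e)
    (heN : e ^ N = 0) (hψ : ψᵀ * ψ = 1) (hψe : ψ * e = e * ψ) (hR : AgreeOnKernels 1 e e 1 ψ) :
    ψ.det = 1 := by
  have hψp (m : ℕ) : ψ * e ^ m = e ^ m * ψ := (Commute.pow_right (show Commute ψ e from hψe) m).eq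
  -- Suppose `X = e ^ d * Z`. Agreement with the identity shows that `X` is orthogonal to the kernel
  -- of `e ^ (d + 1)`, hence lies in its image. So `X` is divisible by every power of `e`.
  have hker : ∀ X : Matrix ι ι k, ψ * X = -X → e * X = 0 → X = 0 := by
    intro X hX heX
    have hdiv : ∀ d, ∃ Z, X = e ^ d * Z := by
      intro d
      induction d with
      | zero => exact ⟨X, by simp⟩
      | succ d ih =>
        obtain ⟨Z, hZ⟩ := ih
        have hZe : e ^ (d + 1) * Z = 0 := by
          rw [pow_succ', Matrix.mul_assoc, ← hZ, heX]
        obtain ⟨g, hg⟩ := exists_mul_mul_eq_self (e ^ (d + 1))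
        have hy := hR d Z (1 - g * e ^ (d + 1)) hZe
          (by rw [mul_sub, mul_one, ← Matrix.mul_assoc, hg, sub_self]) (one_mul _) (one_mul _)
        rw [one_mul, ← Matrix.mul_assoc (e ^ d), ← hψp, Matrix.mul_assoc ψ, ← hZ, hX, mul_neg] at hy
        have hy0 : (1 - g * e ^ (d + 1))ᵀ * X = 0 := by
          have h3 : (2 : k) • ((1 - g * e ^ (d + 1))ᵀ * X) = 0 := by
            rw [two_smul]
            nth_rewrite 1 [← hy]
            exact neg_add_cancel _
          exact (smul_eq_zero.1 h3).resolve_left h2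
        rw [transpose_sub, transpose_one, transpose_mul, transpose_pow_of_skew he, sub_mul, one_mul,
          smul_mul_assoc, smul_mul_assoc, Matrix.mul_assoc, sub_eq_zero] at hy0
        exact ⟨(-1 : k) ^ (d + 1) • (gᵀ * X), by rw [mul_smul_comm, ← hy0]⟩
    obtain ⟨Z, hZ⟩ := hdiv N
    rw [hZ, heN, zero_mul]
  have hinj : ∀ X : Matrix ι ι k, ψ * X = -X → X = 0 := by
    intro X hX
    have : ∀ m ≤ N, e ^ (N - m) * X = 0 := by
      intro m
      induction m with
      | zero => intro _; rw [Nat.sub_zero, heN, zero_mul]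
      | succ m ih =>
        intro hm
        refine hker _ ?_ ?_
        · rw [← Matrix.mul_assoc, hψp, Matrix.mul_assoc, hX, mul_neg]
        · rw [← Matrix.mul_assoc, ← pow_succ', show N - (m + 1) + 1 = N - m by omega, ih (by omega)]
    simpa using this N le_rfl
  have hdet : (1 + ψ).det ≠ 0 := by
    intro h0
    obtain ⟨v, hv, hv0⟩ := exists_mulVec_eq_zero_iff.2 h0
    have h1 : (1 + ψ) * vecMulVec v v = 0 := by rw [mul_vecMulVec, hv0, zero_vecMulVec]
    rw [add_mul, one_mul] at h1
    have h3 := hinj _ (eq_neg_of_add_eq_zero_right h1)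
    rw [vecMulVec_eq_zero] at h3
    exact hv (h3.elim id id)
  have h1 : (1 + ψ).det = (1 + ψ).det * ψ.det := by
    conv_lhs => rw [← hψ, show ψᵀ * ψ + ψ = (1 + ψ)ᵀ * ψ by
      rw [transpose_add, transpose_one, add_mul, one_mul, add_comm]]
    rw [det_mul, det_transpose]
  exact (mul_eq_left₀ hdet).1 h1.symm

/-- Two orthogonal `sl₂`-triples with the same `e` are conjugate under the special orthogonal
group. -/
theorem OrthTriple.exists_conj {e h f h' f' : Matrix ι ι k} {p : ℕ} [CharP k p]
    (hp : p.Prime) (hp2 : 2 < p) (t : OrthTriple 1 e h f) (t' : OrthTriple 1 e h' f')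
    (he : e ^ p = 0) (hf : f ^ p = 0) (hf' : f' ^ p = 0) (hre : RankLeOne (e ^ (p - 1)))
    (hrf : RankLeOne (f ^ (p - 1))) (hrf' : RankLeOne (f' ^ (p - 1))) :
    ∃ g : Matrix ι ι k, gᵀ * g = 1 ∧ g.det = 1 ∧ g * e = e * g ∧ g * f = f' * g := by
  have hne (m : ℕ) (h0 : 0 < m) (hm : m < p) : (m : k) ≠ 0 := by
    rw [Ne, CharP.cast_eq_zero_iff k p]
    exact fun h => absurd (Nat.le_of_dvd h0 h) (by omega)
  have h2 : (2 : k) ≠ 0 := by exact_mod_cast hne 2 (by omega) hp2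
  have hodd : Odd p := hp.odd_of_ne_two (by omega)
  -- The identity commutes with the common `e`; the agreement of `ψ` with it is what controls the
  -- determinant.
  obtain ⟨ψ, hψe, hψf, -, -, hψ, hR⟩ := exists_isometry_intertwiner (p - 1) (φ := 1)
    (fun m h0 hm => hne m h0 (by omega)) t
    (t.hasHeight_of_rankLeOne h2 hp.pos hodd he hf hre hrf) t'
    (t'.hasHeight_of_rankLeOne h2 hp.pos hodd he hf' hre hrf') (by simp) (by simp) (by simp)
    (fun d x y _ _ _ _ => by simp)
  exact ⟨ψ, hψ, det_eq_one_of_agreeOnKernels h2 t.transpose_e he hψ hψe hR, hψe, hψf⟩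

end Uniqueness

end SlTwoOrbits

namespace SlTwoOrbits

open Matrix Polynomial

/-! ### Existence of Jordan types for nilpotent matrices. -/

section JordanType

variable {n : ℕ} {k : Type*} [Field k]

theorem map_part (μ : n.Partition) :
    (Finset.univ : Finset (Fin μ.parts.card)).val.map (fun i : Fin μ.parts.card => part μ i) =
      μ.parts := by
  rw [Fin.univ_val_map]
  conv_rhs => rw [← Multiset.sort_eq μ.parts (· ≥ ·)]
  congr 1
  have hlen := Multiset.length_sort (s := μ.parts) (r := (· ≥ ·))
  apply List.ext_getElem
  · rw [List.length_ofFn, hlen]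
  · intro i h1 h2
    simp [part]

theorem count_parts (μ : n.Partition) (c : ℕ) :
    Fintype.card {i : Fin μ.parts.card // part μ i = c} = μ.parts.count c := by
  conv_rhs => rw [← map_part μ]
  rw [Multiset.count_map, Fintype.card_subtype, ← Finset.filter_val, Finset.card_val]
  simp only [eq_comm]

theorem part_mem (μ : n.Partition) (i : Fin μ.parts.card) : part μ i ∈ μ.parts := by
  have h := Multiset.mem_map_of_mem (fun i : Fin μ.parts.card => part μ i) (Finset.mem_univ_val i)
  rwa [map_part] at h

theorem exists_part_eq {μ : n.Partition} {d : ℕ} (hd : d ∈ μ.parts) :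
    ∃ i : Fin μ.parts.card, part μ i = d := by
  rw [← map_part μ] at hd
  obtain ⟨i, -, hi⟩ := Multiset.mem_map.1 hd
  exact ⟨i, hi⟩

theorem part_antitone (μ : n.Partition) : Antitone (part μ) := by
  intro i j hij
  have hs : (μ.parts.sort (· ≥ ·)).Pairwise (· ≥ ·) := Multiset.pairwise_sort _ _
  rcases lt_or_ge j (μ.parts.sort (· ≥ ·)).length with hj | hj
  · rw [part, part, List.getD_eq_getElem _ _ hj, List.getD_eq_getElem _ _ (hij.trans_lt hj)]
    rcases eq_or_lt_of_le hij with rfl | hij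
    · exact le_rfl
    · exact List.pairwise_iff_getElem.1 hs i j _ hj hij
  · rw [part, List.getD_eq_default _ _ hj]
    exact Nat.zero_le _

/-- A Jordan basis with blocks indexed by an arbitrary finite type gives a Jordan type. -/
theorem exists_hasJordanType_of_basis {x : Matrix (Fin n) (Fin n) k} {κ : Type*} [Fintype κ]
    (d : κ → ℕ) (b : Module.Basis (Σ i, Fin (d i)) k (Fin n → k))
    (hb : ∀ (i : κ) (j : Fin (d i)), ((j : ℕ) = 0 → x.mulVec (b ⟨i, j⟩) = 0) ∧
      ∀ j' : Fin (d i), (j : ℕ) = j' + 1 → x.mulVec (b ⟨i, j⟩) = b ⟨i, j'⟩) :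
    ∃ μ : n.Partition, HasJordanType x μ := by
  classical
  -- Empty blocks are discarded, because parts of a partition are positive.
  let κ' := {i // d i ≠ 0}
  have hsum : ((Finset.univ : Finset κ').val.map fun i : κ' => d i.1).sum = n := by
    have h1 := Module.finrank_eq_card_basis b
    rw [Module.finrank_fin_fun, Fintype.card_sigma] at h1
    simp only [Fintype.card_fin] at h1
    rw [h1]
    change ∑ i : κ', d i.1 = ∑ i, d i
    rw [← Finset.sum_subtype (Finset.univ.filter fun i => d i ≠ 0) (by simp) d,
      Finset.sum_filter_ne_zero]
  let μ : n.Partition :=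
    { parts := (Finset.univ : Finset κ').val.map fun i : κ' => d i.1
      parts_pos := by
        intro i hi
        obtain ⟨a, -, rfl⟩ := Multiset.mem_map.1 hi
        exact Nat.pos_of_ne_zero a.2
      parts_sum := hsum }
  have hcard (c : ℕ) : Fintype.card {i : Fin μ.parts.card // part μ i = c} =
      Fintype.card {i : κ' // d i.1 = c} := by
    rw [count_parts]
    change Multiset.count c ((Finset.univ : Finset κ').val.map fun i : κ' => d i.1) = _
    rw [Multiset.count_map, Fintype.card_subtype, ← Finset.filter_val, Finset.card_val]
    simp only [eq_comm]
  -- Blocks are matched size by size, since each size occurs equally often on both sides.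
  let σ : Fin μ.parts.card ≃ κ' := Equiv.ofFiberEquiv fun c => Fintype.equivOfCardEq (hcard c)
  have hσ (i : Fin μ.parts.card) : d (σ i) = part μ i :=
    Equiv.ofFiberEquiv_map (g := fun i : κ' => d i) _ i
  let τ : (Σ i : Fin μ.parts.card, Fin (part μ i)) ≃ Σ i, Fin (d i) :=
    { toFun := fun a => ⟨(σ a.1).1, Fin.cast (hσ a.1).symm a.2⟩
      invFun := fun a => ⟨σ.symm ⟨a.1, fun h => (Fin.cast h a.2).elim0⟩,
        Fin.cast (by rw [← hσ, Equiv.apply_symm_apply]) a.2⟩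
      left_inv := by
        rintro ⟨i, j⟩
        have h1 : σ.symm ⟨(σ i).1, (σ i).2⟩ = i := by simp
        exact Sigma.ext h1 ((Fin.heq_ext_iff (congrArg (fun i : Fin _ => part μ i) h1)).2 rfl)
      right_inv := by
        rintro ⟨i, j⟩
        have h1 : (σ (σ.symm ⟨i, fun h => (Fin.cast h j).elim0⟩)).1 = i := by simp
        exact Sigma.ext h1 ((Fin.heq_ext_iff (congrArg d h1)).2 rfl) }
  refine ⟨μ, b.reindex τ.symm, fun i j => ⟨fun h0 => ?_, fun j' hj => ?_⟩⟩
  · rw [Module.Basis.reindex_apply, Equiv.symm_symm]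
    exact (hb (σ i) (Fin.cast (hσ i).symm j)).1 h0
  · rw [Module.Basis.reindex_apply, Module.Basis.reindex_apply, Equiv.symm_symm]
    exact (hb (σ i) (Fin.cast (hσ i).symm j)).2 (Fin.cast (hσ i).symm j') hj

/-- The monomials are taken in reverse order so that multiplication by `X` lowers the index, as in
`HasJordanType`. -/
theorem exists_basis_quotient_X_pow (m : ℕ) :
    ∃ β : Module.Basis (Fin m) k (k[X] ⧸ Submodule.span k[X] {(X : k[X]) ^ m}),
      ∀ j : Fin m, β j = Submodule.Quotient.mk ((X : k[X]) ^ (m - 1 - j)) := by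
  let pb := AdjoinRoot.powerBasis' (Polynomial.monic_X_pow (R := k) m)
  have hdim : pb.dim = m := Polynomial.natDegree_X_pow _
  have hpb (i : Fin pb.dim) : pb.basis i = AdjoinRoot.mk (X ^ m) (X ^ (i : ℕ)) := by
    rw [PowerBasis.basis_eq_pow, AdjoinRoot.powerBasis'_gen, map_pow, AdjoinRoot.mk_X]
  refine ⟨pb.basis.reindex ((finCongr hdim).trans Fin.revPerm), fun j => ?_⟩
  refine (Module.Basis.reindex_apply pb.basis _ j).trans ((hpb _).trans ?_)
  change Submodule.Quotient.mk _ = _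
  congr 2
  simp
  omega

/-- Through `x`, the space `k^n` is an `X`-power torsion module over the principal ideal domain
`k[X]`, hence a direct sum of modules `k[X] / (X ^ d)`. -/
theorem exists_hasJordanType {x : Matrix (Fin n) (Fin n) k} (hx : IsNilpotent x) :
    ∃ μ : n.Partition, HasJordanType x μ := by
  obtain ⟨m, hm⟩ := hx
  let φ : Module.End k (Fin n → k) := Matrix.toLin' x
  have hφ : φ ^ m = 0 := by
    change Matrix.toLin' x ^ m = 0
    rw [← Matrix.toLin'_pow, hm, map_zero]
  have htors : Module.IsTorsion' (Module.AEval' φ) (Submonoid.powers (X : k[X])) := by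
    intro v
    refine ⟨⟨X ^ m, m, rfl⟩, ?_⟩
    change (X ^ m : k[X]) • v = 0
    obtain ⟨v, rfl⟩ := (Module.AEval.of k (Fin n → k) φ).surjective v
    rw [Module.AEval.X_pow_smul_of, hφ]
    simp
  obtain ⟨N, d, ⟨E⟩⟩ := Module.torsion_by_prime_power_decomposition (p := (X : k[X]))
    Polynomial.irreducible_X htors
  choose β hβ using fun i => exists_basis_quotient_X_pow (k := k) (d i)
  have hX0 (i : Fin N) (j : Fin (d i)) (h0 : (j : ℕ) = 0) : (X : k[X]) • β i j = 0 := by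
    rw [hβ, ← Submodule.Quotient.mk_smul, Submodule.Quotient.mk_eq_zero, smul_eq_mul, ← pow_succ',
      show d i - 1 - j + 1 = d i by omega]
    exact Submodule.mem_span_singleton_self _
  have hX1 (i : Fin N) (j j' : Fin (d i)) (h : (j : ℕ) = j' + 1) : (X : k[X]) • β i j = β i j' := by
    rw [hβ, hβ, ← Submodule.Quotient.mk_smul, smul_eq_mul, ← pow_succ',
      show d i - 1 - j + 1 = d i - 1 - j' by omega]
  let B := (DFinsupp.basis β).map
    ((E.restrictScalars k).symm ≪≫ₗ (Module.AEval.of k (Fin n → k) φ).symm)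
  have hB (i : Fin N) (j : Fin (d i)) : B ⟨i, j⟩ =
      (Module.AEval.of k (Fin n → k) φ).symm (E.symm (DirectSum.of _ i (β i j))) := by
    have hsingle : DFinsupp.basis β ⟨i, j⟩ = DFinsupp.single i (β i j) := by
      apply (DFinsupp.basis β).repr.injective
      rw [Module.Basis.repr_self]
      simp [DFinsupp.basis, Equiv.eq_symm_apply, sigmaFinsuppEquivDFinsupp_single]
    simp only [B, Module.Basis.map_apply, hsingle]
    rfl
  have hxB (i : Fin N) (j : Fin (d i)) : x.mulVec (B ⟨i, j⟩) =
      (Module.AEval.of k (Fin n → k) φ).symm (E.symm (DirectSum.of _ i ((X : k[X]) • β i j))) := by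
    have h1 : DirectSum.of (fun i => k[X] ⧸ Submodule.span k[X] {(X : k[X]) ^ d i}) i
      ((X : k[X]) • β i j) = (X : k[X]) • DirectSum.of _ i (β i j) := DirectSum.of_smul _ _ _ _
    rw [hB, h1, map_smul, Module.AEval.of_symm_X_smul]
    rfl
  refine exists_hasJordanType_of_basis d B fun i j => ⟨fun h0 => ?_, fun j' hj => ?_⟩
  · rw [hxB, hX0 i j h0, map_zero, map_zero, map_zero]
  · rw [hxB, hX1 i j j' hj, hB]

end JordanType

end SlTwoOrbits

namespace SlTwoOrbits

open Matrix

/-! ### `oneNp` as a Zariski closed, stable set. -/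

section Closedness

variable {n : ℕ} {k : Type*} [Field k]

theorem lt_card_of_part_pos {μ : n.Partition} {i : ℕ} (hi : 0 < part μ i) : i < μ.parts.card := by
  by_contra h
  rw [part, List.getD_eq_default _ _ (by rw [Multiset.length_sort]; omega)] at hi
  exact lt_irrefl _ hi

section Basis

variable {x : Matrix (Fin n) (Fin n) k} {μ : n.Partition}
  {b : Module.Basis (Σ i : Fin μ.parts.card, Fin (part μ i)) k (Fin n → k)}
  (hb : ∀ (i : Fin μ.parts.card) (j : Fin (part μ i)),
      ((j : ℕ) = 0 → x.mulVec (b ⟨i, j⟩) = 0) ∧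
      ∀ j' : Fin (part μ i), (j : ℕ) = j' + 1 → x.mulVec (b ⟨i, j⟩) = b ⟨i, j'⟩)

include hb in
theorem pow_mulVec_basis (m : ℕ) (i : Fin μ.parts.card) (j j' : Fin (part μ i))
    (h : (j : ℕ) = j' + m) : (x ^ m).mulVec (b ⟨i, j⟩) = b ⟨i, j'⟩ := by
  induction m generalizing j with
  | zero =>
    rw [pow_zero, one_mulVec, show j = j' from Fin.ext h]
  | succ m ih =>
    have hlt : (j' : ℕ) + m < part μ i := by omega
    rw [pow_succ, ← mulVec_mulVec, (hb i j).2 ⟨j' + m, hlt⟩ (by rw [h]; rfl), ih ⟨j' + m, hlt⟩ rfl]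

include hb in
theorem pow_mulVec_basis_of_lt (m : ℕ) (i : Fin μ.parts.card) (j : Fin (part μ i))
    (h : (j : ℕ) < m) : (x ^ m).mulVec (b ⟨i, j⟩) = 0 := by
  have hpos : 0 < part μ i := by omega
  have h1 := pow_mulVec_basis hb j i j ⟨0, hpos⟩ (by simp)
  rw [show m = (m - 1 - j) + (1 + j) by omega, pow_add, pow_add, ← mulVec_mulVec, ← mulVec_mulVec, h1,
    pow_one, (hb i ⟨0, hpos⟩).1 rfl, mulVec_zero]

end Basis

theorem rankLeOne_of_basis {M : Matrix (Fin n) (Fin n) k} {κ : Type*}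
    (b : Module.Basis κ k (Fin n → k)) (u : Fin n → k) (h : ∀ a, ∃ c : k, M.mulVec (b a) = c • u) :
    RankLeOne M := by
  have hle : ⊤ ≤ (Submodule.span k {u}).comap (Matrix.toLin' M) := by
    rw [← b.span_eq, Submodule.span_le]
    rintro _ ⟨a, rfl⟩
    obtain ⟨c, hc⟩ := h a
    exact Submodule.mem_span_singleton.2 ⟨c, hc.symm⟩
  choose c hc using fun l => Submodule.mem_span_singleton.1 (hle (Submodule.mem_top (x := Pi.single l 1)))
  refine rankLeOne_iff.2 ⟨u, c, Matrix.ext fun i l => ?_⟩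
  have := congrFun (hc l) i
  simp only [Pi.smul_apply, smul_eq_mul, Matrix.toLin'_apply, mulVec_single_one, col_apply] at this
  rw [vecMulVec_apply, ← this, mul_comm]

theorem eq_zero_of_mulVec_basis {M : Matrix (Fin n) (Fin n) k} {κ : Type*}
    (b : Module.Basis κ k (Fin n → k)) (h : ∀ a, M.mulVec (b a) = 0) : M = 0 := by
  apply Matrix.toLin'.injective
  rw [map_zero]
  exact b.ext fun a => by simpa using h a

/-- When `x ^ p = 0`, the image of `x ^ (p - 1)` is spanned by the bottom vectors of the blocks of
size `p`, so its rank counts those blocks. -/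
theorem mem_oneNp_iff {p : ℕ} (hp : 0 < p) (x : so n k) :
    x ∈ oneNp n k p ↔ (x : Matrix (Fin n) (Fin n) k) ^ p = 0 ∧
      RankLeOne ((x : Matrix (Fin n) (Fin n) k) ^ (p - 1)) := by
  obtain ⟨x, hx⟩ := x
  constructor
  · rintro ⟨-, μ, ⟨b, hb⟩, h0, h1⟩
    have hle (i : Fin μ.parts.card) : part μ i ≤ p := (part_antitone μ (Nat.zero_le _)).trans h0
    have hlt (i : Fin μ.parts.card) (hi : (i : ℕ) ≠ 0) : part μ i < p :=
      (part_antitone μ (Nat.one_le_iff_ne_zero.2 hi)).trans_lt h1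
    refine ⟨eq_zero_of_mulVec_basis b fun a => ?_, ?_⟩
    · exact pow_mulVec_basis_of_lt hb p a.1 a.2 (a.2.2.trans_le (hle a.1))
    · by_cases hc : ∃ i : Fin μ.parts.card, part μ i = p
      · obtain ⟨i₀, hi₀⟩ := hc
        have hi₀' : (i₀ : ℕ) = 0 := by
          by_contra h
          exact (hlt i₀ h).ne hi₀
        refine rankLeOne_of_basis b (b ⟨i₀, ⟨0, by omega⟩⟩) ?_
        rintro ⟨i, j⟩
        by_cases hj : (j : ℕ) < p - 1
        · exact ⟨0, by rw [zero_smul]; exact pow_mulVec_basis_of_lt hb _ _ _ hj⟩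
        · have hi : i = i₀ := by
            by_contra h
            have h1 := hlt i fun h0 => h (Fin.ext (h0.trans hi₀'.symm))
            have h2 := j.2
            omega
          subst hi
          refine ⟨1, ?_⟩
          rw [one_smul]
          have := j.2
          exact pow_mulVec_basis hb _ i j _ (by simp only [zero_add]; omega)
      · have : x ^ (p - 1) = 0 := by
          refine eq_zero_of_mulVec_basis b fun a => pow_mulVec_basis_of_lt hb _ a.1 a.2 ?_
          have h1 := a.2.2
          have h2 := lt_of_le_of_ne (hle a.1) fun h => hc ⟨a.1, h⟩
          omega
        intro i j i' j'
        simp [this]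
  · rintro ⟨hxp, hr⟩
    have hnil : IsNilpotent x := ⟨p, hxp⟩
    obtain ⟨μ, b, hb⟩ := exists_hasJordanType hnil
    have hle : part μ 0 ≤ p := by
      by_contra! h
      have hc : 0 < μ.parts.card := lt_card_of_part_pos (by omega)
      have := pow_mulVec_basis hb p ⟨0, hc⟩ ⟨p, h⟩ ⟨0, by simp only; omega⟩ (by simp)
      rw [show x ^ p = 0 from hxp, zero_mulVec] at this
      exact b.ne_zero _ this.symm
    refine ⟨hnil, μ, ⟨b, hb⟩, hle, ?_⟩
    by_contra! h
    have hc : 1 < μ.parts.card := lt_card_of_part_pos (by omega)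
    have h0 := h.trans (part_antitone μ (Nat.zero_le 1))
    obtain ⟨u, v, huv⟩ := rankLeOne_iff.1 hr
    -- Two blocks of size at least `p` would have independent bottom vectors on the same line.
    have key (i : Fin μ.parts.card) (hi : p ≤ part μ i) :
        ∃ c : k, b ⟨i, ⟨0, by omega⟩⟩ = c • u := by
      refine ⟨v ⬝ᵥ b ⟨i, ⟨p - 1, by omega⟩⟩, ?_⟩
      rw [← pow_mulVec_basis hb (p - 1) i ⟨p - 1, by omega⟩ ⟨0, by omega⟩ (by simp),
        show x ^ (p - 1) = _ from huv, vecMulVec_mulVec]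
      simp
    obtain ⟨c₀, hc₀⟩ := key ⟨0, by omega⟩ h0
    obtain ⟨c₁, hc₁⟩ := key ⟨1, hc⟩ h
    have h2 : c₁ • b ⟨⟨0, by omega⟩, ⟨0, by simp only; omega⟩⟩ =
        c₀ • b ⟨⟨1, hc⟩, ⟨0, by simp only; omega⟩⟩ := by
      rw [hc₀, hc₁, smul_smul, smul_smul, mul_comm]
    have h3 := congrArg (fun w => b.repr w ⟨⟨0, by omega⟩, ⟨0, by simp only; omega⟩⟩) h2
    simp at h3
    rw [h3, zero_smul] at hc₁
    exact b.ne_zero _ hc₁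

theorem isZariskiClosed_oneNp {p : ℕ} (hp : 0 < p) : IsZariskiClosed (oneNp n k p) := by
  -- The equations are the entries of the `p`-th power of the generic matrix and the `2 × 2` minors
  -- of its `(p - 1)`-st power.
  let G : Matrix (Fin n) (Fin n) (MvPolynomial (Fin n × Fin n) k) := Matrix.mvPolynomialX _ _ k
  have hG (x : Matrix (Fin n) (Fin n) k) (m : ℕ) (i j : Fin n) :
      MvPolynomial.eval (fun ij : Fin n × Fin n => x ij.1 ij.2) ((G ^ m) i j) = (x ^ m) i j := by
    have h1 : (MvPolynomial.eval fun ij : Fin n × Fin n => x ij.1 ij.2).mapMatrix (G ^ m) = x ^ m := by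
      rw [map_pow, Matrix.mvPolynomialX_mapMatrix_eval]
    exact congrFun (congrFun h1 i) j
  refine ⟨Set.range (fun ij : Fin n × Fin n => (G ^ p) ij.1 ij.2) ∪
    Set.range (fun q : (Fin n × Fin n) × (Fin n × Fin n) =>
      (G ^ (p - 1)) q.1.1 q.1.2 * (G ^ (p - 1)) q.2.1 q.2.2 -
        (G ^ (p - 1)) q.1.1 q.2.2 * (G ^ (p - 1)) q.2.1 q.1.2), Set.ext fun x => ?_⟩
  rw [mem_oneNp_iff hp]
  constructor
  · rintro ⟨h1, h2⟩ q (⟨ij, rfl⟩ | ⟨q, rfl⟩)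
    · rw [hG, h1, Matrix.zero_apply]
    · rw [map_sub, map_mul, map_mul, hG, hG, hG, hG, h2, sub_self]
  · intro h
    constructor
    · ext i j
      rw [← hG, Matrix.zero_apply]
      exact h _ (Or.inl ⟨(i, j), rfl⟩)
    · intro i j i' j'
      have := h _ (Or.inr ⟨((i, j), (i', j')), rfl⟩)
      rw [map_sub, map_mul, map_mul, hG, hG, hG, hG] at this
      exact sub_eq_zero.1 this

theorem coe_smul_pow (g : OGroup n k) (x : so n k) (m : ℕ) :
    ((g • x : so n k) : Matrix (Fin n) (Fin n) k) ^ m =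
      (g : Matrix (Fin n) (Fin n) k) * (x : Matrix (Fin n) (Fin n) k) ^ m *
        ((g⁻¹ : OGroup n k) : Matrix (Fin n) (Fin n) k) := by
  induction m with
  | zero =>
    rw [pow_zero, pow_zero, mul_one, ← Submonoid.coe_mul, mul_inv_cancel, Submonoid.coe_one]
  | succ m ih =>
    rw [pow_succ, ih, coe_smul, pow_succ]
    calc _ = (g : Matrix (Fin n) (Fin n) k) * (x : Matrix (Fin n) (Fin n) k) ^ m *
          (((g⁻¹ : OGroup n k) : Matrix (Fin n) (Fin n) k) * (g : Matrix (Fin n) (Fin n) k)) *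
          (x : Matrix (Fin n) (Fin n) k) * ((g⁻¹ : OGroup n k) : Matrix (Fin n) (Fin n) k) := by
            simp only [Matrix.mul_assoc]
      _ = _ := by rw [coe_inv_mul, mul_one]; simp only [Matrix.mul_assoc]

theorem smul_mem_oneNp {p : ℕ} (hp : 0 < p) (g : OGroup n k) {x : so n k} (hx : x ∈ oneNp n k p) :
    g • x ∈ oneNp n k p := by
  rw [mem_oneNp_iff hp] at hx ⊢
  refine ⟨?_, ?_⟩
  · rw [coe_smul_pow, hx.1, mul_zero, zero_mul]
  · rw [coe_smul_pow]
    exact hx.2.mul_mul _ _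

end Closedness

end SlTwoOrbits

namespace SlTwoOrbits

open Matrix

/-! ### Centralising elements of determinant `-1`. -/

section Reflections

variable {n : ℕ} {k : Type*} [Field k]

theorem dotProduct_pow_mulVec {x : Matrix (Fin n) (Fin n) k} (hx : xᵀ = -x) (m : ℕ)
    (a c : Fin n → k) : ((x ^ m).mulVec a) ⬝ᵥ c = (-1) ^ m * (a ⬝ᵥ ((x ^ m).mulVec c)) := by
  rw [dotProduct_comm, dotProduct_mulVec, ← mulVec_transpose, transpose_pow_of_skew hx, smul_mulVec,
    smul_dotProduct, smul_eq_mul, dotProduct_comm]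

/-- A string of odd length gives an orthogonal matrix of determinant `-1` that commutes
with `e`. -/
theorem exists_det_eq_neg_one (h2 : (2 : k) ≠ 0) {e : Matrix (Fin n) (Fin n) k} (he : eᵀ = -e)
    {N : ℕ} (hN : Even N) {v : Fin n → k} (hv : (e ^ (N + 1)).mulVec v = 0)
    (hω : v ⬝ᵥ ((e ^ N).mulVec v) ≠ 0) :
    ∃ c : Matrix (Fin n) (Fin n) k, cᵀ * c = 1 ∧ c * e = e * c ∧ c.det = -1 := by
  set ω := v ⬝ᵥ ((e ^ N).mulVec v) with hωdef
  have hmid (u : Fin n → k) (m : ℕ) : (ω⁻¹ • vecMulVec u u) * e ^ m * (ω⁻¹ • vecMulVec u u) =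
      (ω⁻¹ * (u ⬝ᵥ ((e ^ m).mulVec u))) • (ω⁻¹ • vecMulVec u u) := by
    rw [smul_mul_assoc, smul_mul_assoc, Matrix.mul_assoc, mul_smul_comm, mul_vecMulVec, mul_smul_comm,
      vecMulVec_mul_vecMulVec, mul_smul]
    congr 1
    rw [smul_comm]
    congr 1
    ext i j
    simp only [vecMulVec_apply, Matrix.smul_apply, Pi.smul_apply, smul_eq_mul]
    ring
  obtain ⟨x, hx, hY⟩ := exists_isString h2 he (y := ω⁻¹ • vecMulVec v v) (N := N)
    (by rw [hN.neg_one_pow, one_smul, transpose_smul, transpose_vecMulVec])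
    (by rw [mul_smul_comm, mul_vecMulVec, hv, zero_vecMulVec, smul_zero])
    (by rw [hmid, ← hωdef, inv_mul_cancel₀ hω, one_smul])
  set v' := (1 + e * x).mulVec v with hv'
  have hYv : (1 + e * x) * (ω⁻¹ • vecMulVec v v) * (1 + e * x)ᵀ = ω⁻¹ • vecMulVec v' v' := by
    rw [mul_smul_comm, mul_vecMulVec, smul_mul_assoc, vecMulVec_mul, vecMul_transpose]
  rw [hYv] at hY
  have hv0 : v' ≠ 0 := by
    intro h0
    apply hω
    have h1 : (e ^ N).mulVec v' = (e ^ N).mulVec v := by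
      rw [hv', mulVec_mulVec, mul_add, mul_one, ← Matrix.mul_assoc, ← pow_succ, hx, add_zero]
    rw [hωdef, ← h1, h0, mulVec_zero, dotProduct_zero]
  have hgram (m : ℕ) : ω⁻¹ * (v' ⬝ᵥ ((e ^ m).mulVec v')) = if m = N then 1 else 0 := by
    have h1 := hY.mul_pow_mul_eq_ite m
    have hne : ω⁻¹ • vecMulVec v' v' ≠ 0 :=
      smul_ne_zero (inv_ne_zero hω) (vecMulVec_ne_zero hv0 hv0)
    rw [hmid] at h1
    split_ifs at h1 ⊢ with h
    · exact smul_left_injective k hne (by simpa using h1)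
    · exact (smul_eq_zero.1 h1).resolve_right hne
  set q := stringProj e N (ω⁻¹ • vecMulVec v' v') with hq
  have hqq : q * q = q := hY.stringProj_idem
  -- This is `-1` on the string and `1` on its orthogonal complement.
  refine ⟨1 - (2 : k) • q, ?_, ?_, ?_⟩
  · rw [transpose_sub, transpose_one, transpose_smul, hY.transpose_stringProj, mul_sub, mul_one,
      sub_mul, one_mul, smul_mul_smul_comm, ← hq, hqq]
    module
  · rw [sub_mul, mul_sub, one_mul, mul_one, smul_mul_assoc, mul_smul_comm, hY.stringProj_mul]
  -- The projection factors as `q = A * C` with `C * A = 1` of size `N + 1`. Swapping the factors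
  -- gives `det (1 - 2 q) = (-1) ^ (N + 1)`.
  · let A : Matrix (Fin n) (Fin (N + 1)) k := of fun l i => ((e ^ (i : ℕ)).mulVec v') l
    let C : Matrix (Fin (N + 1)) (Fin n) k := of fun i l => ω⁻¹ * (v' ᵥ* (e ^ (N - i))) l
    have hAC : q = A * C := by
      ext l l'
      rw [hq, stringProj, Finset.sum_range, Matrix.sum_apply, Matrix.mul_apply]
      refine Finset.sum_congr rfl fun i _ => ?_
      rw [mul_smul_comm, smul_mul_assoc, mul_vecMulVec, vecMulVec_mul, Matrix.smul_apply,
        vecMulVec_apply, smul_eq_mul]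
      simp only [A, C, of_apply]
      ring
    have hCA : C * A = 1 := by
      ext i j
      have h1 : (C * A) i j = ω⁻¹ * (v' ⬝ᵥ ((e ^ (N - i + j)).mulVec v')) := by
        rw [pow_add, ← mulVec_mulVec, dotProduct_mulVec, Matrix.mul_apply, dotProduct, Finset.mul_sum]
        refine Finset.sum_congr rfl fun l _ => ?_
        simp only [A, C, of_apply]
        ring
      rw [h1, hgram, Matrix.one_apply]
      have := i.2
      have := j.2
      refine if_congr ?_ rfl rfl
      rw [Fin.ext_iff]
      omega
    have h3 : 1 - (2 : k) • q = 1 + ((-(2 : k)) • A) * C := by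
      rw [hAC, Matrix.smul_mul]
      module
    have h4 : (1 : Matrix (Fin (N + 1)) (Fin (N + 1)) k) + C * ((-(2 : k)) • A) = -1 := by
      rw [Matrix.mul_smul, hCA]
      module
    rw [h3, det_one_add_mul_comm, h4, det_neg, det_one, Fintype.card_fin, mul_one]
    exact hN.add_one.neg_one_pow

section Gram

variable {x : Matrix (Fin n) (Fin n) k} {μ : n.Partition}
  {b : Module.Basis (Σ i : Fin μ.parts.card, Fin (part μ i)) k (Fin n → k)}
  (hb : ∀ (i : Fin μ.parts.card) (j : Fin (part μ i)),
      ((j : ℕ) = 0 → x.mulVec (b ⟨i, j⟩) = 0) ∧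
      ∀ j' : Fin (part μ i), (j : ℕ) = j' + 1 → x.mulVec (b ⟨i, j⟩) = b ⟨i, j'⟩)

include hb in
theorem repr_pow_mulVec (m : ℕ) (i : Fin μ.parts.card) (j j' : Fin (part μ i))
    (h : (j : ℕ) = j' + m) (w : Fin n → k) :
    b.repr ((x ^ m).mulVec w) ⟨i, j'⟩ = b.repr w ⟨i, j⟩ := by
  have : b.coord ⟨i, j'⟩ ∘ₗ Matrix.toLin' (x ^ m) = b.coord ⟨i, j⟩ := by
    refine b.ext ?_
    rintro ⟨i₂, j₂⟩
    rw [LinearMap.comp_apply, Matrix.toLin'_apply, Module.Basis.coord_apply, Module.Basis.coord_apply,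
      b.repr_self]
    rcases lt_or_ge (j₂ : ℕ) m with hj | hj
    · rw [pow_mulVec_basis_of_lt hb m i₂ j₂ hj, map_zero, Finsupp.zero_apply,
        Finsupp.single_eq_of_ne]
      rintro h1
      obtain ⟨rfl, h1⟩ := Sigma.mk.inj_iff.1 h1
      have := eq_of_heq h1
      omega
    · rw [pow_mulVec_basis hb m i₂ j₂ ⟨j₂ - m, by omega⟩ (by simp only; omega), b.repr_self]
      rw [Finsupp.single_apply, Finsupp.single_apply]
      refine if_congr ?_ rfl rfl
      constructor
      · intro h1
        obtain ⟨rfl, h1⟩ := Sigma.mk.inj_iff.1 h1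
        have h1 := Fin.ext_iff.1 (eq_of_heq h1)
        simp only at h1
        rw [show j₂ = j from Fin.ext (by omega)]
      · intro h1
        obtain ⟨rfl, h1⟩ := Sigma.mk.inj_iff.1 h1
        have h1 := Fin.ext_iff.1 (eq_of_heq h1)
        rw [show (⟨j₂ - m, by omega⟩ : Fin (part μ i₂)) = j' from Fin.ext (by simp only; omega)]
  exact LinearMap.congr_fun this w

include hb in
theorem repr_pow_mulVec_eq_zero (m : ℕ) (i : Fin μ.parts.card) (j' : Fin (part μ i))
    (h : part μ i ≤ j' + m) (w : Fin n → k) :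
    b.repr ((x ^ m).mulVec w) ⟨i, j'⟩ = 0 := by
  have : b.coord ⟨i, j'⟩ ∘ₗ Matrix.toLin' (x ^ m) = 0 := by
    refine b.ext ?_
    rintro ⟨i₂, j₂⟩
    rw [LinearMap.comp_apply, Matrix.toLin'_apply, Module.Basis.coord_apply, LinearMap.zero_apply]
    rcases lt_or_ge (j₂ : ℕ) m with hj | hj
    · rw [pow_mulVec_basis_of_lt hb m i₂ j₂ hj, map_zero, Finsupp.zero_apply]
    · rw [pow_mulVec_basis hb m i₂ j₂ ⟨j₂ - m, by omega⟩ (by simp only; omega), b.repr_self,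
        Finsupp.single_eq_of_ne]
      rintro h1
      obtain ⟨rfl, h1⟩ := Sigma.mk.inj_iff.1 h1
      have h1 := Fin.ext_iff.1 (eq_of_heq h1)
      simp only at h1
      have := j₂.2
      omega
  exact LinearMap.congr_fun this w

/-- The orthogonal complement of the kernel of a power of a skew-symmetric matrix is its image. -/
theorem exists_eq_pow_mulVec {x : Matrix (Fin n) (Fin n) k} (hx : xᵀ = -x) (d : ℕ) {v : Fin n → k}
    (hv : ∀ w, (x ^ d).mulVec w = 0 → v ⬝ᵥ w = 0) : ∃ w, v = (x ^ d).mulVec w := by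
  obtain ⟨y, hy⟩ := exists_mul_mul_eq_self (x ^ d)
  have h1 : v = v ᵥ* (y * x ^ d) := by
    have : v ᵥ* (1 - y * x ^ d) = 0 := by
      ext i
      have := hv ((1 - y * x ^ d).mulVec (Pi.single i 1)) (by
        rw [mulVec_mulVec, mul_sub, mul_one, ← Matrix.mul_assoc, hy, sub_self, zero_mulVec])
      rwa [dotProduct_mulVec, dotProduct_single_one] at this
    rwa [vecMul_sub, vecMul_one, sub_eq_zero] at this
  refine ⟨(-1 : k) ^ d • (v ᵥ* y), ?_⟩
  conv_lhs => rw [h1, ← vecMul_vecMul, ← mulVec_transpose (x ^ d), transpose_pow_of_skew hx,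
    smul_mulVec]
  rw [mulVec_smul]

include hb in
/-- The Gram matrix of the multiplicity space of the Jordan blocks of size `d`. -/
theorem exists_gram (hx : xᵀ = -x) (d : ℕ) (hd : 0 < d) :
    ∃ u : {i : Fin μ.parts.card // part μ i = d} → (Fin n → k),
      (∀ i, (x ^ d).mulVec (u i) = 0) ∧
      (of fun i i' => u i ⬝ᵥ ((x ^ (d - 1)).mulVec (u i'))).det ≠ 0 := by
  -- The top vectors of the blocks of size `d`.
  let u : {i : Fin μ.parts.card // part μ i = d} → (Fin n → k) :=
    fun i => b ⟨i.1, ⟨d - 1, by rw [i.2]; omega⟩⟩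
  have hbot (i : {i : Fin μ.parts.card // part μ i = d}) :
      (x ^ (d - 1)).mulVec (u i) = b ⟨i.1, ⟨0, by rw [i.2]; omega⟩⟩ :=
    pow_mulVec_basis hb (d - 1) i.1 _ _ (by simp)
  refine ⟨u, fun i => pow_mulVec_basis_of_lt hb d i.1 _ (by simp only; omega), fun hdet => ?_⟩
  obtain ⟨c, hc0, hc⟩ := exists_mulVec_eq_zero_iff.2 hdet
  -- A null vector of the Gram matrix produces a combination `v` of bottom vectors of blocks of size
  -- `d` that is orthogonal to the kernel of `x ^ d`. Then `v` is in the image of `x ^ d`, which has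
  -- no component along these bottom vectors.
  set v := ∑ i, c i • (x ^ (d - 1)).mulVec (u i) with hv
  have hvu (i) : u i ⬝ᵥ v = 0 := by
    have h1 := congrFun hc i
    rw [Pi.zero_apply, mulVec, dotProduct] at h1
    rw [hv, dotProduct_sum, ← h1]
    refine Finset.sum_congr rfl fun i' _ => ?_
    rw [dotProduct_smul, smul_eq_mul, of_apply, mul_comm]
  have hxv : x.mulVec v = 0 := by
    rw [hv, mulVec_sum]
    refine Finset.sum_eq_zero fun i _ => ?_
    rw [mulVec_smul, hbot, (hb _ _).1 rfl, smul_zero]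
  have hvx : v = (x ^ (d - 1)).mulVec (∑ i, c i • u i) := by
    rw [mulVec_sum]
    simp only [mulVec_smul]
    exact hv
  have hvb (i : Fin μ.parts.card) (j : Fin (part μ i)) (hj : (j : ℕ) < d) : v ⬝ᵥ b ⟨i, j⟩ = 0 := by
    rcases Nat.lt_or_ge j (d - 1) with hj1 | hj1
    · rw [hvx, dotProduct_pow_mulVec hx, pow_mulVec_basis_of_lt hb (d - 1) i j hj1, dotProduct_zero,
        mul_zero]
    · have hjd : (j : ℕ) = d - 1 := by omega
      by_cases hi : part μ i = d
      · have := hvu ⟨i, hi⟩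
        rw [dotProduct_comm] at this
        rwa [show j = ⟨d - 1, by omega⟩ from Fin.ext hjd]
      · have hlt : d < part μ i := by
          have := j.2
          omega
        rw [← (hb i ⟨d, hlt⟩).2 j (by simp only; omega), dotProduct_comm]
        have := dotProduct_pow_mulVec hx 1 (b ⟨i, ⟨d, hlt⟩⟩) v
        rw [pow_one, hxv, dotProduct_zero, mul_zero] at this
        exact this
  obtain ⟨w, hw⟩ := exists_eq_pow_mulVec hx d (v := v) (by
    intro w hw
    rw [← b.sum_repr w, dotProduct_sum]
    refine Finset.sum_eq_zero ?_
    rintro ⟨i, j⟩ -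
    rw [dotProduct_smul]
    rcases Nat.lt_or_ge j d with hj | hj
    · rw [hvb i j hj, smul_zero]
    · rw [← repr_pow_mulVec hb d i j ⟨j - d, by omega⟩ (by simp only; omega) w, hw, map_zero,
        Finsupp.zero_apply, zero_smul])
  apply hc0
  ext i
  have h1 := repr_pow_mulVec_eq_zero hb d i.1 ⟨0, by rw [i.2]; omega⟩
    (by have := i.2; simp only; omega) w
  rw [← hw, hv, map_sum, Finsupp.finsetSum_apply, Finset.sum_eq_single i] at h1
  · rw [map_smul, hbot, b.repr_self, Finsupp.smul_apply, Finsupp.single_eq_same, smul_eq_mul,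
      mul_one] at h1
    exact h1
  · intro i' _ hne
    rw [map_smul, hbot, b.repr_self, Finsupp.smul_apply, Finsupp.single_eq_of_ne, smul_zero]
    intro h
    exact hne (Subtype.ext (Sigma.mk.inj_iff.1 h).1.symm)
  · intro h
    exact absurd (Finset.mem_univ i) h

end Gram

/-- If the Jordan type is not very even, then some element of the centraliser in the orthogonal
group has determinant `-1`. -/
theorem exists_det_eq_neg_one_of_not_veryEven (h2 : (2 : k) ≠ 0) {x : Matrix (Fin n) (Fin n) k}
    (hx : xᵀ = -x) {μ : n.Partition} (hμ : HasJordanType x μ) (hne : ¬ VeryEven μ) :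
    ∃ c : Matrix (Fin n) (Fin n) k, cᵀ * c = 1 ∧ c * x = x * c ∧ c.det = -1 := by
  obtain ⟨b, hb⟩ := hμ
  obtain ⟨d, hdμ, hd⟩ : ∃ d ∈ μ.parts, ¬ (Even d ∧ Even (μ.parts.count d)) := by
    by_contra! h
    exact hne h
  have hd0 : 0 < d := μ.parts_pos hdμ
  obtain ⟨u, hu, hdet⟩ := exists_gram hb hx d hd0
  set G : Matrix _ _ k := of fun i i' => u i ⬝ᵥ ((x ^ (d - 1)).mulVec (u i')) with hG
  have hsymm (i i') : G i i' = (-1) ^ (d - 1) * G i' i := by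
    rw [hG, of_apply, of_apply, dotProduct_comm, dotProduct_pow_mulVec hx]
  rcases Nat.even_or_odd d with hev | hodd
  -- For even `d` the Gram matrix is skew-symmetric because `d - 1` is odd; of odd size, it would be
  -- singular.
  · exfalso
    have hcount : Odd (Fintype.card {i : Fin μ.parts.card // part μ i = d}) := by
      rw [count_parts, ← Nat.not_even_iff_odd]
      exact fun h => hd ⟨hev, h⟩
    have hGt : Gᵀ = -G := by
      ext i i'
      rw [transpose_apply, hsymm, (Nat.Even.sub_odd hd0 hev odd_one).neg_one_pow, Matrix.neg_apply,
        neg_one_mul]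
    have h1 : G.det = -G.det := by
      conv_lhs => rw [← det_transpose, hGt, det_neg, hcount.neg_one_pow, neg_one_mul]
    have h3 : (2 : k) * G.det = 0 := by
      rw [two_mul]
      nth_rewrite 1 [h1]
      exact neg_add_cancel _
    exact hdet ((mul_eq_zero.1 h3).resolve_left h2)
  · have hev : Even (d - 1) := Nat.Odd.sub_odd hodd odd_one
    obtain ⟨i₀, hi₀⟩ := exists_part_eq hdμ
    -- For odd `d` the Gram matrix is symmetric and nonzero, and polarisation yields a vector of
    -- nonzero norm.
    obtain ⟨i, i', hii⟩ : ∃ i i', G i i' ≠ 0 := by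
      by_contra! h
      apply hdet
      have : Nonempty {i : Fin μ.parts.card // part μ i = d} := ⟨⟨i₀, hi₀⟩⟩
      rw [show G = 0 from Matrix.ext h, det_zero]
    have main (v : Fin n → k) (hv : (x ^ d).mulVec v = 0)
        (hω : v ⬝ᵥ ((x ^ (d - 1)).mulVec v) ≠ 0) :
        ∃ c : Matrix (Fin n) (Fin n) k, cᵀ * c = 1 ∧ c * x = x * c ∧ c.det = -1 :=
      exists_det_eq_neg_one h2 hx hev (by rwa [Nat.sub_add_cancel hd0]) hω
    by_cases h1 : G i i = 0
    · by_cases h3 : G i' i' = 0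
      · refine main (u i + u i') (by rw [mulVec_add, hu, hu, add_zero]) ?_
        have : (u i + u i') ⬝ᵥ ((x ^ (d - 1)).mulVec (u i + u i')) =
            G i i + G i i' + (G i' i + G i' i') := by
          rw [mulVec_add, add_dotProduct, dotProduct_add, dotProduct_add]
          rfl
        rw [this, h1, h3, hsymm i' i, hev.neg_one_pow, one_mul, zero_add, add_zero, ← two_mul]
        exact mul_ne_zero h2 hii
      · exact main (u i') (hu i') h3
    · exact main (u i) (hu i) h1

end Reflections

end SlTwoOrbits

namespace SlTwoOrbits

open Matrix

/-! ### Stable Lagrangian subspaces and determinant `1`. -/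

section Lagrangian

variable {n : ℕ} {k : Type*} [Field k]

/-- An orthogonal matrix that stabilises a Lagrangian subspace has determinant `1`. -/
theorem det_eq_one_of_stable_lagrangian {g : Matrix (Fin n) (Fin n) k} (hg : gᵀ * g = 1)
    (L : Submodule k (Fin n → k)) (hL : ∀ u ∈ L, ∀ v ∈ L, u ⬝ᵥ v = 0)
    (hdim : n ≤ 2 * Module.finrank k L) (h1 : ∀ u ∈ L, g.mulVec u ∈ L)
    (h2 : ∀ u ∈ L, gᵀ.mulVec u ∈ L) : g.det = 1 := by
  have hg' : g * gᵀ = 1 := mul_eq_one_comm.1 hg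
  let ψ : (Fin n → k) →ₗ[k] Module.Dual k (Fin n → k) := dotProductBilin k k
  let φ : (Fin n → k) →ₗ[k] Module.Dual k L := L.subtype.dualMap ∘ₗ ψ
  have hφ (v : Fin n → k) (u : L) : φ v u = v ⬝ᵥ (u : Fin n → k) := rfl
  have hker : L ≤ LinearMap.ker φ := fun v hv => by
    rw [LinearMap.mem_ker]
    ext u
    exact hL v hv u u.2
  have hsurj : Function.Surjective (L.liftQ φ hker) := by
    intro α
    obtain ⟨β, hβ⟩ := Subspace.dualRestrict_surjective (W := L) α
    refine ⟨Submodule.Quotient.mk fun i => β (Pi.single i 1), ?_⟩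
    rw [← hβ]
    ext u
    change (fun i => β (Pi.single i 1)) ⬝ᵥ (u : Fin n → k) = β u
    conv_rhs => rw [pi_eq_sum_univ' (u : Fin n → k), map_sum]
    refine Finset.sum_congr rfl fun i _ => ?_
    rw [map_smul, smul_eq_mul, mul_comm]
  have hfin : Module.finrank k ((Fin n → k) ⧸ L) = Module.finrank k (Module.Dual k L) := by
    refine le_antisymm ?_ (LinearMap.finrank_le_finrank_of_surjective hsurj)
    have := L.finrank_quotient_add_finrank
    rw [Module.finrank_fin_fun] at this
    rw [Subspace.dual_finrank_eq]
    omega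
  let E := LinearEquiv.ofBijective (L.liftQ φ hker)
    ⟨(LinearMap.injective_iff_surjective_of_finrank_eq_finrank hfin).2 hsurj, hsurj⟩
  have hgL : L ≤ L.comap (toLin' g) := fun u hu => by simpa using h1 u hu
  have hgtL : L ≤ L.comap (toLin' gᵀ) := fun u hu => by simpa using h2 u hu
  -- The form identifies `k^n / L` with the dual of `L`, and `g` on the quotient becomes the dual of
  -- `gᵀ` on `L`. So `det g` is the determinant of `g * gᵀ = 1` on `L`.
  have hconj : (E : _ →ₗ[k] _) ∘ₗ L.mapQ L (toLin' g) hgL ∘ₗ (E.symm : _ →ₗ[k] _) =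
      ((toLin' gᵀ).restrict hgtL).dualMap := by
    rw [← LinearMap.comp_assoc, LinearEquiv.comp_toLinearMap_symm_eq]
    apply Submodule.linearMap_qext
    refine LinearMap.ext fun v => LinearMap.ext fun u => ?_
    change g.mulVec v ⬝ᵥ (u : Fin n → k) = v ⬝ᵥ gᵀ.mulVec u
    rw [dotProduct_mulVec, vecMul_transpose]
  have hdet := LinearMap.det_eq_det_mul_det L (toLin' g) hgL
  rw [← LinearMap.det_conj (L.mapQ L (toLin' g) hgL) E, hconj, LinearMap.det_dualMap,
    LinearMap.det_toLin', ← LinearMap.det_comp] at hdet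
  rw [hdet]
  convert LinearMap.det_id (M := L) (A := k)
  ext1 u
  apply Subtype.ext
  change g.mulVec (gᵀ.mulVec u) = u
  rw [mulVec_mulVec, hg', one_mulVec]

/-- If all Jordan blocks of the skew-symmetric matrix `x` have even size, then the centraliser of
`x` in the orthogonal group consists of matrices of determinant `1`. -/
theorem det_eq_one_of_forall_even {x g : Matrix (Fin n) (Fin n) k} (hx : xᵀ = -x)
    {μ : n.Partition} (hμ : HasJordanType x μ) (hev : ∀ d ∈ μ.parts, Even d) (hg : gᵀ * g = 1)
    (hgx : g * x = x * g) : g.det = 1 := by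
  obtain ⟨b, hb⟩ := hμ
  -- The sum of the spaces `x ^ m (ker x ^ (2 m))` is defined without a basis, so the centraliser
  -- stabilises it. It is isotropic because `x ^ (m + m')` kills `ker x ^ (2 m)` for `m ≤ m'`, and
  -- it contains the lower half of every even block, hence has dimension at least `n / 2`.
  let S (m : ℕ) : Submodule k (Fin n → k) :=
    (LinearMap.ker (toLin' (x ^ (2 * m)))).map (toLin' (x ^ m))
  have hS {m : ℕ} {u : Fin n → k} : u ∈ S m ↔ ∃ a, (x ^ (2 * m)).mulVec a = 0 ∧ (x ^ m).mulVec a = u := by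
    simp only [S, Submodule.mem_map, LinearMap.mem_ker, toLin'_apply]
  have hstab {h : Matrix (Fin n) (Fin n) k} (hhx : h * x = x * h) (u : Fin n → k)
      (hu : u ∈ ⨆ m, S m) : h.mulVec u ∈ ⨆ m, S m := by
    have hle : ⨆ m, S m ≤ (⨆ m, S m).comap (toLin' h) := by
      refine iSup_le fun m u hu => ?_
      obtain ⟨a, ha, rfl⟩ := hS.1 hu
      have hc (l : ℕ) : h * x ^ l = x ^ l * h := (show Commute h x from hhx).pow_right l
      refine Submodule.mem_iSup_of_mem m (hS.2 ⟨h.mulVec a, ?_, ?_⟩)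
      · rw [mulVec_mulVec, ← hc, ← mulVec_mulVec, ha, mulVec_zero]
      · rw [toLin'_apply, mulVec_mulVec, mulVec_mulVec, hc]
    simpa using hle hu
  have hiso' {m m' : ℕ} (hmm : m ≤ m') {u v : Fin n → k} (hu : u ∈ S m) (hv : v ∈ S m') :
      u ⬝ᵥ v = 0 := by
    obtain ⟨a, ha, rfl⟩ := hS.1 hu
    obtain ⟨a', -, rfl⟩ := hS.1 hv
    rw [dotProduct_comm, dotProduct_pow_mulVec hx, mulVec_mulVec, ← pow_add,
      show m' + m = (m' - m) + 2 * m by omega, pow_add, ← mulVec_mulVec, ha, mulVec_zero,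
      dotProduct_zero, mul_zero]
  have hiso : ∀ u ∈ ⨆ m, S m, ∀ v ∈ ⨆ m, S m, u ⬝ᵥ v = 0 := by
    intro u hu v hv
    induction hu using Submodule.iSup_induction' with
    | zero => exact zero_dotProduct _
    | add y z _ _ hy hz => rw [add_dotProduct, hy, hz, add_zero]
    | mem m u hu =>
      induction hv using Submodule.iSup_induction' with
      | zero => exact dotProduct_zero _
      | add y z _ _ hy hz => rw [dotProduct_add, hy, hz, add_zero]
      | mem m' v hv =>
        rcases le_total m m' with h | h
        · exact hiso' h hu hv
        · rw [dotProduct_comm]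
          exact hiso' h hv hu
  have hev' (i : Fin μ.parts.card) : part μ i / 2 * 2 = part μ i :=
    Nat.div_mul_cancel (even_iff_two_dvd.1 (hev _ (part_mem μ i)))
  have hlt (i : Fin μ.parts.card) (j : Fin (part μ i / 2)) : (j : ℕ) < part μ i :=
    j.2.trans_le (Nat.div_le_self _ _)
  have hmem (i : Fin μ.parts.card) (j : Fin (part μ i / 2)) :
      b ⟨i, ⟨j, hlt i j⟩⟩ ∈ ⨆ m, S m := by
    have h : (j : ℕ) + part μ i / 2 < part μ i := by
      have := Nat.add_lt_add_right j.2 (part μ i / 2)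
      rwa [← mul_two, hev'] at this
    refine Submodule.mem_iSup_of_mem (part μ i / 2)
      (hS.2 ⟨b ⟨i, ⟨j + part μ i / 2, h⟩⟩, ?_, ?_⟩)
    · exact pow_mulVec_basis_of_lt hb _ _ _ (by rwa [mul_comm, hev'])
    · exact pow_mulVec_basis hb _ _ _ _ rfl
  refine det_eq_one_of_stable_lagrangian hg (⨆ m, S m) hiso ?_ (hstab hgx) (hstab ?_)
  · let c : (Σ i : Fin μ.parts.card, Fin (part μ i / 2)) → (⨆ m, S m : Submodule k (Fin n → k)) :=
      fun ij => ⟨b ⟨ij.1, ⟨ij.2, hlt ij.1 ij.2⟩⟩, hmem ij.1 ij.2⟩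
    have hc : LinearIndependent k c := by
      apply LinearIndependent.of_comp (Submodule.subtype _)
      refine b.linearIndependent.comp
        (fun ij : Σ i : Fin μ.parts.card, Fin (part μ i / 2) => ⟨ij.1, ⟨ij.2, hlt ij.1 ij.2⟩⟩) ?_
      rintro ⟨i, j⟩ ⟨i', j'⟩ h
      obtain ⟨rfl, h⟩ := Sigma.mk.inj_iff.1 h
      have := Fin.ext_iff.1 (eq_of_heq h)
      simp only at this
      rw [Fin.ext this]
    have h1 := hc.fintype_card_le_finrank
    have h2 : Module.finrank k (Fin n → k) = _ := Module.finrank_eq_card_basis b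
    rw [Fintype.card_sigma] at h1 h2
    simp only [Fintype.card_fin, Module.finrank_fin_fun] at h1 h2
    have h3 : n = (∑ i : Fin μ.parts.card, part μ i / 2) * 2 := by
      rw [Finset.sum_mul]
      refine h2.trans ?_
      exact Finset.sum_congr rfl fun i _ => (hev' i).symm
    omega
  · have h1 := congrArg Matrix.transpose hgx
    rw [transpose_mul, transpose_mul, hx, neg_mul, mul_neg, neg_inj] at h1
    exact h1.symm

end Lagrangian

end SlTwoOrbits

namespace SlTwoOrbits

open Matrix

/-! ### Splitting of `O_n`-orbits into `SO_n`-orbits. -/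

section Splitting

variable {n : ℕ} {k : Type*} [Field k]

theorem coe_transpose_mul (g : OGroup n k) :
    (g : Matrix (Fin n) (Fin n) k)ᵀ * (g : Matrix (Fin n) (Fin n) k) = 1 := by
  rw [← coe_inv_eq_transpose, coe_inv_mul]

theorem mem_SO {g : OGroup n k} : g ∈ SO n k ↔ (g : Matrix (Fin n) (Fin n) k).det = 1 := Iff.rfl

theorem det_eq_one_or_neg_one (g : OGroup n k) :
    (g : Matrix (Fin n) (Fin n) k).det = 1 ∨ (g : Matrix (Fin n) (Fin n) k).det = -1 := by
  have h := congrArg Matrix.det (coe_transpose_mul g)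
  rw [det_mul, det_transpose, det_one] at h
  exact mul_self_eq_one_iff.1 h

theorem mul_mem_SO_of_det_eq_neg_one {g c : OGroup n k}
    (hg : (g : Matrix (Fin n) (Fin n) k).det = -1) (hc : (c : Matrix (Fin n) (Fin n) k).det = -1) :
    g * c ∈ SO n k := by
  rw [mem_SO, Submonoid.coe_mul, det_mul, hg, hc, neg_mul_neg, one_mul]

theorem orbit_smul_eq {Γ X : Type*} [Group Γ] [MulAction Γ X] (G : Subgroup Γ) {g : Γ} (hg : g ∈ G)
    (x : X) : MulAction.orbit G (g • x) = MulAction.orbit G x :=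
  MulAction.orbit_eq_iff.2 ⟨⟨g, hg⟩, rfl⟩

theorem exists_smul_eq_of_orbit_eq {Γ X : Type*} [Group Γ] [MulAction Γ X] {G : Subgroup Γ} {x y : X}
    (h : MulAction.orbit G x = MulAction.orbit G y) : ∃ g ∈ G, g • y = x := by
  obtain ⟨g, hg⟩ := MulAction.orbit_eq_iff.1 h
  exact ⟨g, g.2, hg⟩

theorem smul_eq_self_iff (g : OGroup n k) (x : so n k) :
    g • x = x ↔ (g : Matrix (Fin n) (Fin n) k) * (x : Matrix (Fin n) (Fin n) k) =
      (x : Matrix (Fin n) (Fin n) k) * (g : Matrix (Fin n) (Fin n) k) := by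
  rw [Subtype.ext_iff, coe_smul]
  constructor
  · intro h
    conv_rhs => rw [← h, mul_assoc, coe_inv_mul, mul_one]
  · intro h
    rw [h, mul_assoc, ← Submonoid.coe_mul, mul_inv_cancel, Submonoid.coe_one, mul_one]

/-- An orthogonal matrix, given by `cᵀ c = 1`, as an element of `O_n(k)`. -/
def toOGroup (c : Matrix (Fin n) (Fin n) k) (hc : cᵀ * c = 1) : OGroup n k :=
  ⟨c, (Matrix.mem_orthogonalGroup_iff' (Fin n) k).2 hc⟩

theorem ncard_splitting_eq_one {X : Type*} [MulAction (OGroup n k) X] {x : X} {c : OGroup n k}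
    (hc : (c : Matrix (Fin n) (Fin n) k).det = -1) (hcx : c • x = x) :
    (splitting n k x).ncard = 1 := by
  rw [Set.ncard_eq_one]
  refine ⟨MulAction.orbit (SO n k) x, Set.eq_singleton_iff_unique_mem.2
    ⟨⟨x, MulAction.mem_orbit_self x, rfl⟩, ?_⟩⟩
  rintro _ ⟨_, ⟨g, rfl⟩, rfl⟩
  change MulAction.orbit (SO n k) (g • x) = _
  rcases det_eq_one_or_neg_one g with hg | hg
  · exact orbit_smul_eq _ hg x
  · nth_rewrite 1 [← hcx]
    rw [← mul_smul]
    exact orbit_smul_eq _ (mul_mem_SO_of_det_eq_neg_one hg hc) x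

theorem ncard_splitting_eq_two (h2 : (2 : k) ≠ 0) {X : Type*} [MulAction (OGroup n k) X] {x : X}
    {r : OGroup n k} (hr : (r : Matrix (Fin n) (Fin n) k).det = -1)
    (hx : ∀ c : OGroup n k, c • x = x → c ∈ SO n k) : (splitting n k x).ncard = 2 := by
  have h11 : (-1 : k) ≠ 1 := fun h => h2 (by linear_combination -h)
  rw [Set.ncard_eq_two]
  refine ⟨MulAction.orbit (SO n k) x, MulAction.orbit (SO n k) (r • x), ?_, ?_⟩
  · intro h
    obtain ⟨g, hg, hgx⟩ := exists_smul_eq_of_orbit_eq h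
    rw [← mul_smul] at hgx
    have h1 := hx _ hgx
    rw [mem_SO, Submonoid.coe_mul, det_mul, mem_SO.1 hg, hr, one_mul] at h1
    exact h11 h1
  · ext C
    rw [Set.mem_insert_iff, Set.mem_singleton_iff]
    constructor
    · rintro ⟨_, ⟨g, rfl⟩, rfl⟩
      change MulAction.orbit (SO n k) (g • x) = _ ∨ MulAction.orbit (SO n k) (g • x) = _
      rcases det_eq_one_or_neg_one g with hg | hg
      · exact Or.inl (orbit_smul_eq _ hg x)
      · right
        have hr' : ((r⁻¹ : OGroup n k) : Matrix (Fin n) (Fin n) k).det = -1 := by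
          rw [coe_inv_eq_transpose, det_transpose, hr]
        rw [show g • x = (g * r⁻¹) • r • x by rw [← mul_smul, inv_mul_cancel_right]]
        exact orbit_smul_eq _ (mul_mem_SO_of_det_eq_neg_one hg hr') _
    · rintro (rfl | rfl)
      · exact ⟨x, MulAction.mem_orbit_self x, rfl⟩
      · exact ⟨r • x, MulAction.mem_orbit x r, rfl⟩

theorem exists_det_coe_eq_neg_one (h2 : (2 : k) ≠ 0) (hn : 1 ≤ n) :
    ∃ r : OGroup n k, (r : Matrix (Fin n) (Fin n) k).det = -1 := by
  -- With `e = 0` and `N = 0` the construction is the reflection in a unit coordinate vector.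
  obtain ⟨c, hc, -, hdet⟩ := exists_det_eq_neg_one h2 (n := n) (k := k) (e := 0) (by simp) (N := 0)
    Even.zero (v := Pi.single ⟨0, hn⟩ 1)
    (by rw [zero_add, pow_one, zero_mulVec]) (by simp)
  exact ⟨toOGroup c hc, hdet⟩

theorem transpose_coe (x : so n k) :
    (x : Matrix (Fin n) (Fin n) k)ᵀ = -(x : Matrix (Fin n) (Fin n) k) :=
  (LieAlgebra.Orthogonal.mem_so (Fin n) k _).1 x.2

theorem ncard_splitting_of_veryEven (h2 : (2 : k) ≠ 0) (hn : 1 ≤ n) (x : so n k) {μ : n.Partition}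
    (hμ : HasJordanType (x : Matrix (Fin n) (Fin n) k) μ) (hev : VeryEven μ) :
    (splitting n k x).ncard = 2 := by
  obtain ⟨r, hr⟩ := exists_det_coe_eq_neg_one (k := k) h2 hn
  refine ncard_splitting_eq_two h2 hr fun c hc => ?_
  exact det_eq_one_of_forall_even (transpose_coe x) hμ (fun d hd => (hev d hd).1)
    (coe_transpose_mul c) ((smul_eq_self_iff c x).1 hc)

theorem ncard_splitting_of_not_veryEven (h2 : (2 : k) ≠ 0) (x : so n k) {μ : n.Partition}
    (hμ : HasJordanType (x : Matrix (Fin n) (Fin n) k) μ) (hev : ¬ VeryEven μ) :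
    (splitting n k x).ncard = 1 := by
  obtain ⟨c, hc, hcx, hdet⟩ := exists_det_eq_neg_one_of_not_veryEven h2 (transpose_coe x) hμ hev
  exact ncard_splitting_eq_one (c := toOGroup c hc) hdet ((smul_eq_self_iff _ x).2 hcx)

end Splitting

/-! ### The bijections between orbits of triples and orbits of nilpotent elements. -/

section SlTwoProperty

variable {n : ℕ} {k : Type*} [Field k]

theorem Triple.orthTriple (t : Triple (so n k)) :
    OrthTriple (1 : Matrix (Fin n) (Fin n) k) t.e t.h t.f where
  transpose_proj := transpose_one
  proj_idem := one_mul 1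
  transpose_e := transpose_coe t.e
  transpose_f := transpose_coe t.f
  lie_h_e := by
    have h := congrArg Subtype.val t.lie_h_e
    rw [LieSubalgebra.coe_bracket, Ring.lie_def] at h
    exact h.trans ((two_nsmul _).trans (two_smul k _).symm)
  lie_h_f := by
    have h := congrArg Subtype.val t.lie_h_f
    rw [LieSubalgebra.coe_bracket, Ring.lie_def] at h
    exact h.trans (congrArg Neg.neg ((two_nsmul _).trans (two_smul k _).symm))
  lie_e_f := by
    have h := congrArg Subtype.val t.lie_e_f
    rwa [LieSubalgebra.coe_bracket, Ring.lie_def] at h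
  proj_mul_e := one_mul _
  proj_mul_f := one_mul _

/-- The triple in `so_n(k)` given by matrices. -/
def OrthTriple.toTriple {e h f : Matrix (Fin n) (Fin n) k} (t : OrthTriple 1 e h f) :
    Triple (so n k) where
  e := ⟨e, (LieAlgebra.Orthogonal.mem_so (Fin n) k _).2 t.transpose_e⟩
  h := ⟨h, (LieAlgebra.Orthogonal.mem_so (Fin n) k _).2 t.transpose_h⟩
  f := ⟨f, (LieAlgebra.Orthogonal.mem_so (Fin n) k _).2 t.transpose_f⟩
  lie_h_e := Subtype.ext (by
    rw [LieSubalgebra.coe_bracket, Ring.lie_def, t.lie_h_e, two_smul]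
    exact (two_nsmul _).symm)
  lie_h_f := Subtype.ext (by
    rw [LieSubalgebra.coe_bracket, Ring.lie_def, t.lie_h_f, two_smul]
    exact congrArg Neg.neg (two_nsmul _).symm)
  lie_e_f := Subtype.ext (by rw [LieSubalgebra.coe_bracket, Ring.lie_def, t.lie_e_f])

variable {p : ℕ} [CharP k p]

theorem two_ne_zero_of_charP (k : Type*) [Field k] {p : ℕ} [CharP k p] (hp2 : 2 < p) :
    (2 : k) ≠ 0 := by
  have := (CharP.cast_eq_zero_iff k p 2).not.2 (Nat.not_dvd_of_pos_of_lt two_pos hp2)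
  exact_mod_cast this

/-- The factorisation of `f ^ (p - 1)` through `e ^ (p - 1)` transfers the rank bound, which keeps
`f` in the same set. -/
theorem exists_triple_of_mem_oneNp (hp : p.Prime) (hp2 : 2 < p) {e : so n k}
    (he : e ∈ oneNp n k p) : ∃ t : Triple (so n k), t.e = e ∧ t.f ∈ oneNp n k p := by
  have h2 : (2 : k) ≠ 0 := two_ne_zero_of_charP k hp2
  obtain ⟨he0, her⟩ := (mem_oneNp_iff hp.pos e).1 he
  have hp1 : p - 1 + 1 = p := Nat.sub_add_cancel hp.one_le
  obtain ⟨h, f, t, hf, z, w, hzw⟩ := exists_orthTriple h2 (p - 1) 1 (e : Matrix (Fin n) (Fin n) k)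
    transpose_one (one_mul 1) (transpose_coe e) (one_mul _) (by rwa [hp1])
  refine ⟨t.toTriple, rfl, (mem_oneNp_iff hp.pos _).2 ⟨by rwa [hp1] at hf, ?_⟩⟩
  change RankLeOne (f ^ (p - 1))
  rw [hzw]
  exact her.mul_mul z w

theorem exists_smul_eq_of_e_eq (hp : p.Prime) (hp2 : 2 < p) {t t' : Triple (so n k)}
    (he : t.e ∈ oneNp n k p) (hf : t.f ∈ oneNp n k p) (hf' : t'.f ∈ oneNp n k p)
    (h : t.e = t'.e) : ∃ g ∈ SO n k, g • t = t' := by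
  have T' := t'.orthTriple
  rw [← h] at T'
  obtain ⟨he0, her⟩ := (mem_oneNp_iff hp.pos _).1 he
  obtain ⟨hf0, hfr⟩ := (mem_oneNp_iff hp.pos _).1 hf
  obtain ⟨hf0', hfr'⟩ := (mem_oneNp_iff hp.pos _).1 hf'
  obtain ⟨g, hg, hdet, hge, hgf⟩ := t.orthTriple.exists_conj hp hp2 T' he0 hf0 hf0' her hfr hfr'
  have h1 : toOGroup g hg • t.e = t'.e := by rw [← h, smul_eq_self_iff]; exact hge
  have h2 : toOGroup g hg • t.f = t'.f := by
    apply Subtype.ext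
    rw [coe_smul]
    change g * _ * _ = _
    rw [hgf, mul_assoc]
    change _ * (((toOGroup g hg : OGroup n k) : Matrix (Fin n) (Fin n) k) * _) = _
    rw [← Submonoid.coe_mul, mul_inv_cancel, Submonoid.coe_one, mul_one]
  refine ⟨toOGroup g hg, hdet, Triple.ext h1 ?_ h2⟩
  change toOGroup g hg • t.h = t'.h
  rw [← t.lie_e_f, ← t'.lie_e_f, smul_lie, h1, h2]

/-- Injectivity for both (a) and (c): an element of `SO` first makes the two `e` equal, then
`exists_smul_eq_of_e_eq` applies. -/
theorem orbit_eq_of_eImage_eq (hp : p.Prime) (hp2 : 2 < p) {t t' : Triple (so n k)}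
    (he : t.e ∈ oneNp n k p) (hf : t.f ∈ oneNp n k p) (hf' : t'.f ∈ oneNp n k p)
    (h : eImage (MulAction.orbit (SO n k) t) = eImage (MulAction.orbit (SO n k) t')) :
    MulAction.orbit (SO n k) t = MulAction.orbit (SO n k) t' := by
  rw [eImage_orbit, eImage_orbit] at h
  obtain ⟨g, hg, hgt⟩ := exists_smul_eq_of_orbit_eq h
  rw [← orbit_smul_eq _ hg t']
  obtain ⟨c, hc, hct⟩ := exists_smul_eq_of_e_eq hp hp2 (t := t) (t' := g • t') he hf
    (smul_mem_oneNp hp.pos g hf') hgt.symm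
  rw [← hct, orbit_smul_eq _ hc]

theorem slTwoProperty_oneNp (hp : p.Prime) (hp2 : 2 < p) :
    SlTwoProperty (SO n k) (oneNp n k p) where
  subset_nilCone _ hx := hx.1
  closed := isZariskiClosed_oneNp hp.pos
  stable g _ _ hx := smul_mem_oneNp hp.pos g hx
  bijOn := by
    refine ⟨?_, ?_, ?_⟩
    · rintro _ ⟨t, ht, rfl⟩
      exact ⟨t.e, ht.1, eImage_orbit _ t⟩
    · rintro _ ⟨t, ht, rfl⟩ _ ⟨t', ht', rfl⟩ h
      exact orbit_eq_of_eImage_eq hp hp2 ht.1 ht.2 ht'.2 h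
    · rintro _ ⟨e, he, rfl⟩
      obtain ⟨t, rfl, hf⟩ := exists_triple_of_mem_oneNp hp hp2 he
      exact ⟨_, ⟨t, ⟨he, hf⟩, rfl⟩, eImage_orbit _ t⟩

theorem bijOn_splitting (hp : p.Prime) (hp2 : 2 < p) {t : Triple (so n k)}
    (he : t.e ∈ oneNp n k p) (hf : t.f ∈ oneNp n k p) :
    Set.BijOn eImage (splitting n k t) (splitting n k t.e) := by
  refine ⟨?_, ?_, ?_⟩
  · rintro _ ⟨_, ⟨g, rfl⟩, rfl⟩
    exact ⟨g • t.e, ⟨g, rfl⟩, eImage_orbit _ (g • t)⟩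
  · rintro _ ⟨_, ⟨g, rfl⟩, rfl⟩ _ ⟨_, ⟨g', rfl⟩, rfl⟩ h
    exact orbit_eq_of_eImage_eq hp hp2 (t := g • t) (t' := g' • t) (smul_mem_oneNp hp.pos g he)
      (smul_mem_oneNp hp.pos g hf) (smul_mem_oneNp hp.pos g' hf) h
  · rintro _ ⟨_, ⟨g, rfl⟩, rfl⟩
    exact ⟨_, ⟨g • t, ⟨g, rfl⟩, rfl⟩, eImage_orbit _ (g • t)⟩

end SlTwoProperty

end SlTwoOrbits

theorem proposition4p6 {k : Type*} [Field k] [IsAlgClosed k] (p : ℕ) [CharP k p] (hp : 2 < p)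
    (n : ℕ) (hn : 1 ≤ n) :
    SlTwoOrbits.SlTwoProperty (SlTwoOrbits.SO n k) (SlTwoOrbits.oneNp n k p) ∧
    (∀ x ∈ SlTwoOrbits.nilCone n k, ∀ μ : n.Partition,
      SlTwoOrbits.HasJordanType (x : Matrix (Fin n) (Fin n) k) μ →
        (SlTwoOrbits.VeryEven μ → (SlTwoOrbits.splitting n k x).ncard = 2) ∧
        (¬ SlTwoOrbits.VeryEven μ → (SlTwoOrbits.splitting n k x).ncard = 1)) ∧
    (∀ t : SlTwoOrbits.Triple (SlTwoOrbits.so n k),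
      t.e ∈ SlTwoOrbits.oneNp n k p → t.f ∈ SlTwoOrbits.oneNp n k p →
        Set.BijOn SlTwoOrbits.eImage (SlTwoOrbits.splitting n k t) (SlTwoOrbits.splitting n k t.e)) := by
  -- The bound `2 < p` excludes characteristic zero, so `p` is prime.
  have hp' : p.Prime := (CharP.char_is_prime_or_zero k p).resolve_right (by omega)
  have h2 := SlTwoOrbits.two_ne_zero_of_charP k hp
  exact ⟨SlTwoOrbits.slTwoProperty_oneNp hp' hp,
    fun x _ _ hμ => ⟨SlTwoOrbits.ncard_splitting_of_veryEven h2 hn x hμ,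
      SlTwoOrbits.ncard_splitting_of_not_veryEven h2 x hμ⟩,
    fun _ he hf => SlTwoOrbits.bijOn_splitting hp' hp he hf⟩
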